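/- All strings are over the alphabet $\{0,1\}$ and all languages are sets of such strings. Oracle Turing machines are polynomially clocked, with clocks that do not depend on the oracle. Let $A$ be any set of strings. $\mathrm{NP}^A$ is the class of languages accepted by nondeterministic polynomial-time Turing machines with oracle $A$, and $\mathrm{coNP}^A$ is the class of the complements of its members. $\mathrm{FP}_t$ and $\mathrm{FP}_t^A$ are the classes of total functions on strings computable in deterministic polynomial time without an oracle and with oracle $A$, respectively. $\mathrm{NPSV}_t^A$ is the class of total functions $f$ for which there is a nondeterministic polynomial-time Turing machine with oracle $A$ that on every input $x$ has at least one accepting path, and all of whose accepting paths on $x$ output $f(x)$. For languages $L, B$ we write $L\leq_m^p B$ (respectively $L\leq_m^{p,A}B$) if there is $f\in\mathrm{FP}_t$ (respectively $f\in \mathrm{FP}_t^A$) with $x\in L\iff f(x)\in B$ for all $x$. We write $L\leq_{1\text{-}tt}^{p}B$ (respectively $L\leq_{1\text{-}tt}^{p,A}B$, $L\leq_{1\text{-}tt}^{\mathcal{SN},A}B$) if there is a function in $\mathrm{FP}_t$ (respectively $\mathrm{FP}_t^A$, $\mathrm{NPSV}_t^A$) that computes, on every input $x$, both a string $y_x$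 and a predicate $\alpha_x$ of one boolean variable such that $x\in L\iff\alpha_x(\chi_B(y_x))$, where $\chi_B$ is the characteristic function of $B$. Consider the following three classes. (i) $(\mathrm{R}_{1\text{-}tt}^{\mathcal{SN}}(\mathrm{NP}))^A=\{L : L\leq_{1\text{-}tt}^{\mathcal{SN},A}C\text{ for some }C\in\mathrm{NP}^A\}$. (ii) $(\mathrm{P}^{(\mathrm{NP}\cap\mathrm{coNP},\mathrm{NP})})^A$, the class of languages accepted by a deterministic polynomial-time machine that makes, in one parallel round, at most one query to some set in $\mathrm{NP}^A\cap\mathrm{coNP}^A$ and at most one query to some set in $\mathrm{NP}^A$, and that in addition has unlimited access to $A$ before and after that round. (iii) $\mathrm{P}^{(\mathrm{NP}^A\cap\mathrm{coNP}^A,\mathrm{NP}^A)}$, the class of languages accepted by a deterministic polynomial-time machine that makes, in one parallel round, at most one query to some set in $\mathrm{NP}^A\cap\mathrm{coNP}^A$ and at most one query to some set in $\mathrm{NP}^A$, and that has no other access to an oracle. A class $\mathcal{D}$ has $\leq$-complete sets if there is $L\in\mathcal{D}$ such that $B\leq L$ for every $B\in\mathcal{D}$. Theorem. For every set $A$, the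 following twelve statements are equivalent: for each of the three classes $\mathcal D$ in (i), (ii), (iii), and each of the four reducibilities $\leq_{1\text{-}tt}^{p,A}$, $\leq_{1\text{-}tt}^{p}$, $\leq_m^{p,A}$, $\leq_m^{p}$, the statement that $\mathcal D$ has complete sets under that reducibility. -/

import Mathlib

namespace RelComplexity

/-! ## Oracle Turing machines

Strings are elements of `List Bool`, the tape alphabet is `Option Bool` (`none` is the blank), and
tapes are Mathlib's two-way infinite tapes `Turing.Tape (Option Bool)`. -/

/-- What a machine does after scanning a cell: overwrite the cell, move the head (or leave it where
it is), and enter the state `next`. -/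
structure Action where
  write : Option Bool
  move : Option Turing.Dir
  next : ℕ

/-- The instruction attached to a state of an oracle Turing machine.
* `scan i δ`: read the cell under the head of tape `i` and perform the action `δ` on tape `i`.
* `choose q₀ q₁`: branch nondeterministically to one of the two states.
* `query i q`: ask the base oracle about the string on tape `i`; enter state `q a`, where `a` is
  the answer.
* `ask i j q`: one round of parallel queries. If `i = some t`, the first parallel oracle is asked
  about the string on tape `t`; if `j = some t`, the second parallel oracle is simultaneously asked
  about the string on tape `t`. Enter state `q a b`, where `a`, `b` are the two answers (`false`
  for a query that was not posed).
* `halt b`: stop; accept if `b = true`, reject if `b = false`. -/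
inductive Instr where
  | scan (i : ℕ) (δ : Option Bool → Action)
  | choose (q₀ q₁ : ℕ)
  | query (i : ℕ) (q : Bool → ℕ)
  | ask (i j : Option ℕ) (q : Bool → Bool → ℕ)
  | halt (b : Bool)

/-- A (nondeterministic) multi-tape oracle Turing machine: the finite list of its states
`0, 1, …, n - 1`, each with its instruction. State `0` is the initial state; a state outside the
list is a rejecting halting state. The tapes are indexed by `ℕ`, but a machine mentions, and
therefore uses, only finitely many of them. -/
abbrev Machine := List Instr

/-- A configuration: the current state and the contents of the tapes (with head positions). -/
structure Cfg where
  state : ℕ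
  tapes : ℕ → Turing.Tape (Option Bool)

/-- The oracles of a computation: the base oracle (queried sequentially, any number of times) and
the two oracles that are queried in parallel rounds. -/
structure Oracles where
  base : Language Bool
  fst : Language Bool
  snd : Language Bool

/-- The symbols of a list up to the first blank. -/
def readList : List (Option Bool) → List Bool
  | some b :: l => b :: readList l
  | none :: _ => []
  | [] => []

theorem readList_append_blank (l : List (Option Bool)) (n : ℕ) :
    readList (l ++ List.replicate n none) = readList l := by
  induction l with
  | nil => cases n <;> rfl
  | cons a l ih => cases a with
    | none => rfl
    | some b => simpa [readList] using ih

/-- The string on a tape: the symbols from the scanned cell rightwards up to the first blank. -/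
def tapeString (T : Turing.Tape (Option Bool)) : List Bool :=
  T.right₀.liftOn readList (by
    rintro a b ⟨n, rfl⟩
    exact (readList_append_blank a n).symm)

/-- The effect of an action on a tape. -/
def Action.onTape (a : Action) (T : Turing.Tape (Option Bool)) : Turing.Tape (Option Bool) :=
  match a.move with
  | none => T.write a.write
  | some d => (T.write a.write).move d

open Classical in
/-- The characteristic function of a language. -/
noncomputable def chi (L : Language Bool) (x : List Bool) : Bool := decide (x ∈ L)

/-- The answer to a query that is posed only if `i` is not `none`. -/
noncomputable def optAnswer (L : Language Bool) (c : Cfg) : Option ℕ → Bool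
  | none => false
  | some i => chi L (tapeString (c.tapes i))

namespace Machine

/-- The instruction of a state; states outside the list halt and reject. -/
def instr (M : Machine) (q : ℕ) : Instr := (M[q]?).getD (Instr.halt false)

/-- One step of a machine. The bit `b` selects the successor at a nondeterministic branching and is
irrelevant otherwise. The result is `none` exactly for halting configurations. -/
noncomputable def step (M : Machine) (O : Oracles) (b : Bool) (c : Cfg) : Option Cfg :=
  match M.instr c.state with
  | .scan i δ =>
      some ⟨(δ (c.tapes i).head).next,
        Function.update c.tapes i ((δ (c.tapes i).head).onTape (c.tapes i))⟩
  | .choose q₀ q₁ => some ⟨if b then q₁ else q₀, c.tapes⟩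
  | .query i q => some ⟨q (chi O.base (tapeString (c.tapes i))), c.tapes⟩
  | .ask i j q => some ⟨q (optAnswer O.fst c i) (optAnswer O.snd c j), c.tapes⟩
  | .halt _ => none

/-- `M.Reaches O n c c'`: some computation path of `M` leads from `c` to `c'` in `n` steps. -/
inductive Reaches (M : Machine) (O : Oracles) : ℕ → Cfg → Cfg → Prop
  | refl (c : Cfg) : Reaches M O 0 c c
  | cons {n : ℕ} {c c' c'' : Cfg} (b : Bool) :
      M.step O b c = some c' → Reaches M O n c' c'' → Reaches M O (n + 1) c c''

end Machine

/-- The initial configuration: the input is on tape `0`, all other tapes are blank. -/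
noncomputable def initial (x : List Bool) : Cfg where
  state := 0
  tapes := fun i => if i = 0 then Turing.Tape.mk₁ (x.map some) else Turing.Tape.mk₁ []

namespace Machine

/-- Some accepting computation path of `M` on input `x` has output `y` (the string on tape `1`). -/
def AcceptsWithOutput (M : Machine) (O : Oracles) (x y : List Bool) : Prop :=
  ∃ n c, M.Reaches O n (initial x) c ∧ M.instr c.state = .halt true ∧ tapeString (c.tapes 1) = y

/-- Some computation path of `M` on input `x` accepts. -/
def Accepts (M : Machine) (O : Oracles) (x : List Bool) : Prop :=
  ∃ n c, M.Reaches O n (initial x) c ∧ M.instr c.state = .halt true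

/-- Polynomial time, with a clock that is independent of the oracles: the length of every
computation path on input `x` is at most `p(|x|)`. -/
def PolyTime (M : Machine) : Prop :=
  ∃ p : Polynomial ℕ, ∀ (O : Oracles) (x : List Bool) (n : ℕ) (c : Cfg),
    M.Reaches O n (initial x) c → n ≤ p.eval x.length

/-- The machine has no nondeterministic branching. -/
def Deterministic (M : Machine) : Prop := ∀ q₀ q₁, Instr.choose q₀ q₁ ∉ M

/-- The machine never queries the base oracle. -/
def NoBaseQueries (M : Machine) : Prop := ∀ i q, Instr.query i q ∉ M

/-- The machine has no parallel query rounds. -/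
def NoParallelQueries (M : Machine) : Prop := ∀ i j q, Instr.ask i j q ∉ M

/-- In configuration `c` a round of parallel queries is posed. -/
def AsksAt (M : Machine) (c : Cfg) : Prop := ∃ i j q, M.instr c.state = .ask i j q

/-- With oracles `O`, on every input, the machine poses at most one round of parallel queries. -/
def AtMostOneRound (M : Machine) (O : Oracles) : Prop :=
  ∀ (x : List Bool) (n m : ℕ) (c c' : Cfg), M.Reaches O n (initial x) c → M.AsksAt c →
    M.Reaches O (m + 1) c c' → ¬ M.AsksAt c'

end Machine

/-- Only a base oracle. -/
def baseOnly (A : Language Bool) : Oracles := ⟨A, ⊥, ⊥⟩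

/-! ## Classes of languages and of functions -/

/-- `NP^A`. -/
def NP (A : Language Bool) : Set (Language Bool) :=
  {L | ∃ M : Machine, M.NoParallelQueries ∧ M.PolyTime ∧
    ∀ x, x ∈ L ↔ M.Accepts (baseOnly A) x}

/-- `coNP^A`. -/
def coNP (A : Language Bool) : Set (Language Bool) := {L | Lᶜ ∈ NP A}

/-- `FP_t^A`, the total functions computable in deterministic polynomial time with oracle `A`. -/
def FPRel (A : Language Bool) : Set (List Bool → List Bool) :=
  {f | ∃ M : Machine, M.Deterministic ∧ M.NoParallelQueries ∧ M.PolyTime ∧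
    ∀ x, M.AcceptsWithOutput (baseOnly A) x (f x)}

/-- `FP_t`, the total functions computable in deterministic polynomial time without any oracle. -/
def FP : Set (List Bool → List Bool) :=
  {f | ∃ M : Machine, M.Deterministic ∧ M.NoBaseQueries ∧ M.NoParallelQueries ∧ M.PolyTime ∧
    ∀ x, M.AcceptsWithOutput (baseOnly ⊥) x (f x)}

/-- `NPSV_t^A`, the total single-valued functions computable in nondeterministic polynomial time
with oracle `A`: on every input some path accepts with output `f x`, and every accepting path has
output `f x`. -/
def NPSVRel (A : Language Bool) : Set (List Bool → List Bool) :=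
  {f | ∃ M : Machine, M.NoParallelQueries ∧ M.PolyTime ∧
    ∀ x, M.AcceptsWithOutput (baseOnly A) x (f x) ∧
      ∀ y, M.AcceptsWithOutput (baseOnly A) x y → y = f x}

/-! ## Reductions -/

/-- `L` many-one reduces to `B` via a function of the class `F`. -/
def ManyOneVia (F : Set (List Bool → List Bool)) (L B : Language Bool) : Prop :=
  ∃ f ∈ F, ∀ x, x ∈ L ↔ f x ∈ B

/-- `L` 1-truth-table reduces to `B` via a function of the class `F`: a function of `F` computes
both a query string `y x` and a predicate `α x` of one boolean variable (written as its truth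
table, in front of the query string), and `x ∈ L ↔ α x (χ_B (y x))`. -/
def OneTTVia (F : Set (List Bool → List Bool)) (L B : Language Bool) : Prop :=
  ∃ (α : List Bool → Bool → Bool) (y : List Bool → List Bool),
    (fun x => α x false :: α x true :: y x) ∈ F ∧
      ∀ x, x ∈ L ↔ α x (chi B (y x)) = true

/-- `L ≤_m^p B`. -/
def LeM (L B : Language Bool) : Prop := ManyOneVia FP L B

/-- `L ≤_m^{p,A} B`. -/
def LeMRel (A L B : Language Bool) : Prop := ManyOneVia (FPRel A) L B

/-- `L ≤_{1-tt}^p B`. -/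
def LeOneTT (L B : Language Bool) : Prop := OneTTVia FP L B

/-- `L ≤_{1-tt}^{p,A} B`. -/
def LeOneTTRel (A L B : Language Bool) : Prop := OneTTVia (FPRel A) L B

/-- `L ≤_{1-tt}^{SN,A} B` (strong nondeterministic). -/
def LeOneTTSNRel (A L B : Language Bool) : Prop := OneTTVia (NPSVRel A) L B

/-! ## The three classes -/

/-- `(R_{1-tt}^{SN}(NP))^A`. -/
def RSNNP (A : Language Bool) : Set (Language Bool) :=
  {L | ∃ C ∈ NP A, LeOneTTSNRel A L C}

/-- `(P^{(NP ∩ coNP, NP)})^A`: the languages of deterministic polynomial-time machines that make,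
in one parallel round, at most one query to a set in `NP^A ∩ coNP^A` and at most one query to a set
in `NP^A`, and additionally have unlimited access to `A`. -/
def PParallelNPRel (A : Language Bool) : Set (Language Bool) :=
  {L | ∃ C ∈ NP A ∩ coNP A, ∃ D ∈ NP A, ∃ M : Machine,
    M.Deterministic ∧ M.PolyTime ∧ M.AtMostOneRound ⟨A, C, D⟩ ∧
      ∀ x, x ∈ L ↔ M.Accepts ⟨A, C, D⟩ x}

/-- `P^{(𝒞,𝒟)}`: the languages of deterministic polynomial-time machines that make, in one parallel
round, at most one query to a set in `𝒞` and at most one query to a set in `𝒟`, and use no other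
oracle. -/
def PParallel (𝒞 𝒟 : Set (Language Bool)) : Set (Language Bool) :=
  {L | ∃ C ∈ 𝒞, ∃ D ∈ 𝒟, ∃ M : Machine,
    M.Deterministic ∧ M.NoBaseQueries ∧ M.PolyTime ∧ M.AtMostOneRound ⟨⊥, C, D⟩ ∧
      ∀ x, x ∈ L ↔ M.Accepts ⟨⊥, C, D⟩ x}

/-- The class `𝒞` has complete sets under the reducibility `le`. -/
def HasComplete (𝒞 : Set (Language Bool)) (le : Language Bool → Language Bool → Prop) : Prop :=
  ∃ L ∈ 𝒞, ∀ B ∈ 𝒞, le B L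

end RelComplexity

open RelComplexity

open Turing
namespace RelComplexity

/-! The three classes are equal: each consists of the symmetric differences of a set `C` in `NP^A ∩
coNP^A` and a set `D` in `NP^A` (`IsXor`). A truth table `(a₀, a₁)` evaluated at `b` gives `a₀ ⊕
((a₀ ⊕ a₁) ∧ b)`, and the table is single-valued nondeterministic information, so a 1-tt reduction
to an `NP^A` set yields such a difference. Conversely an `NPSV_t^A` function can guess and verify
`C(x)` and output the identity or the negation as truth table, with query `x` to `D`
(`mem_RSNNP_iff`). For a parallel machine let `W_d` be its verdict when the first query is answered
correctly and the second by `d`. If `d` is the true second answer, the verdict is `W_0 ⊕ (d ∧ (W_0 ⊕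
W_1))`, where `W_0` and `W_1` are in `NP^A ∩ coNP^A` (`isXor_of_mem_pParallelNPRel`). Conversely,
one machine asks both oracles about its input and accepts if the answers differ
(`mem_pParallel_of_isXor`).

For the single remaining class, `≤_m^p` implies the other three reducibilities and each of them
implies `≤_{1-tt}^{p,A}`, so only a passage from the weakest to the strongest is needed. The same
algebra shows that the class is closed under evaluating truth tables produced by `NPSV_t^A`
functions (`IsXor.evalTable`). Suppose `u ∈ FP_t^A` is universal in the sense that every `f ∈
FP_t^A` is `u ∘ g` for some `g ∈ FP_t`. If `L` is complete in the weakest sense, then the set of `w`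
for which the truth table `u w`, evaluated at `L`, is true lies in the class, and every `B` in the
class many-one reduces to it by an oracle-free `g` (`HasComplete.leM`).

The main labour is `exists_universal`. The function `u` needs one polynomial clock that is valid on
all strings and for all oracles. Therefore `g x` is a straight-line program: the transition table of
the machine, as guarded micro-instructions, repeated at least as often as its clock allows steps on
`x`. Writing it needs no oracle; only its execution by `u` does. A fixed machine must serve programs
with arbitrarily many tapes, so it stores a log of all writes and moves and, before each
instruction, replays the log to recover the one tape concerned.

As machines are concrete, the constructions rest on a small calculus: `Ensures` and `wp` bound all
paths, `Allows` and `can` exhibit one path, `Computes` is the deterministic case. -/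

abbrev Store := ℕ → Tape (Option Bool)

/-! ## Total and partial correctness of machines -/

namespace Machine

/-- All computation paths from a configuration halt within `n` steps, with an answer and final
tapes that satisfy the postcondition. -/
inductive Ensures (M : Machine) (O : Oracles) (Φ : Bool → Store → Prop) : ℕ → Cfg → Prop
  | halt {n : ℕ} {c : Cfg} (b : Bool) (h : M.instr c.state = .halt b) (hΦ : Φ b c.tapes) :
      Ensures M O Φ n c
  | step {n : ℕ} {c : Cfg} (h : ∀ b, M.instr c.state ≠ .halt b)
      (hs : ∀ b c', M.step O b c = some c' → Ensures M O Φ n c') : Ensures M O Φ (n + 1) c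

/-- Some computation path from a configuration halts with an answer and final tapes that satisfy the
postcondition. -/
def Allows (M : Machine) (O : Oracles) (Φ : Bool → Store → Prop) (c : Cfg) : Prop :=
  ∃ n c' b, M.Reaches O n c c' ∧ M.instr c'.state = .halt b ∧ Φ b c'.tapes

variable {M N : Machine} {O : Oracles} {Φ Ψ : Bool → Store → Prop} {n m : ℕ} {c c' c'' : Cfg}

theorem step_eq_none_iff {b : Bool} : M.step O b c = none ↔ ∃ a, M.instr c.state = .halt a := by
  unfold step
  cases h : M.instr c.state <;> simp

theorem exists_step (h : ∀ b, M.instr c.state ≠ .halt b) (b : Bool) :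
    ∃ c', M.step O b c = some c' := by
  have : M.step O b c ≠ none := fun h' => by
    obtain ⟨a, ha⟩ := step_eq_none_iff.1 h'
    exact h a ha
  exact Option.ne_none_iff_exists'.1 this

theorem not_halt_of_step {b : Bool} (h : M.step O b c = some c') (a : Bool) :
    M.instr c.state ≠ .halt a := fun h' => by
  have := (step_eq_none_iff (O := O) (b := b)).2 ⟨a, h'⟩
  simp [this] at h

theorem Reaches.trans (h : M.Reaches O n c c') (h' : M.Reaches O m c' c'') :
    M.Reaches O (n + m) c c'' := by
  induction h with
  | refl => simpa using h'
  | @cons k _ _ _ b hb _ ih =>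
    rw [show k + 1 + m = k + m + 1 by omega]
    exact .cons b hb (ih h')

theorem Reaches.snoc {b : Bool} (h : M.Reaches O n c c') (h' : M.step O b c' = some c'') :
    M.Reaches O (n + 1) c c'' :=
  h.trans (.cons b h' (.refl _))

/-- `Reaches` grows at its front. Growing at the back keeps the start fixed, so that each step is
known to leave a configuration reachable from that start. -/
theorem Reaches.rec_snoc {c : Cfg} {P : ℕ → Cfg → Prop} (h0 : P 0 c)
    (hs : ∀ n c' c'' b, M.Reaches O n c c' → M.step O b c' = some c'' → P n c' → P (n + 1) c'') :
    ∀ {n c'}, M.Reaches O n c c' → P n c' := by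
  intro n c' h
  -- The prefix of length `k` already travelled makes the front-growing induction carry reachability
  -- from `c`.
  suffices H : ∀ m c₁ c₂, M.Reaches O m c₁ c₂ → ∀ k, M.Reaches O k c c₁ → P k c₁ → P (k + m) c₂ by
    simpa using H n c c' h 0 (.refl _) h0
  intro m c₁ c₂ h
  induction h with
  | refl => intro k _ h; simpa using h
  | @cons m _ _ _ b hb _ ih =>
    intro k hk hP
    rw [show k + (m + 1) = k + 1 + m by omega]
    exact ih (k + 1) (hk.snoc hb) (hs _ _ _ _ hk hb hP)

theorem Ensures.mono (h : M.Ensures O Φ n c) (hn : n ≤ m) (hΦ : ∀ b T, Φ b T → Ψ b T) :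
    M.Ensures O Ψ m c := by
  induction h generalizing m with
  | halt b h h' => exact .halt b h (hΦ _ _ h')
  | step h _ ih =>
    obtain ⟨m, rfl⟩ : ∃ k, m = k + 1 := ⟨m - 1, by omega⟩
    exact .step h fun b c' hc => ih b c' hc (by omega)

/-- This turns a total correctness proof into a clock: polynomial time is always proved through it.
-/
theorem Ensures.length_le (h : M.Ensures O Φ n c) (hr : M.Reaches O m c c') : m ≤ n := by
  induction h generalizing m with
  | halt b h _ =>
    cases hr with
    | refl => exact Nat.zero_le _
    | cons b' hb _ => exact absurd h (not_halt_of_step hb b)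
  | step h _ ih =>
    cases hr with
    | refl => exact Nat.zero_le _
    | cons b hb hr => exact Nat.succ_le_succ (ih b _ hb hr)

theorem Ensures.post {b : Bool} (h : M.Ensures O Φ n c) (hr : M.Reaches O m c c')
    (hb : M.instr c'.state = .halt b) : Φ b c'.tapes := by
  induction h generalizing m with
  | halt b' h h' =>
    cases hr with
    | refl => rw [h] at hb; cases hb; exact h'
    | cons b' hb _ => exact absurd h (not_halt_of_step hb _)
  | step h _ ih =>
    cases hr with
    | refl => exact absurd hb (h b)
    | cons b hb hr => exact ih b _ hb hr

/-- Every nonhalting configuration has a successor for each choice bit, so a path that always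
chooses `false` must end within the bound. -/
theorem Ensures.allows (h : M.Ensures O Φ n c) : M.Allows O Φ c := by
  induction h with
  | halt b h h' => exact ⟨0, _, b, .refl _, h, h'⟩
  | step h _ ih =>
    obtain ⟨c', hc⟩ := exists_step (O := O) h false
    obtain ⟨n, c'', b, h1, h2⟩ := ih _ _ hc
    exact ⟨n + 1, c'', b, .cons _ hc h1, h2⟩

theorem Allows.mono (h : M.Allows O Φ c) (hΦ : ∀ b T, Φ b T → Ψ b T) : M.Allows O Ψ c := by
  obtain ⟨n, c', b, h1, h2, h3⟩ := h
  exact ⟨n, c', b, h1, h2, hΦ _ _ h3⟩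

theorem Allows.of_reaches (hr : M.Reaches O n c c') (h : M.Allows O Φ c') : M.Allows O Φ c := by
  obtain ⟨m, c'', b, h1, h2, h3⟩ := h
  exact ⟨n + m, c'', b, hr.trans h1, h2, h3⟩

/-- A machine all of whose paths are short ensures the strongest postcondition. -/
theorem ensures_of_bounded (h : ∀ m c', M.Reaches O m c c' → m ≤ n) :
    M.Ensures O (fun b T => ∃ m c', M.Reaches O m c c' ∧ M.instr c'.state = .halt b ∧ c'.tapes = T)
      n c := by
  induction n generalizing c with
  | zero =>
    by_cases hc : ∀ b, M.instr c.state ≠ .halt b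
    · obtain ⟨c', hc⟩ := exists_step (O := O) hc false
      have := h 1 c' (.cons _ hc (.refl _))
      omega
    · push Not at hc
      obtain ⟨b, hb⟩ := hc
      exact .halt b hb ⟨0, c, .refl _, hb, rfl⟩
  | succ n ih =>
    by_cases hc : ∀ b, M.instr c.state ≠ .halt b
    · refine .step hc fun b c' hb => (ih fun m c'' hr => ?_).mono le_rfl ?_
      · have := h (m + 1) c'' (.cons b hb hr)
        omega
      · rintro a T ⟨m, c'', h1, h2⟩
        exact ⟨m + 1, c'', .cons b hb h1, h2⟩
    · push Not at hc
      obtain ⟨b, hb⟩ := hc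
      exact .halt b hb ⟨0, c, .refl _, hb, rfl⟩

/-! ## Features of instructions -/

end Machine

/-- The features of instructions that a machine may be forbidden to use. -/
inductive Feature | choose | query | ask

def Instr.feature : Instr → Option Feature
  | .choose _ _ => some .choose
  | .query _ _ => some .query
  | .ask _ _ _ => some .ask
  | _ => none

namespace Machine

/-- No instruction of the machine has the feature `f`. -/
def Avoids (f : Feature) (M : Machine) : Prop := ∀ I ∈ M, I.feature ≠ some f

theorem deterministic_iff {M : Machine} : M.Deterministic ↔ M.Avoids .choose := by
  constructor
  · intro h I hI hf
    cases I <;> simp [Instr.feature] at hf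
    exact h _ _ hI
  · intro h a b hI
    exact h _ hI rfl

theorem noBaseQueries_iff {M : Machine} : M.NoBaseQueries ↔ M.Avoids .query := by
  constructor
  · intro h I hI hf
    cases I <;> simp [Instr.feature] at hf
    exact h _ _ hI
  · intro h a b hI
    exact h _ hI rfl

theorem noParallelQueries_iff {M : Machine} : M.NoParallelQueries ↔ M.Avoids .ask := by
  constructor
  · intro h I hI hf
    cases I <;> simp [Instr.feature] at hf
    exact h _ _ _ hI
  · intro h a b d hI
    exact h _ hI rfl

theorem instr_eq_or_mem (M : Machine) (q : ℕ) : M.instr q = .halt false ∨ M.instr q ∈ M := by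
  unfold instr
  cases h : M[q]? with
  | none => exact .inl rfl
  | some I => exact .inr (List.mem_of_getElem? h)

theorem Avoids.instr {f : Feature} {M : Machine} (h : M.Avoids f) (q : ℕ) :
    (M.instr q).feature ≠ some f := by
  rcases M.instr_eq_or_mem q with hq | hq
  · rw [hq]; simp [Instr.feature]
  · exact h _ hq

/-! ## Relocating code -/

end Machine

/-- An instruction that jumps to a state. -/
def jump (q : ℕ) : Instr := .scan 0 fun s => ⟨s, none, q⟩

/-- Relabel the states of an instruction by `φ`, its tapes by `σ`, and replace halting by a jump. -/
def Instr.link (φ : ℕ → ℕ) (σ : ℕ → ℕ) (e : Bool → Instr) : Instr → Instr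
  | .scan i δ => .scan (σ i) fun s => ⟨(δ s).write, (δ s).move, φ (δ s).next⟩
  | .choose a b => .choose (φ a) (φ b)
  | .query i q => .query (σ i) (φ ∘ q)
  | .ask i j q => .ask (i.map σ) (j.map σ) fun a b => φ (q a b)
  | .halt b => e b

namespace Machine

variable {M N : Machine} {O : Oracles} {Φ Ψ : Bool → Store → Prop} {n m : ℕ} {c c' c'' : Cfg}

theorem step_jump {b : Bool} {q : ℕ} (h : M.instr c.state = jump q) :
    M.step O b c = some ⟨q, c.tapes⟩ := by
  unfold step
  rw [h]
  simp [jump, Action.onTape]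

/-- How one step of a machine is reflected by relabelled code. -/
theorem step_link {X : Machine} {φ σ : ℕ → ℕ} {e : Bool → Instr} {q : ℕ} {T : Store}
    (hσ : Function.Injective σ) (hX : X.instr (φ q) = (M.instr q).link φ σ e)
    (hq : ∀ b, M.instr q ≠ .halt b) (b : Bool) :
    ∃ q' T', M.step O b ⟨q, T ∘ σ⟩ = some ⟨q', T' ∘ σ⟩ ∧ X.step O b ⟨φ q, T⟩ = some ⟨φ q', T'⟩ ∧
      ∀ j ∉ Set.range σ, T' j = T j := by
  unfold step
  simp only [hX]
  cases h : M.instr q with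
  | scan i δ =>
    refine ⟨_, Function.update T (σ i) ((δ (T (σ i)).head).onTape (T (σ i))), ?_, rfl, ?_⟩
    · rw [Function.update_comp_eq_of_injective T hσ]
      rfl
    · intro j hj
      exact Function.update_of_ne (fun h => hj ⟨i, h.symm⟩) _ _
  | choose a a' =>
    refine ⟨_, T, rfl, ?_, fun _ _ => rfl⟩
    cases b <;> rfl
  | query i q => exact ⟨_, T, rfl, rfl, fun _ _ => rfl⟩
  | ask i j q =>
    refine ⟨_, T, rfl, ?_, fun _ _ => rfl⟩
    cases i <;> cases j <;> rfl
  | halt b => exact absurd h (hq b)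

/-- The code of `M`, to be placed at position `off` and continued at the states `e b`. -/
def code (M : Machine) (off : ℕ) (e : Bool → ℕ) : Machine :=
  (M ++ [Instr.halt false]).map (Instr.link (fun q => off + min q M.length) id (jump ∘ e))

/-- The code of `M` occurs in `X` at position `off`. -/
def HasCode (X M : Machine) (off : ℕ) (e : Bool → ℕ) : Prop :=
  ∀ q, X.instr (off + min q M.length) =
    (M.instr q).link (fun q => off + min q M.length) id (jump ∘ e)

@[simp] theorem length_code {off : ℕ} {e : Bool → ℕ} : (code M off e).length = M.length + 1 := by
  simp [code]

theorem hasCode_append (A M B : Machine) (off : ℕ) (e : Bool → ℕ) (h : A.length = off) :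
    HasCode (A ++ code M off e ++ B) M off e := by
  intro q
  subst h
  have hlt : min q M.length < (code M A.length e).length := by simp
  have h1 : (A ++ code M A.length e ++ B)[A.length + min q M.length]? =
      (code M A.length e)[min q M.length]? := by
    rw [List.append_assoc, List.getElem?_append_right (by omega), Nat.add_sub_cancel_left,
      List.getElem?_append_left hlt]
  unfold instr
  rw [h1]
  simp only [code, List.getElem?_map]
  -- All states outside the list behave alike; they are collapsed to the single rejecting state that
  -- `code` appends at index `M.length`.
  rcases lt_or_ge q M.length with hq | hq
  · rw [min_eq_left hq.le, List.getElem?_append_left hq, List.getElem?_eq_getElem hq]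
    rfl
  · rw [min_eq_right hq, List.getElem?_append_right le_rfl, List.getElem?_eq_none hq]
    simp

/-- Linked code mirrors each step of `M`; the additional unit of time is the jump that replaces
halting. -/
theorem Ensures.link {X : Machine} {off : ℕ} {e : Bool → ℕ} (hX : HasCode X M off e)
    (h : M.Ensures O Φ n c) (hk : ∀ b T, Φ b T → X.Ensures O Ψ m ⟨e b, T⟩) :
    X.Ensures O Ψ (n + 1 + m) ⟨off + min c.state M.length, c.tapes⟩ := by
  induction h with
  | @halt n c b h h' =>
    have hc : X.instr (off + min c.state M.length) = jump (e b) := by rw [hX, h]; rfl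
    rw [show n + 1 + m = n + m + 1 by omega]
    refine .step (by simp [hc, jump]) fun a c' hs => ?_
    rw [step_jump (q := e b) hc] at hs
    cases hs
    exact (hk _ _ h').mono (by omega) fun _ _ => id
  | @step n c h _ ih =>
    rw [show n + 1 + 1 + m = n + 1 + m + 1 by omega]
    refine .step (fun b hb => ?_) fun b c' hs => ?_
    · rw [hX] at hb
      cases h' : M.instr c.state <;> simp [h', Instr.link] at hb
      exact h _ h'
    · obtain ⟨q', T', h1, h2, -⟩ := step_link (M := M) (O := O) (X := X)
        (φ := fun q => off + min q M.length) (T := c.tapes) Function.injective_id (hX c.state) h b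
      rw [hs] at h2
      cases h2
      exact ih b _ h1

theorem Allows.link {X : Machine} {off : ℕ} {e : Bool → ℕ} (hX : HasCode X M off e)
    (h : M.Allows O Φ c) (hk : ∀ b T, Φ b T → X.Allows O Ψ ⟨e b, T⟩) :
    X.Allows O Ψ ⟨off + min c.state M.length, c.tapes⟩ := by
  obtain ⟨n, c', b, h1, h2, h3⟩ := h
  refine .of_reaches (n := n) (c' := ⟨off + min c'.state M.length, c'.tapes⟩) ?_
    (.of_reaches (n := 1) (.cons false (step_jump (q := e b) (by rw [hX, h2]; rfl)) (.refl _))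
      (hk _ _ h3))
  clear h2 h3
  induction h1 with
  | refl => exact .refl _
  | @cons n c c₁ c₂ b hb _ ih =>
    obtain ⟨q', T', h1, h2, -⟩ := step_link (M := M) (O := O) (X := X)
        (φ := fun q => off + min q M.length) (T := c.tapes) Function.injective_id (hX c.state)
        (not_halt_of_step hb) b
    have : (⟨q', T'⟩ : Cfg) = c₁ := by
      have h1' : M.step O b c = some ⟨q', T'⟩ := h1
      rw [hb] at h1'
      exact (Option.some.inj h1').symm
    subst this
    exact .cons b h2 ih

/-- All paths from the initial state. -/
abbrev wp (M : Machine) (O : Oracles) (n : ℕ) (T : Store) (Φ : Bool → Store → Prop) : Prop :=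
  M.Ensures O Φ n ⟨0, T⟩

/-- Some path from the initial state. -/
abbrev can (M : Machine) (O : Oracles) (T : Store) (Φ : Bool → Store → Prop) : Prop :=
  M.Allows O Φ ⟨0, T⟩

theorem wp.mono' {T : Store} (h : M.wp O n T Φ) (hn : n ≤ m) : M.wp O m T Φ :=
  Ensures.mono h hn fun _ _ => id

/-! ## Structured programming -/

/-- The position in `cond M N₁ N₂` where `N₁` (for `true`) or `N₂` starts. -/
def condStart (M N₁ : Machine) (b : Bool) : ℕ :=
  if b then M.length + 1 else M.length + 1 + (N₁.length + 1)

/-- The position in `cond M N₁ N₂` of the final state with answer `b`. -/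
def condExit (M N₁ N₂ : Machine) (b : Bool) : ℕ :=
  M.length + 1 + (N₁.length + 1) + (N₂.length + 1) + if b then 0 else 1

/-- Run `M`, then `N₁` or `N₂` according to the answer of `M`. -/
def cond (M N₁ N₂ : Machine) : Machine :=
  code M 0 (condStart M N₁) ++ code N₁ (condStart M N₁ true) (condExit M N₁ N₂) ++
    code N₂ (condStart M N₁ false) (condExit M N₁ N₂) ++ [.halt true, .halt false]

theorem instr_append_right (A B : Machine) (k : ℕ) : (A ++ B).instr (A.length + k) = B.instr k := by
  unfold instr
  rw [List.getElem?_append_right (by omega), Nat.add_sub_cancel_left]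

theorem hasCode_cond (M N₁ N₂ : Machine) : HasCode (cond M N₁ N₂) M 0 (condStart M N₁) := by
  have := hasCode_append [] M (code N₁ (condStart M N₁ true) (condExit M N₁ N₂) ++
    (code N₂ (condStart M N₁ false) (condExit M N₁ N₂) ++ [.halt true, .halt false])) 0
    (condStart M N₁) rfl
  simpa only [cond, List.append_assoc, List.nil_append] using this

theorem hasCode_cond_branch (M N₁ N₂ : Machine) (b : Bool) :
    HasCode (cond M N₁ N₂) (if b then N₁ else N₂) (condStart M N₁ b) (condExit M N₁ N₂) := by
  cases b
  · exact hasCode_append (code M 0 (condStart M N₁) ++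
      code N₁ (condStart M N₁ true) (condExit M N₁ N₂)) N₂ [.halt true, .halt false] _ _
      (by simp [condStart])
  · have := hasCode_append (code M 0 (condStart M N₁)) N₁
      (code N₂ (condStart M N₁ false) (condExit M N₁ N₂) ++ [.halt true, .halt false])
      (condStart M N₁ true) (condExit M N₁ N₂) (by simp [condStart])
    simpa only [cond, List.append_assoc, if_true] using this

theorem instr_condExit (M N₁ N₂ : Machine) (b : Bool) :
    (cond M N₁ N₂).instr (condExit M N₁ N₂ b) = .halt b := by
  have := instr_append_right (code M 0 (condStart M N₁) ++
    code N₁ (condStart M N₁ true) (condExit M N₁ N₂) ++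
    code N₂ (condStart M N₁ false) (condExit M N₁ N₂)) [.halt true, .halt false]
    (if b then 0 else 1)
  simp only [List.length_append, length_code] at this
  unfold cond
  rw [condExit, this]
  cases b <;> rfl

theorem ensures_of_halt {T : Store} {q : ℕ} {b : Bool} (h : M.instr q = .halt b) (hΦ : Φ b T) :
    M.Ensures O Φ n ⟨q, T⟩ := .halt b h hΦ

/-- The 2 counts the two jumps: out of `M` into a branch, and out of the branch to the exit. -/
theorem wp_cond {N₁ N₂ : Machine} {T : Store}
    (h : M.wp O n T fun b T' => (if b then N₁ else N₂).wp O m T' Φ) :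
    (cond M N₁ N₂).wp O (n + m + 2) T Φ := by
  have h1 := hasCode_cond M N₁ N₂
  have h2 := hasCode_cond_branch M N₁ N₂
  have h3 := instr_condExit M N₁ N₂
  have := Ensures.link (Ψ := Φ) (m := m + 1) h1 h fun b T' h' => by
    have := Ensures.link (Ψ := Φ) (m := 0) (h2 b) h' fun b T' h' => ensures_of_halt (h3 b) h'
    simpa using this
  simp only [Nat.zero_min, add_zero] at this
  exact this.mono (by omega) fun _ _ => id

theorem can_cond {N₁ N₂ : Machine} {T : Store}
    (h : M.can O T fun b T' => (if b then N₁ else N₂).can O T' Φ) :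
    (cond M N₁ N₂).can O T Φ := by
  have h1 := hasCode_cond M N₁ N₂
  have h2 := hasCode_cond_branch M N₁ N₂
  have h3 := instr_condExit M N₁ N₂
  have := Allows.link (Ψ := Φ) h1 h fun b T' h' => by
    have := Allows.link (Ψ := Φ) (h2 b) h' fun b T' h' => ⟨0, _, b, .refl _, h3 b, h'⟩
    simpa using this
  simpa using this

/-- Run `M`, then `N`. -/
def seq (M N : Machine) : Machine := cond M N N

theorem wp_seq {T : Store} (h : M.wp O n T fun _ T' => N.wp O m T' Φ) :
    (seq M N).wp O (n + m + 2) T Φ :=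
  wp_cond (Ensures.mono h le_rfl fun b T' h => by simpa using h)

theorem can_seq {T : Store} (h : M.can O T fun _ T' => N.can O T' Φ) : (seq M N).can O T Φ :=
  can_cond (Allows.mono h fun b T' h => by simpa using h)

/-- Repeat `M` as long as its answer is `true`. -/
def loop (M : Machine) : Machine :=
  code M 0 (fun b => if b then 0 else M.length + 1) ++ [.halt true]

/-- One unrolling. There is no invariant: users do induction on the data and supply the bound `m`
for the remaining iterations. The additional unit is the jump back or out. -/
theorem wp_loop {T : Store}
    (h : M.wp O n T fun b T' => if b then (loop M).wp O m T' Φ else Φ true T') :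
    (loop M).wp O (n + m + 1) T Φ := by
  have h1 : HasCode (loop M) M 0 (fun b => if b then 0 else M.length + 1) := by
    simpa [loop] using hasCode_append [] M [.halt true] 0 (fun b => if b then 0 else M.length + 1) rfl
  have h2 : (loop M).instr (M.length + 1) = .halt true := by
    have := instr_append_right (code M 0 (fun b => if b then 0 else M.length + 1)) [.halt true] 0
    rw [length_code] at this
    exact this
  have := Ensures.link (Ψ := Φ) (m := m) h1 h fun b T' h' => by
    cases b
    · exact ensures_of_halt h2 h'
    · exact h'
  simp only [Nat.zero_min, add_zero] at this
  exact this.mono (by omega) fun _ _ => id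

/-- Rename the tapes of a machine. -/
def rename (σ : ℕ → ℕ) (M : Machine) : Machine := M.map (Instr.link id σ Instr.halt)

theorem instr_rename (σ : ℕ → ℕ) (M : Machine) (q : ℕ) :
    (rename σ M).instr q = (M.instr q).link id σ Instr.halt := by
  unfold instr rename
  rw [List.getElem?_map]
  cases M[q]? <;> rfl

/-- A frame rule: tapes outside the range of `σ` survive, so renaming to disjoint ranges lets two
machines run without interference. -/
theorem Ensures.rename {σ : ℕ → ℕ} (hσ : Function.Injective σ) {q : ℕ} {T : Store}
    (h : M.Ensures O Φ n ⟨q, T ∘ σ⟩) :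
    (rename σ M).Ensures O (fun b T' => Φ b (T' ∘ σ) ∧ ∀ j ∉ Set.range σ, T' j = T j) n ⟨q, T⟩ := by
  generalize hc : (⟨q, T ∘ σ⟩ : Cfg) = c at h
  induction h generalizing q T with
  | halt b h h' =>
    subst hc
    exact .halt b (by rw [instr_rename]; simp only at h; rw [h]; rfl) ⟨h', fun _ _ => rfl⟩
  | step h _ ih =>
    subst hc
    refine .step (fun b hb => ?_) fun b c' hs => ?_
    · rw [instr_rename] at hb
      cases h' : M.instr q <;> simp [h', Instr.link] at hb
      exact h _ h'
    · obtain ⟨q', T', h1, h2, h3⟩ := step_link (M := M) (O := O) (X := Machine.rename σ M)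
        (φ := id) (T := T) hσ (instr_rename σ M q) h b
      simp only [id] at h2
      rw [hs] at h2
      cases h2
      exact (ih b _ h1 rfl).mono le_rfl fun b T'' hT =>
        ⟨hT.1, fun j hj => (hT.2 j hj).trans (h3 j hj)⟩

theorem Allows.rename {σ : ℕ → ℕ} (hσ : Function.Injective σ) {q : ℕ} {T : Store}
    (h : M.Allows O Φ ⟨q, T ∘ σ⟩) :
    (rename σ M).Allows O (fun b T' => Φ b (T' ∘ σ) ∧ ∀ j ∉ Set.range σ, T' j = T j) ⟨q, T⟩ := by
  obtain ⟨n, c', b, h1, h2, h3⟩ := h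
  generalize hc : (⟨q, T ∘ σ⟩ : Cfg) = c at h1
  induction h1 generalizing q T with
  | refl =>
    subst hc
    exact ⟨0, ⟨q, T⟩, b, .refl _, by rw [instr_rename]; simp only at h2; rw [h2]; rfl, h3,
      fun _ _ => rfl⟩
  | @cons n c c₁ c₂ a ha _ ih =>
    subst hc
    obtain ⟨q', T', h1, h2', h3'⟩ := step_link (M := M) (O := O) (X := Machine.rename σ M)
        (φ := id) (T := T) hσ (instr_rename σ M q) (not_halt_of_step ha) a
    rw [ha] at h1
    have := ih h2 h3 (Option.some.inj h1).symm
    exact .of_reaches (.cons a h2' (.refl _)) (this.mono fun b T'' hT =>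
        ⟨hT.1, fun j hj => (hT.2 j hj).trans (h3' j hj)⟩)

/-! ## Features of structured programs -/

variable {f : Feature}

theorem avoids_code {off : ℕ} {e : Bool → ℕ} (h : M.Avoids f) : (code M off e).Avoids f := by
  intro I hI
  simp only [code, List.mem_map, List.mem_append, List.mem_singleton] at hI
  obtain ⟨J, hJ | rfl, rfl⟩ := hI
  · have := h J hJ
    cases J <;> simp_all [Instr.link, Instr.feature, jump]
  · simp [Instr.link, Instr.feature, jump]

theorem Avoids.append {A B : Machine} (hA : A.Avoids f) (hB : B.Avoids f) : Avoids f (A ++ B) := by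
  intro I hI
  rcases List.mem_append.1 hI with h | h
  · exact hA I h
  · exact hB I h

theorem Avoids.cond {N₁ N₂ : Machine} (h : M.Avoids f) (h₁ : N₁.Avoids f) (h₂ : N₂.Avoids f) :
    (cond M N₁ N₂).Avoids f := by
  refine (((avoids_code h).append (avoids_code h₁)).append (avoids_code h₂)).append ?_
  simp [Avoids, Instr.feature]

theorem Avoids.seq (h : M.Avoids f) (h₁ : N.Avoids f) : (seq M N).Avoids f := h.cond h₁ h₁

theorem Avoids.loop (h : M.Avoids f) : (loop M).Avoids f :=
  (avoids_code h).append (by simp [Avoids, Instr.feature])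

theorem Avoids.rename {σ : ℕ → ℕ} (h : M.Avoids f) : (rename σ M).Avoids f := by
  intro I hI
  obtain ⟨J, hJ, rfl⟩ := List.mem_map.1 hI
  have := h J hJ
  cases J <;> simp_all [Instr.link, Instr.feature]

end Machine

/-! ## Stacks on tapes -/

/-- A tape that holds a string, with the head on its first symbol. -/
def stk (l : List Bool) : Tape (Option Bool) := Tape.mk₁ (l.map some)

/-- `ListBlank` identifies lists up to trailing blanks; this is what makes an erased cell vanish, so
that tapes can be compared by equality. -/
theorem listBlank_cons_none : (ListBlank.mk ([] : List (Option Bool))).cons none = ListBlank.mk [] := by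
  refine ListBlank.ext fun i => ?_
  rw [ListBlank.cons_mk, ListBlank.nth_mk, ListBlank.nth_mk]
  cases i <;> rfl

theorem stk_head (l : List Bool) : (stk l).head = l.head? := by
  cases l <;> rfl

/-- Blanking the cell before moving keeps the left half of the tape empty, so the result is again
literally a stack. -/
theorem stk_pop (l : List Bool) : ((stk l).write none).move .right = stk l.tail := by
  unfold stk Tape.mk₁ Tape.mk₂
  rw [Tape.write_mk', Tape.move_right_mk', ListBlank.head_cons, ListBlank.tail_cons,
    listBlank_cons_none, ListBlank.tail_mk, List.map_tail]

theorem stk_push (b : Bool) (l : List Bool) : ((stk l).move .left).write (some b) = stk (b :: l) := by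
  unfold stk Tape.mk₁ Tape.mk₂
  rw [Tape.move_left_mk', Tape.write_mk', ListBlank.tail_cons, ListBlank.tail_mk, ListBlank.cons_mk]
  rfl

theorem tapeString_mk' (L : ListBlank (Option Bool)) (R : List (Option Bool)) :
    tapeString (Tape.mk' L (ListBlank.mk R)) = readList R := by
  unfold tapeString
  rw [Tape.mk'_right₀]
  rfl

theorem readList_map_some (l : List Bool) : readList (l.map some) = l := by
  induction l with
  | nil => rfl
  | cons b l ih => simp [readList, ih]

@[simp] theorem tapeString_stk (l : List Bool) : tapeString (stk l) = l := by
  unfold stk Tape.mk₁ Tape.mk₂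
  rw [tapeString_mk', readList_map_some]

/-- The nonblank portion of a tape extends at most `k` cells to either side of the head. -/
def Fits (k : ℕ) (T : Tape (Option Bool)) : Prop :=
  ∃ L R : List (Option Bool), L.length ≤ k ∧ R.length ≤ k ∧ T = Tape.mk' (ListBlank.mk L) (ListBlank.mk R)

theorem Fits.mono {k k' : ℕ} {T : Tape (Option Bool)} (h : Fits k T) (hk : k ≤ k') : Fits k' T := by
  obtain ⟨L, R, hL, hR, rfl⟩ := h
  exact ⟨L, R, hL.trans hk, hR.trans hk, rfl⟩

theorem fits_stk (l : List Bool) : Fits l.length (stk l) :=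
  ⟨[], l.map some, by simp, by simp, rfl⟩

theorem Fits.write {k : ℕ} {T : Tape (Option Bool)} (h : Fits k T) (s : Option Bool) :
    Fits (k + 1) (T.write s) := by
  obtain ⟨L, R, hL, hR, rfl⟩ := h
  refine ⟨L, s :: R.tail, by omega, by simp; omega, ?_⟩
  rw [Tape.write_mk', ListBlank.tail_mk, ListBlank.cons_mk]

theorem Fits.move {k : ℕ} {T : Tape (Option Bool)} (h : Fits k T) (d : Dir) :
    Fits (k + 1) (T.move d) := by
  obtain ⟨L, R, hL, hR, rfl⟩ := h
  cases d with
  | left =>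
    refine ⟨L.tail, L.headI :: R, by simp; omega, by simp; omega, ?_⟩
    rw [Tape.move_left_mk', ListBlank.tail_mk, ListBlank.head_mk, ListBlank.cons_mk]
  | right =>
    refine ⟨R.headI :: L, R.tail, by simp; omega, by simp; omega, ?_⟩
    rw [Tape.move_right_mk', ListBlank.tail_mk, ListBlank.head_mk, ListBlank.cons_mk]

theorem Fits.onTape {k : ℕ} {T : Tape (Option Bool)} (h : Fits k T) (a : Action) :
    Fits (k + 2) (a.onTape T) := by
  unfold Action.onTape
  cases a.move with
  | none => exact (h.write _).mono (by omega)
  | some d => exact (h.write _).move d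

theorem length_readList_le (l : List (Option Bool)) : (readList l).length ≤ l.length := by
  induction l with
  | nil => simp [readList]
  | cons a l ih => cases a <;> simp [readList]; omega

theorem Fits.length_tapeString_le {k : ℕ} {T : Tape (Option Bool)} (h : Fits k T) :
    (tapeString T).length ≤ k := by
  obtain ⟨L, R, hL, hR, rfl⟩ := h
  rw [tapeString_mk']
  exact (length_readList_le R).trans hR

theorem initial_eq (x : List Bool) : (initial x) = ⟨0, fun i => if i = 0 then stk x else stk []⟩ := rfl

/-- A step writes one cell and moves by at most one, which costs at most 2 in the crude measure
`Fits`. Hence outputs of polynomial-time machines have polynomial length. -/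
theorem Machine.Reaches.fits {M : Machine} {O : Oracles} {n k : ℕ} {c c' : Cfg} (i : ℕ)
    (h : M.Reaches O n c c') (hk : Fits k (c.tapes i)) : Fits (k + 2 * n) (c'.tapes i) := by
  induction h generalizing k with
  | refl => exact hk
  | @cons n c c₁ _ b hb _ ih =>
    refine (ih (k := k + 2) ?_).mono (by omega)
    unfold Machine.step at hb
    cases hi : M.instr c.state with
    | scan j δ =>
      simp only [hi, Option.some.injEq] at hb
      subst hb
      by_cases hij : i = j
      · subst hij
        simpa using hk.onTape _
      · simpa [hij] using hk.mono (by omega)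
    | halt b => simp [hi] at hb
    | _ =>
      simp only [hi, Option.some.injEq] at hb
      subst hb
      exact hk.mono (by omega)

/-! ## Deterministic specifications -/

namespace Machine

/-- From the tapes `T`, within `n` steps, `M` halts with answer `b` and tapes `T'`. -/
def Computes (M : Machine) (O : Oracles) (T : Store) (n : ℕ) (b : Bool) (T' : Store) : Prop :=
  M.wp O n T fun b' T'' => b' = b ∧ T'' = T'

variable {M N N₁ N₂ : Machine} {O : Oracles} {T T₁ T₂ : Store} {n m k : ℕ} {a b : Bool}

theorem Computes.mono (h : M.Computes O T n b T₁) (hn : n ≤ m) : M.Computes O T m b T₁ :=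
  Ensures.mono h hn fun _ _ => id

theorem Computes.to (h : M.Computes O T n b T₁) (e : T₁ = T₂) : M.Computes O T n b T₂ := e ▸ h

theorem Computes.wp {Φ : Bool → Store → Prop} (h : M.Computes O T n b T₁) (hΦ : Φ b T₁) :
    M.wp O n T Φ :=
  Ensures.mono h le_rfl fun _ _ ⟨h1, h2⟩ => by subst h1 h2; exact hΦ

theorem Computes.can {Φ : Bool → Store → Prop} (h : M.Computes O T n b T₁) (hΦ : Φ b T₁) :
    M.can O T Φ :=
  (h.wp hΦ).allows

theorem Computes.cond (h : M.Computes O T n a T₁)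
    (h' : Computes (if a then N₁ else N₂) O T₁ m b T₂) :
    (cond M N₁ N₂).Computes O T (n + m + 2) b T₂ :=
  wp_cond (h.wp h')

theorem Computes.seq (h : M.Computes O T n a T₁) (h' : N.Computes O T₁ m b T₂) :
    (seq M N).Computes O T (n + m + 2) b T₂ :=
  wp_seq (h.wp h')

theorem Computes.loop_step (h : M.Computes O T n true T₁) (h' : (loop M).Computes O T₁ m b T₂) :
    (loop M).Computes O T (n + m + 1) b T₂ :=
  wp_loop (h.wp h')

theorem Computes.loop_exit (h : M.Computes O T n false T₁) :
    (loop M).Computes O T (n + 1) true T₁ :=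
  wp_loop (m := 0) (h.wp ⟨rfl, rfl⟩)

/-! ## Primitive programs -/

/-- Halt at once. -/
def ret (b : Bool) : Machine := [.halt b]

theorem computes_ret : (ret b).Computes O T 0 b T := .halt b rfl ⟨rfl, rfl⟩

/-- Scan tape `i`, perform the action `f` and answer `g`. -/
def act (i : ℕ) (f : Option Bool → Option Bool × Option Dir) (g : Option Bool → Bool) : Machine :=
  [.scan i fun s => ⟨(f s).1, (f s).2, if g s then 1 else 2⟩, .halt true, .halt false]

/-- The effect of writing a symbol and moving. -/
def actOn (a : Option Bool × Option Dir) (T : Tape (Option Bool)) : Tape (Option Bool) :=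
  Action.onTape ⟨a.1, a.2, 0⟩ T

theorem computes_act (i : ℕ) (f : Option Bool → Option Bool × Option Dir) (g : Option Bool → Bool) :
    (act i f g).Computes O T 1 (g (T i).head)
      (Function.update T i (actOn (f (T i).head) (T i))) := by
  refine .step (by simp [instr, act]) fun b c' hs => ?_
  simp only [step, instr, act, List.getElem?_cons_zero, Option.getD_some, Option.some.injEq] at hs
  subst hs
  refine .halt (g (T i).head) ?_ ⟨rfl, rfl⟩
  cases g (T i).head <;> rfl

/-- Ask the base oracle about the string on tape `i`. -/
def askBase (i : ℕ) : Machine := [.query i fun a => if a then 1 else 2, .halt true, .halt false]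

theorem computes_askBase (i : ℕ) :
    (askBase i).Computes O T 1 (chi O.base (tapeString (T i))) T := by
  refine .step (by simp [instr, askBase]) fun b c' hs => ?_
  simp only [step, instr, askBase, List.getElem?_cons_zero, Option.getD_some, Option.some.injEq] at hs
  subst hs
  refine .halt (chi O.base (tapeString (T i))) ?_ ⟨rfl, rfl⟩
  cases chi O.base (tapeString (T i)) <;> rfl

/-- Answer `true` or `false`, nondeterministically. -/
def coin : Machine := [.choose 1 2, .halt false, .halt true]

theorem wp_coin {Φ : Bool → Store → Prop} (h : ∀ b, Φ b T) : coin.wp O 1 T Φ := by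
  refine .step (by simp [instr, coin]) fun b c' hs => ?_
  simp only [step, instr, coin, List.getElem?_cons_zero, Option.getD_some, Option.some.injEq] at hs
  subst hs
  refine .halt b ?_ (h b)
  cases b <;> rfl

theorem can_coin {Φ : Bool → Store → Prop} (b : Bool) (h : Φ b T) : coin.can O T Φ := by
  refine ⟨1, ⟨if b then 2 else 1, T⟩, b, .cons b ?_ (.refl _), ?_, h⟩
  · simp [step, instr, coin]
  · cases b <;> rfl

/-- Answer whether the scanned cell of tape `i` is nonblank. -/
def isCons (i : ℕ) : Machine := act i (fun s => (s, none)) Option.isSome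

theorem computes_isCons (i : ℕ) : (isCons i).Computes O T 1 (T i).head.isSome T := by
  have := computes_act (O := O) (T := T) i (fun s => (s, none)) Option.isSome
  simpa [isCons, actOn, Action.onTape] using this

/-- Pop the top of the stack on tape `i` and answer whether it was `true`. -/
def pop (i : ℕ) : Machine := act i (fun _ => (none, some .right)) (· == some true)

theorem computes_pop (i : ℕ) {l : List Bool} (h : T i = stk l) :
    (pop i).Computes O T 1 (l.headD false) (Function.update T i (stk l.tail)) := by
  have := computes_act (O := O) (T := T) i (fun _ => (none, some .right)) (· == some true)
  have h2 : ((T i).head == some true) = l.headD false := by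
    rw [h, stk_head]
    rcases l with _ | ⟨b, l⟩
    · rfl
    · cases b <;> rfl
  rw [h2] at this
  have h3 : actOn (none, some .right) (T i) = stk l.tail := by
    rw [h]; exact stk_pop l
  simp only [h3] at this
  exact this

/-- Push a symbol onto the stack on tape `i`. -/
def push (i : ℕ) (b : Bool) : Machine :=
  seq (act i (fun s => (s, some .left)) fun _ => true) (act i (fun _ => (some b, none)) fun _ => true)

theorem computes_push_raw (i : ℕ) (b : Bool) :
    (push i b).Computes O T 4 true (Function.update T i (((T i).move .left).write (some b))) := by
  have h1 := computes_act (O := O) (T := T) i (fun s => (s, some .left)) fun _ => true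
  have h2 := computes_act (O := O)
    (T := Function.update T i (actOn ((T i).head, some .left) (T i))) i
    (fun _ => (some b, none)) fun _ => true
  have := h1.seq h2
  simpa [push, actOn, Action.onTape] using this

theorem computes_push (i : ℕ) (b : Bool) {l : List Bool} (h : T i = stk l) :
    (push i b).Computes O T 4 true (Function.update T i (stk (b :: l))) := by
  have := computes_push_raw (O := O) (T := T) i b
  rwa [h, stk_push] at this

/-- As long as the scanned cell of tape `i` is nonblank, run `step`, which answers a bit, and
then `B₁` or `B₀` accordingly. -/
def whileCons (i : ℕ) (step B₀ B₁ : Machine) : Machine :=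
  loop (cond (isCons i) (seq (cond step B₁ B₀) (ret true)) (ret false))

theorem computes_whileCons_exit {i : ℕ} {S B₀ B₁ : Machine} (h : (T i).head = none) :
    (whileCons i S B₀ B₁).Computes O T 4 true T := by
  have h1 := computes_isCons (O := O) (T := T) i
  rw [h] at h1
  -- 1 for the test, 2 for `cond`, 1 for leaving the loop.
  exact ((h1.cond (N₁ := seq (cond S B₁ B₀) (ret true)) (N₂ := ret false)
    (b := false) (m := 0) computes_ret).loop_exit).mono (by omega)

theorem computes_whileCons_step {i : ℕ} {S B₀ B₁ : Machine} {T' T₁ T₂ : Store} {d : Bool}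
    (h : (T i).head ≠ none) (hS : S.Computes O T k a T')
    (hB : Computes (if a then B₁ else B₀) O T' n b T₁)
    (hL : (whileCons i S B₀ B₁).Computes O T₁ m d T₂) :
    (whileCons i S B₀ B₁).Computes O T (k + n + m + 8) d T₂ := by
  have h1 := computes_isCons (O := O) (T := T) i
  rw [Option.isSome_iff_ne_none.2 h] at h1
  -- The overhead 8 is 1 for the test, 2 each for the outer `cond`, the `seq` and the inner `cond`,
  -- and 1 for the loop.
  exact ((h1.cond (N₁ := seq (cond S B₁ B₀) (ret true)) (N₂ := ret false)
    ((hS.cond hB).seq computes_ret)).loop_step hL).mono (by omega)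

/-- Pop all symbols of the stack on tape `i`, and run `B₁` or `B₀` for each of them. -/
def forPop (i : ℕ) (B₀ B₁ : Machine) : Machine := whileCons i (pop i) B₀ B₁

theorem computes_forPop_nil {i : ℕ} {B₀ B₁ : Machine} (h : T i = stk []) :
    (forPop i B₀ B₁).Computes O T 4 true T :=
  computes_whileCons_exit (by rw [h]; rfl)

theorem computes_forPop_cons {i : ℕ} {B₀ B₁ : Machine} {l : List Bool} {d : Bool}
    (h : T i = stk (a :: l))
    (hB : Computes (if a then B₁ else B₀) O (Function.update T i (stk l)) n b T₁)
    (hL : (forPop i B₀ B₁).Computes O T₁ m d T₂) :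
    (forPop i B₀ B₁).Computes O T (n + m + 9) d T₂ :=
  (computes_whileCons_step (by rw [h]; simp [stk_head]) (computes_pop i h) hB hL).mono (by omega)

/-! ## Stores given by a list of tapes -/

end Machine

/-- The store with the given tapes, all further tapes being blank. -/
def tp (ts : List (Tape (Option Bool))) : Store := fun i => ts.getD i (stk [])

theorem update_tp {ts : List (Tape (Option Bool))} {i : ℕ} (h : i < ts.length)
    (v : Tape (Option Bool)) : Function.update (tp ts) i v = tp (ts.set i v) := by
  funext j
  unfold tp
  rcases eq_or_ne j i with rfl | hj
  · simp [h]
  · rw [Function.update_of_ne hj, List.getD_eq_getElem?_getD, List.getD_eq_getElem?_getD,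
      List.getElem?_set_ne hj.symm]

theorem tp_apply {ts : List (Tape (Option Bool))} {i : ℕ} {v : Tape (Option Bool)}
    (h : ts[i]? = some v) : tp ts i = v := by
  unfold tp
  rw [List.getD_eq_getElem?_getD, h]
  rfl

theorem lt_length_of_getElem? {α : Type*} {ts : List α} {i : ℕ} {v : α} (h : ts[i]? = some v) :
    i < ts.length := by
  by_contra h'
  simp [List.getElem?_eq_none (not_lt.1 h')] at h

theorem initial_eq_tp (x : List Bool) (n : ℕ) :
    initial x = ⟨0, tp (stk x :: List.replicate n (stk []))⟩ := by
  rw [initial_eq]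
  congr 1
  funext i
  cases i with
  | zero => rfl
  | succ i =>
    simp only [tp, Nat.succ_ne_zero, if_false, List.getD_eq_getElem?_getD,
      List.getElem?_cons_succ, List.getElem?_replicate]
    split_ifs <;> rfl

namespace Machine

variable {M N B₀ B₁ : Machine} {O : Oracles} {T T₁ T₂ : Store} {n m k i : ℕ} {a b d : Bool}
  {ts : List (Tape (Option Bool))} {l : List Bool}

theorem computes_act_tp (i : ℕ) (f : Option Bool → Option Bool × Option Dir)
    (g : Option Bool → Bool) {v : Tape (Option Bool)} (h : ts[i]? = some v) :
    (act i f g).Computes O (tp ts) 1 (g v.head) (tp (ts.set i (actOn (f v.head) v))) := by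
  have := computes_act (O := O) (T := tp ts) i f g
  rwa [tp_apply h, update_tp (lt_length_of_getElem? h)] at this

theorem computes_pop_tp (h : ts[i]? = some (stk l)) :
    (pop i).Computes O (tp ts) 1 (l.headD false) (tp (ts.set i (stk l.tail))) := by
  have := computes_pop (O := O) i (tp_apply h)
  rwa [update_tp (lt_length_of_getElem? h)] at this

theorem computes_push_tp (h : ts[i]? = some (stk l)) :
    (push i b).Computes O (tp ts) 4 true (tp (ts.set i (stk (b :: l)))) := by
  have := computes_push (O := O) i b (tp_apply h)
  rwa [update_tp (lt_length_of_getElem? h)] at this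

theorem computes_isCons_tp (h : ts[i]? = some (stk l)) :
    (isCons i).Computes O (tp ts) 1 (!l.isEmpty) (tp ts) := by
  have := computes_isCons (O := O) (T := tp ts) i
  rw [tp_apply h, stk_head] at this
  cases l <;> exact this

theorem computes_forPop_nil_tp (h : ts[i]? = some (stk [])) :
    (forPop i B₀ B₁).Computes O (tp ts) 4 true (tp ts) :=
  computes_forPop_nil (tp_apply h)

theorem computes_forPop_cons_tp (h : ts[i]? = some (stk (a :: l)))
    (hB : Computes (if a then B₁ else B₀) O (tp (ts.set i (stk l))) n b T₁)
    (hL : (forPop i B₀ B₁).Computes O T₁ m d T₂) :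
    (forPop i B₀ B₁).Computes O (tp ts) (n + m + 9) d T₂ := by
  refine computes_forPop_cons (b := b) (tp_apply h) ?_ hL
  rwa [update_tp (lt_length_of_getElem? h)]

/-! ## Features of the primitive programs -/

variable {f : Feature}

theorem avoids_ret : (ret b).Avoids f := by simp [ret, Avoids, Instr.feature]

theorem avoids_act {g : Option Bool → Option Bool × Option Dir} {g' : Option Bool → Bool} :
    (act i g g').Avoids f := by
  simp [act, Avoids, Instr.feature]

theorem avoids_askBase (hf : f ≠ .query) : (askBase i).Avoids f := by
  simp [askBase, Avoids, Instr.feature, hf.symm]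

theorem avoids_coin (hf : f ≠ .choose) : coin.Avoids f := by
  simp [coin, Avoids, Instr.feature, hf.symm]

theorem avoids_isCons : (isCons i).Avoids f := avoids_act
theorem avoids_pop : (pop i).Avoids f := avoids_act
theorem avoids_push : (push i b).Avoids f := avoids_act.seq avoids_act

theorem Avoids.whileCons (h : M.Avoids f) (h₀ : B₀.Avoids f) (h₁ : B₁.Avoids f) :
    (whileCons i M B₀ B₁).Avoids f :=
  (avoids_isCons.cond ((h.cond h₁ h₀).seq avoids_ret) avoids_ret).loop

theorem Avoids.forPop (h₀ : B₀.Avoids f) (h₁ : B₁.Avoids f) : (forPop i B₀ B₁).Avoids f :=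
  avoids_pop.whileCons h₀ h₁

/-! ## Copying strings -/

/-- Move the stack on tape `i` to tape `j`, reversing it. -/
def moveTo (i j : ℕ) : Machine := forPop i (push j false) (push j true)

theorem avoids_moveTo {j : ℕ} : (moveTo i j).Avoids f := avoids_push.forPop avoids_push

/-- Each symbol costs 9 for the iteration of `forPop` and 4 for the push. -/
theorem computes_moveTo {i j : ℕ} (hij : i ≠ j) {l : List Bool} :
    ∀ {T : Store} {r : List Bool}, T i = stk l → T j = stk r →
      (moveTo i j).Computes O T (13 * l.length + 4) true
        (Function.update (Function.update T i (stk [])) j (stk (l.reverse ++ r))) := by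
  induction l with
  | nil =>
    intro T r hi hj
    have := computes_forPop_nil (O := O) (B₀ := push j false) (B₁ := push j true) hi
    have e : Function.update (Function.update T i (stk [])) j (stk r) = T := by
      rw [← hi, Function.update_eq_self, ← hj, Function.update_eq_self]
    simpa [moveTo, e] using this
  | cons a l ih =>
    intro T r hi hj
    have hj' : Function.update T i (stk l) j = stk r := by rwa [Function.update_of_ne hij.symm]
    have h1 : Computes (if a then push j true else push j false) O (Function.update T i (stk l)) 4
        true (Function.update (Function.update T i (stk l)) j (stk (a :: r))) := by
      have := computes_push (O := O) j a hj'
      cases a <;> exact this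
    have h2 := ih (T := Function.update (Function.update T i (stk l)) j (stk (a :: r)))
      (r := a :: r) (by rw [Function.update_of_ne hij, Function.update_self])
      (by rw [Function.update_self])
    have := (computes_forPop_cons hi h1 h2).mono (m := 13 * (a :: l).length + 4)
      (by simp; omega)
    refine this.to ?_
    funext k
    by_cases hkj : k = j
    · subst hkj; simp
    · by_cases hki : k = i
      · subst hki; simp [hkj]
      · simp [hkj, hki]

/-- Copy the string at the head of tape `i` to tape `k`, using tape `j` as an auxiliary stack. -/
def copyString (i j k : ℕ) : Machine :=
  seq (whileCons i (act i (fun s => (s, some .right)) (· == some true)) (push j false) (push j true))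
    (moveTo j k)

theorem avoids_copyString {i j k : ℕ} : (copyString i j k).Avoids f :=
  (avoids_act.whileCons avoids_push avoids_push).seq avoids_moveTo

theorem exists_eq_cons_of_head_eq_some {T : Tape (Option Bool)} (a : Bool) (h : T.head = some a) :
    tapeString T = a :: tapeString (T.move .right) := by
  obtain ⟨L, R, rfl⟩ := T.exists_mk'
  induction R using ListBlank.induction_on with | _ R
  rw [Tape.move_right_mk', ListBlank.tail_mk, tapeString_mk', tapeString_mk']
  rw [Tape.mk'_head, ListBlank.head_mk] at h
  cases R with
  | nil => simp [List.headI] at h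
  | cons b R =>
    simp only [List.headI] at h
    subst h
    rfl

theorem tapeString_eq_nil {T : Tape (Option Bool)} (h : T.head = none) : tapeString T = [] := by
  obtain ⟨L, R, rfl⟩ := T.exists_mk'
  induction R using ListBlank.induction_on with | _ R
  rw [tapeString_mk']
  rw [Tape.mk'_head, ListBlank.head_mk] at h
  cases R with
  | nil => rfl
  | cons b R =>
    simp only [List.headI] at h
    subst h
    rfl

/-- The tape read is the output of an arbitrary machine and need not be a stack, so it is scanned
rather than popped; what remains of it is irrelevant, hence the unspecified `v`. -/
theorem computes_scanString {i j : ℕ} (hij : i ≠ j) {y : List Bool} :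
    ∀ {T : Store} {r : List Bool}, tapeString (T i) = y → T j = stk r → ∃ v,
      (whileCons i (act i (fun s => (s, some .right)) (· == some true)) (push j false)
        (push j true)).Computes O T (13 * y.length + 4) true
        (Function.update (Function.update T i v) j (stk (y.reverse ++ r))) := by
  induction y with
  | nil =>
    intro T r hi hj
    refine ⟨T i, ?_⟩
    have h : (T i).head = none := by
      cases h : (T i).head with
      | none => rfl
      | some a => rw [exists_eq_cons_of_head_eq_some a h] at hi; cases hi
    have := computes_whileCons_exit (O := O) (B₀ := push j false) (B₁ := push j true)
      (S := act i (fun s => (s, some .right)) (· == some true)) h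
    have e : Function.update (Function.update T i (T i)) j (stk r) = T := by
      rw [Function.update_eq_self, ← hj, Function.update_eq_self]
    simpa only [List.reverse_nil, List.nil_append, e] using this.mono (by simp)
  | cons a y ih =>
    intro T r hi hj
    have h : (T i).head = some a := by
      cases h : (T i).head with
      | none => rw [tapeString_eq_nil h] at hi; cases hi
      | some b => rw [exists_eq_cons_of_head_eq_some b h] at hi; rw [(List.cons.inj hi).1]
    rw [exists_eq_cons_of_head_eq_some a h] at hi
    have hi' := (List.cons.inj hi).2
    have h0 := computes_act (O := O) (T := T) i (fun s => (s, some .right)) (· == some true)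
    have e0 : actOn ((T i).head, some .right) (T i) = (T i).move .right := by
      simp [actOn, Action.onTape]
    have e1 : ((T i).head == some true) = a := by rw [h]; cases a <;> rfl
    simp only [e0, e1] at h0
    set T' := Function.update T i ((T i).move .right) with hT'
    have hj' : T' j = stk r := by rwa [hT', Function.update_of_ne hij.symm]
    have h1 : Computes (if a then push j true else push j false) O T' 4
        true (Function.update T' j (stk (a :: r))) := by
      have := computes_push (O := O) j a hj'
      cases a <;> exact this
    obtain ⟨v, h2⟩ := ih (T := Function.update T' j (stk (a :: r)))
      (r := a :: r) (by rw [Function.update_of_ne hij, hT', Function.update_self, hi'])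
      (by rw [Function.update_self])
    refine ⟨v, ?_⟩
    have := (computes_whileCons_step (by rw [h]; simp) h0 h1 h2).mono
      (m := 13 * (a :: y).length + 4) (by simp; omega)
    refine this.to ?_
    funext k
    by_cases hkj : k = j
    · subst hkj; simp
    · by_cases hki : k = i
      · subst hki; simp [hkj]
      · simp [hkj, hki, hT']

theorem computes_copyString {i j k : ℕ} (hij : i ≠ j) (hik : i ≠ k) (hjk : j ≠ k) {T : Store}
    (hj : T j = stk []) (hk : T k = stk []) : ∃ v,
      (copyString i j k).Computes O T (26 * (tapeString (T i)).length + 10) true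
        (Function.update (Function.update T i v) k (stk (tapeString (T i)))) := by
  obtain ⟨v, h1⟩ := computes_scanString (O := O) hij (T := T) rfl hj
  refine ⟨v, ?_⟩
  have h2 := computes_moveTo (O := O) hjk (l := (tapeString (T i)).reverse)
    (T := Function.update (Function.update T i v) j (stk ((tapeString (T i)).reverse))) (r := [])
    (by simp) (by rw [Function.update_of_ne hjk.symm, Function.update_of_ne hik.symm, hk])
  rw [List.append_nil] at h1
  have := (h1.seq h2).mono (m := 26 * (tapeString (T i)).length + 10) (by simp; omega)
  refine this.to ?_
  funext a
  by_cases hak : a = k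
  · subst hak; simp
  · by_cases haj : a = j
    · subst haj; simp [hak, hj, hij.symm]
    · by_cases hai : a = i
      · subst hai; simp [hak, haj]
      · simp [hak, haj, hai]

end Machine

/-! ### Rules with slack in the time bound; erasing and pushing strings. -/

namespace Machine

variable {M N N₁ N₂ B₀ B₁ : Machine} {O : Oracles} {T T₁ T₂ : Store} {n m k : ℕ} {a b : Bool}

theorem Computes.cond_le (h : M.Computes O T n a T₁)
    (h' : Computes (if a then N₁ else N₂) O T₁ m b T₂) (hk : n + m + 2 ≤ k) :
    (Machine.cond M N₁ N₂).Computes O T k b T₂ :=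
  (h.cond h').mono hk

theorem Computes.cond_true (h : M.Computes O T n true T₁) (h' : N₁.Computes O T₁ m b T₂)
    (hk : n + m + 2 ≤ k) : (Machine.cond M N₁ N₂).Computes O T k b T₂ :=
  h.cond_le (by simpa using h') hk

theorem Computes.cond_false (h : M.Computes O T n false T₁) (h' : N₂.Computes O T₁ m b T₂)
    (hk : n + m + 2 ≤ k) : (Machine.cond M N₁ N₂).Computes O T k b T₂ :=
  h.cond_le (by simpa using h') hk

theorem Computes.seq_le (h : M.Computes O T n a T₁) (h' : N.Computes O T₁ m b T₂)
    (hk : n + m + 2 ≤ k) : (Machine.seq M N).Computes O T k b T₂ :=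
  (h.seq h').mono hk

theorem Computes.loop_step_le (h : M.Computes O T n true T₁)
    (h' : (loop M).Computes O T₁ m b T₂) (hk : n + m + 1 ≤ k) :
    (loop M).Computes O T k b T₂ :=
  (h.loop_step h').mono hk

theorem Computes.loop_exit_le (h : M.Computes O T n false T₁) (hk : n + 1 ≤ k) :
    (loop M).Computes O T k true T₁ :=
  h.loop_exit.mono hk

theorem computes_moveTo_tp {ts : List (Tape (Option Bool))} {i j : ℕ} {l r : List Bool}
    (hij : i ≠ j) (hi : ts[i]? = some (stk l)) (hj : ts[j]? = some (stk r)) :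
    (moveTo i j).Computes O (tp ts) (13 * l.length + 4) true
      (tp ((ts.set i (stk [])).set j (stk (l.reverse ++ r)))) := by
  have := computes_moveTo (O := O) hij (tp_apply hi) (tp_apply hj)
  rwa [update_tp (lt_length_of_getElem? hi),
    update_tp (by simpa using lt_length_of_getElem? hj)] at this

section
variable {ts : List (Tape (Option Bool))} {i : ℕ} {l : List Bool}

theorem computes_pop_cons_tp (h : ts[i]? = some (stk (a :: l))) :
    (pop i).Computes O (tp ts) 1 a (tp (ts.set i (stk l))) :=
  computes_pop_tp h

theorem computes_pop_nil_tp (h : ts[i]? = some (stk [])) :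
    (pop i).Computes O (tp ts) 1 false (tp (ts.set i (stk []))) :=
  computes_pop_tp h

theorem computes_isCons_cons_tp (h : ts[i]? = some (stk (a :: l))) :
    (isCons i).Computes O (tp ts) 1 true (tp ts) :=
  computes_isCons_tp h

theorem computes_isCons_nil_tp (h : ts[i]? = some (stk [])) :
    (isCons i).Computes O (tp ts) 1 false (tp ts) :=
  computes_isCons_tp h

end

/-- Erase the stack on tape `i`. -/
def clear (i : ℕ) : Machine := forPop i (ret true) (ret true)

theorem computes_clear_tp {i : ℕ} {l : List Bool} : ∀ {ts : List (Tape (Option Bool))},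
    ts[i]? = some (stk l) →
    (clear i).Computes O (tp ts) (9 * l.length + 4) true (tp (ts.set i (stk []))) := by
  induction l with
  | nil =>
    intro ts h
    have : ts.set i (stk []) = ts := by
      obtain ⟨h1, h2⟩ := List.getElem?_eq_some_iff.1 h
      rw [← h2]; simp
    rw [this]
    exact computes_forPop_nil_tp h
  | cons a l ih =>
    intro ts h
    have hlt := lt_length_of_getElem? h
    have h2 := ih (ts := ts.set i (stk l)) (by simp [hlt])
    have h1 : Computes (if a then ret true else ret true) O (tp (ts.set i (stk l))) 0 true
        (tp (ts.set i (stk l))) := by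
      cases a <;> exact computes_ret
    refine ((computes_forPop_cons_tp h h1 h2).mono (by simp; omega)).to ?_
    rw [List.set_set]

/-- Push the symbols of a string, the first one first. -/
def pushAll (i : ℕ) : List Bool → Machine
  | [] => ret true
  | b :: l => seq (push i b) (pushAll i l)

theorem computes_pushAll_tp {i : ℕ} {l : List Bool} : ∀ {ts : List (Tape (Option Bool))}
    {r : List Bool}, ts[i]? = some (stk r) →
    (pushAll i l).Computes O (tp ts) (6 * l.length) true (tp (ts.set i (stk (l.reverse ++ r)))) := by
  induction l with
  | nil =>
    intro ts r h
    have : ts.set i (stk r) = ts := by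
      obtain ⟨h1, h2⟩ := List.getElem?_eq_some_iff.1 h
      rw [← h2]; simp
    simp only [List.reverse_nil, List.nil_append, this]
    exact computes_ret
  | cons a l ih =>
    intro ts r h
    have hlt := lt_length_of_getElem? h
    have h2 := ih (ts := ts.set i (stk (a :: r))) (r := a :: r) (by simp [hlt])
    refine ((computes_push_tp h).seq_le h2 (by simp; omega)).to ?_
    rw [List.set_set]
    simp

variable {f : Feature} {i : ℕ}

theorem avoids_clear : (clear i).Avoids f := avoids_ret.forPop avoids_ret

theorem avoids_pushAll {l : List Bool} : (pushAll i l).Avoids f := by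
  induction l with
  | nil => exact avoids_ret
  | cons b l ih => exact avoids_push.seq ih

end Machine

/-! ## Micro-operations

A micro-program acts on a flag and on infinitely many tapes: it writes and moves only if the flag is
set, and it can clear the flag according to the scanned symbol of a tape or to the answer of the
base oracle about the string on a tape. -/

inductive Op where
  | write (s : Option Bool)
  | move (d : Dir)
  | test (s : Option Bool)
  | answer (a : Bool)
  | set

namespace Op

def code : Op → List Bool
  | write none => [false, false, false, false]
  | write (some b) => [false, false, true, b]
  | move .right => [false, true, false, false]
  | move .left => [false, true, true, false]
  | test none => [true, false, false, false]
  | test (some b) => [true, false, true, b]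
  | answer a => [true, true, false, a]
  | set => [true, true, true, false]

def decode : Bool → Bool → Bool → Bool → Op
  | false, false, c, d => write (if c then some d else none)
  | false, true, c, _ => move (if c then .left else .right)
  | true, false, c, d => test (if c then some d else none)
  | true, true, c, d => if c then set else answer d

theorem exists_code (o : Op) : ∃ a b c d, o.code = [a, b, c, d] ∧ decode a b c d = o := by
  rcases o with (_ | b) | (_ | _) | (_ | b) | a | _ <;> exact ⟨_, _, _, _, rfl, rfl⟩

@[simp] theorem length_code (o : Op) : o.code.length = 4 := by
  obtain ⟨a, b, c, d, h, -⟩ := o.exists_code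
  rw [h]; rfl

/-- The effect of a micro-operation on its tape. -/
def onTape : Op → Tape (Option Bool) → Tape (Option Bool)
  | write s, T => T.write s
  | move d, T => T.move d
  | _, T => T

end Op

/-- A micro-instruction: the index of the tape and the operation. -/
abbrev Micro := ℕ × Op

def Micro.encode (r : Micro) : List Bool := List.replicate r.1 true ++ false :: r.2.code

/-- The binary code of a micro-program. -/
def encodeAll (rs : List Micro) : List Bool := rs.flatMap Micro.encode

/-- The tape `i` after a history of writes and moves. -/
def replayOn (i : ℕ) (W : Tape (Option Bool)) (hs : List Micro) : Tape (Option Bool) :=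
  hs.foldl (fun W r => if r.1 = i then r.2.onTape W else W) W

/-- The semantics of micro-instructions. The state consists of the flag and the history of the
writes and moves performed so far. -/
noncomputable def microStep (A : Language Bool) (s : Bool × List Micro) (r : Micro) : Bool × List Micro :=
  match r.2 with
  | .test a => (s.1 && ((replayOn r.1 (stk []) s.2).head == a), s.2)
  | .answer a => (s.1 && (chi A (tapeString (replayOn r.1 (stk []) s.2)) == a), s.2)
  | .set => (true, s.2)
  | _ => (s.1, if s.1 then s.2 ++ [r] else s.2)

theorem encodeAll_append (rs rs' : List Micro) :
    encodeAll (rs ++ rs') = encodeAll rs ++ encodeAll rs' := List.flatMap_append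

theorem encodeAll_cons (r : Micro) (rs : List Micro) :
    encodeAll (r :: rs) = r.encode ++ encodeAll rs := rfl

@[simp] theorem Micro.length_encode (r : Micro) : r.encode.length = r.1 + 5 := by
  simp [Micro.encode]

theorem length_le_length_encodeAll (rs : List Micro) : rs.length ≤ (encodeAll rs).length := by
  induction rs with
  | nil => simp
  | cons r rs ih => rw [encodeAll_cons]; simp; omega

theorem fits_replayOn (i : ℕ) (hs : List Micro) : ∀ {k : ℕ} {W : Tape (Option Bool)}, Fits k W →
    Fits (k + hs.length) (replayOn i W hs) := by
  induction hs with
  | nil => intro k W h; exact h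
  | cons r hs ih =>
    intro k W h
    have : Fits (k + 1) (if r.1 = i then r.2.onTape W else W) := by
      split_ifs
      · cases r.2 with
        | write s => exact h.write s
        | move d => exact h.move d
        | _ => exact h.mono (by omega)
      · exact h.mono (by omega)
    exact (ih this).mono (by simp; omega)

namespace Machine

variable {O : Oracles} {n m k : ℕ} {a b : Bool}

/-! ## The universal machine

It uses the following tapes: `0` the remaining program, `1` the work tape, `2` the reversed code of
the history, `3` the rest of the history during a replay, `4` the index of the current tape in unary,
`5` and `6` auxiliary stacks for comparing indices, `7` the flag. -/

/-- Move an index in unary from the program to tape `4`. -/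
def readIndex : Machine := loop (cond (pop 0) (seq (push 4 true) (ret true)) (ret false))

/-- Split a program into its leading index and the rest. -/
def splitIndex : List Bool → ℕ × List Bool
  | true :: l => ((splitIndex l).1 + 1, (splitIndex l).2)
  | false :: l => (0, l)
  | [] => (0, [])

theorem splitIndex_replicate (i : ℕ) (l : List Bool) :
    splitIndex (List.replicate i true ++ false :: l) = (i, l) := by
  induction i with
  | zero => rfl
  | succ i ih => simp [List.replicate_succ, splitIndex, ih]

/-- Needed for arbitrary strings: the universal machine must be clocked on malformed programs too.
-/
theorem splitIndex_length (l : List Bool) : (splitIndex l).1 + (splitIndex l).2.length ≤ l.length := by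
  induction l with
  | nil => simp [splitIndex]
  | cons b l ih => cases b <;> simp [splitIndex]; omega

theorem splitIndex_length_lt {l : List Bool} (h : l ≠ []) :
    (splitIndex l).2.length < l.length := by
  cases l with
  | nil => exact absurd rfl h
  | cons b l =>
    have := splitIndex_length l
    cases b <;> simp [splitIndex]; omega

theorem computes_readIndex {w h h' r' e f : Tape (Option Bool)} (l : List Bool) : ∀ (k : ℕ),
    readIndex.Computes O (tp [stk l, w, h, h', stk (List.replicate k true), r', e, f])
      (20 * l.length + 20) true
      (tp [stk (splitIndex l).2, w, h, h', stk (List.replicate (k + (splitIndex l).1) true),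
        r', e, f]) := by
  induction l with
  | nil =>
    intro k
    exact .loop_exit_le (n := 3) (.cond_false (computes_pop_nil_tp rfl) computes_ret le_rfl) (by simp)
  | cons b l ih =>
    intro k
    cases b
    · exact .loop_exit_le (n := 3) (.cond_false (computes_pop_cons_tp rfl) computes_ret le_rfl) (by simp)
    · refine Computes.to (Computes.loop_step_le (k := 20 * (true :: l).length + 20) (.cond_true (k := 9)
        (computes_pop_cons_tp rfl) (.seq_le (k := 6) (computes_push_tp rfl) computes_ret le_rfl) le_rfl)
        (ih (k + 1)) ?_) ?_
      · simp; omega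
      · rw [splitIndex, show k + 1 + (splitIndex l).1 = k + ((splitIndex l).1 + 1) by omega]

/-- Compare the index at the front of tape `3` with the index on tape `4`, moving the former to
tape `2`. -/
def matchIndex : Machine :=
  loop (cond (pop 3)
    (seq (push 2 true) (seq (cond (isCons 4) (seq (pop 4) (push 5 true)) (push 6 true)) (ret true)))
    (seq (push 2 false) (ret false)))

/-- Every `true` of the entry's index `j` moves a mark from tape `4` to tape `5`, or adds one to
tape `6` once tape `4` is empty. With truncated subtraction, tapes `4` and `6` end with `a - j` and
`c + (j - a)` marks; started with `c = 0`, both are empty exactly if `a = j`. -/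
theorem computes_matchIndex {p w f : Tape (Option Bool)} {s : List Bool} (j : ℕ) :
    ∀ (a b c : ℕ) (h : List Bool),
    matchIndex.Computes O (tp [p, w, stk h, stk (List.replicate j true ++ false :: s),
        stk (List.replicate a true), stk (List.replicate b true), stk (List.replicate c true), f])
      (40 * j + 20) true
      (tp [p, w, stk (false :: (List.replicate j true ++ h)), stk s,
        stk (List.replicate (a - j) true), stk (List.replicate (b + min a j) true),
        stk (List.replicate (c + (j - a)) true), f]) := by
  induction j with
  | zero =>
    intro a b c h
    refine Computes.to (Computes.loop_exit_le (k := 20) (n := 10) (.cond_false (k := 10) (computes_pop_cons_tp rfl)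
      (.seq_le (k := 7) (computes_push_tp rfl) computes_ret (by omega)) le_rfl) (by omega)) ?_
    simp
  | succ j ih =>
    intro a b c h
    -- A `true` pushed below the remaining ones is indistinguishable from one pushed on top.
    have e1 : List.replicate j true ++ true :: h = true :: (List.replicate j true ++ h) := by
      rw [← List.singleton_append, ← List.append_assoc, ← List.replicate_succ', List.replicate_succ]
      rfl
    cases a with
    | zero =>
      refine Computes.to (Computes.loop_step_le (k := 40 * (j + 1) + 20) (.cond_true (k := 30)
        (computes_pop_cons_tp rfl) (.seq_le (k := 20) (computes_push_tp rfl) (.seq_le (k := 14) (.cond_false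
          (k := 10) (computes_isCons_nil_tp rfl) (computes_push_tp rfl) (by omega)) computes_ret
          (by omega)) (by omega)) (by omega)) (ih 0 b (c + 1) (true :: h)) (by omega)) ?_
      rw [e1]
      simp [List.replicate_succ]
      grind
    | succ a =>
      refine Computes.to (Computes.loop_step_le (k := 40 * (j + 1) + 20) (.cond_true (k := 30)
        (computes_pop_cons_tp rfl) (.seq_le (k := 20) (computes_push_tp rfl) (.seq_le (k := 14) (.cond_true
          (k := 11) (computes_isCons_cons_tp rfl) (.seq_le (k := 8) (computes_pop_cons_tp rfl)
          (computes_push_tp rfl) (by omega)) (by omega)) computes_ret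
          (by omega)) (by omega)) (by omega)) (ih a (b + 1) c (true :: h)) (by omega)) ?_
      rw [e1]
      simp [List.replicate_succ]
      grind

end Machine

/-! ### Decoding operations and replaying the history onto the work tape. -/

namespace Machine

variable {O : Oracles} {n m k i : ℕ} {a b : Bool}

/-- Pop a symbol of tape `i` and continue according to it. -/
def branch (i : ℕ) (B : Bool → Machine) : Machine := cond (pop i) (B true) (B false)

theorem computes_branch_tp {ts : List (Tape (Option Bool))} {l : List Bool} {B : Bool → Machine}
    {T : Store} (h : ts[i]? = some (stk l))
    (hB : (B (l.headD false)).Computes O (tp (ts.set i (stk l.tail))) n b T) :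
    (branch i B).Computes O (tp ts) (n + 3) b T := by
  refine (computes_pop_tp h).cond_le (m := n) ?_ (by omega)
  cases h : l.headD false <;> rw [h] at hB <;> exact hB

/-- Read the code of an operation from tape `i`. -/
def readOp (i : ℕ) (body : Op → Machine) : Machine :=
  branch i fun a => branch i fun b => branch i fun c => branch i fun d => body (Op.decode a b c d)

/-- The operation whose code is at the front of a string. -/
def headOp (l : List Bool) : Op :=
  Op.decode (l.headD false) (l.tail.headD false) (l.tail.tail.headD false)
    (l.tail.tail.tail.headD false)

theorem headOp_code (o : Op) (l : List Bool) : headOp (o.code ++ l) = o := by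
  obtain ⟨a, b, c, d, h, h'⟩ := o.exists_code
  rw [h]
  exact h'

/-- Four bits are read at 3 steps each. A truncated code is padded by `false`, so reading never
fails. -/
theorem computes_readOp_tp {ts : List (Tape (Option Bool))} {l : List Bool} {body : Op → Machine}
    {T : Store} (h : ts[i]? = some (stk l))
    (hB : (body (headOp l)).Computes O (tp (ts.set i (stk (l.drop 4)))) n b T) :
    (readOp i body).Computes O (tp ts) (n + 12) b T := by
  have hlt := lt_length_of_getElem? h
  refine computes_branch_tp h (computes_branch_tp (l := l.tail) (by simp [hlt])
    (computes_branch_tp (l := l.tail.tail) (by simp [hlt])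
    (computes_branch_tp (l := l.tail.tail.tail) (by simp [hlt]) ?_)))
  have e : l.tail.tail.tail.tail = l.drop 4 := by simp only [← List.drop_one, List.drop_drop]
  simp only [List.set_set]
  rw [e]
  exact hB

/-- Perform an operation on the work tape. -/
def onWork : Op → Machine
  | .write s => act 1 (fun _ => (s, none)) fun _ => true
  | .move d => act 1 (fun s => (s, some d)) fun _ => true
  | _ => ret true

theorem computes_onWork (o : Op) {p W : Tape (Option Bool)} {ts : List (Tape (Option Bool))} :
    (onWork o).Computes O (tp (p :: W :: ts)) 1 true (tp (p :: o.onTape W :: ts)) := by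
  cases o with
  | write s => exact computes_act_tp 1 _ _ rfl
  | move d =>
    refine Computes.to (computes_act_tp 1 _ _ rfl) ?_
    simp [actOn, Action.onTape, Op.onTape]
  | _ => exact computes_ret.mono (by omega)

/-- Undo the changes of `matchIndex` on the tapes `4`, `5` and `6`. -/
def restoreIndex : Machine := seq (moveTo 5 4) (clear 6)

theorem computes_restoreIndex {p W h h' f : Tape (Option Bool)} (i j : ℕ) :
    restoreIndex.Computes O (tp [p, W, h, h', stk (List.replicate (i - j) true),
        stk (List.replicate (0 + min i j) true), stk (List.replicate (0 + (j - i)) true), f])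
      (22 * j + 10) true
      (tp [p, W, h, h', stk (List.replicate i true), stk [], stk [], f]) := by
  refine Computes.to (Computes.seq_le (computes_moveTo_tp (by omega) rfl rfl)
    (computes_clear_tp rfl) ?_) ?_
  · simp; omega
  · have : (List.replicate (0 + min i j) true).reverse ++ List.replicate (i - j) true =
        List.replicate i true := by
      rw [List.reverse_replicate, List.replicate_append_replicate]
      congr 1; omega
    rw [this]
    rfl

/-- Replay one entry of the history. -/
def replayEntry : Machine :=
  seq matchIndex
    (cond (cond (isCons 4) (ret false) (cond (isCons 6) (ret false) (ret true)))
      (seq restoreIndex (readOp 3 fun o => seq (pushAll 2 o.code) (onWork o)))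
      (seq restoreIndex (readOp 3 fun o => pushAll 2 o.code)))

/-- The entry is always transferred back to tape `2`, but its operation is applied to the work tape
only if its index is `i`. -/
theorem computes_replayEntry {p W f : Tape (Option Bool)} (r : Micro) (i : ℕ) (h s : List Bool) :
    replayEntry.Computes O (tp [p, W, stk h, stk (r.encode ++ s), stk (List.replicate i true),
        stk [], stk [], f])
      (100 * r.encode.length) true
      (tp [p, if r.1 = i then r.2.onTape W else W, stk (r.encode.reverse ++ h), stk s,
        stk (List.replicate i true), stk [], stk [], f]) := by
  obtain ⟨j, o⟩ := r
  have e : Micro.encode (j, o) ++ s = List.replicate j true ++ false :: (o.code ++ s) := by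
    simp [Micro.encode]
  have e' : (Micro.encode (j, o)).reverse ++ h =
      o.code.reverse ++ (false :: (List.replicate j true ++ h)) := by
    simp [Micro.encode]
  have ed : (o.code ++ s).drop 4 = s := List.drop_left' o.length_code
  rw [e, e', Micro.length_encode]
  refine Computes.seq_le (m := 22 * j + 100) (b := true)
    (computes_matchIndex (s := o.code ++ s) j i 0 0 h) ?_ (by simp only; omega)
  have hskip : Computes (readOp 3 fun o => pushAll 2 o.code) O
      (tp [p, W, stk (false :: (List.replicate j true ++ h)), stk (o.code ++ s),
        stk (List.replicate i true), stk [], stk [], f]) 36 true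
      (tp [p, W, stk (o.code.reverse ++ (false :: (List.replicate j true ++ h))), stk s,
        stk (List.replicate i true), stk [], stk [], f]) := by
    refine (computes_readOp_tp rfl (n := 24) ?_).mono (by omega)
    rw [headOp_code, ed]
    exact Computes.mono (computes_pushAll_tp rfl) (by simp)
  have happly : Computes (readOp 3 fun o => seq (pushAll 2 o.code) (onWork o)) O
      (tp [p, W, stk (false :: (List.replicate j true ++ h)), stk (o.code ++ s),
        stk (List.replicate i true), stk [], stk [], f]) 39 true
      (tp [p, o.onTape W, stk (o.code.reverse ++ (false :: (List.replicate j true ++ h))), stk s,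
        stk (List.replicate i true), stk [], stk [], f]) := by
    refine (computes_readOp_tp rfl (n := 27) ?_).mono (by omega)
    rw [headOp_code, ed]
    exact Computes.seq_le (computes_pushAll_tp rfl) (computes_onWork o) (by simp)
  -- After the comparison tape `4` is nonempty if `j < i`, tape `6` is nonempty if `i < j`, and both
  -- are empty if the indices agree.
  rcases lt_trichotomy j i with hij | rfl | hij
  · obtain ⟨d, hd⟩ : ∃ d, i - j = d + 1 := ⟨i - j - 1, by omega⟩
    rw [if_neg (by simp only; omega)]
    refine Computes.cond_false (n := 10) ?_
      (Computes.seq_le (computes_restoreIndex i j) hskip le_rfl) (by omega)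
    rw [hd]
    exact Computes.cond_true (m := 0) (computes_isCons_cons_tp rfl) computes_ret (by omega)
  · rw [if_pos rfl]
    refine Computes.cond_true (n := 10) ?_
      (Computes.seq_le (computes_restoreIndex j j) happly le_rfl) (by omega)
    rw [Nat.sub_self]
    exact Computes.cond_false (computes_isCons_nil_tp rfl) (Computes.cond_false
      (computes_isCons_nil_tp rfl) computes_ret le_rfl) (by omega)
  · obtain ⟨d, hd⟩ : ∃ d, 0 + (j - i) = d + 1 := ⟨j - i - 1, by omega⟩
    rw [if_neg (by simp only; omega)]
    refine Computes.cond_false (n := 10) ?_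
      (Computes.seq_le (computes_restoreIndex i j) hskip le_rfl) (by omega)
    rw [hd, Nat.sub_eq_zero_of_le hij.le]
    exact Computes.cond_false (computes_isCons_nil_tp rfl) (Computes.cond_true (m := 0)
      (computes_isCons_cons_tp rfl) computes_ret le_rfl) (by omega)

def replayLoop : Machine := loop (cond (isCons 3) (seq replayEntry (ret true)) (ret false))

theorem computes_replayLoop {p f : Tape (Option Bool)} (i : ℕ) (hs : List Micro) :
    ∀ (W : Tape (Option Bool)) (h : List Bool),
    replayLoop.Computes O (tp [p, W, stk h, stk (encodeAll hs), stk (List.replicate i true),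
        stk [], stk [], f])
      (110 * (encodeAll hs).length + 10) true
      (tp [p, replayOn i W hs, stk ((encodeAll hs).reverse ++ h), stk [],
        stk (List.replicate i true), stk [], stk [], f]) := by
  induction hs with
  | nil =>
    intro W h
    exact Computes.loop_exit_le (Computes.cond_false (computes_isCons_nil_tp rfl) computes_ret
      le_rfl) (by simp)
  | cons r hs ih =>
    intro W h
    obtain ⟨a, t, ht⟩ : ∃ a t, r.encode ++ encodeAll hs = a :: t := by
      have : r.encode ++ encodeAll hs ≠ [] := by simp [Micro.encode]
      exact ⟨_, _, (List.cons_head_tail this).symm⟩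
    have hc : (isCons 3).Computes O (tp [p, W, stk h, stk (r.encode ++ encodeAll hs),
        stk (List.replicate i true), stk [], stk [], f]) 1 true (tp [p, W, stk h,
        stk (r.encode ++ encodeAll hs), stk (List.replicate i true), stk [], stk [], f]) := by
      rw [ht]; exact computes_isCons_cons_tp rfl
    rw [encodeAll_cons]
    refine Computes.to (Computes.loop_step_le (Computes.cond_true hc
      (Computes.seq_le (computes_replayEntry r i h _) computes_ret le_rfl) le_rfl)
      (ih _ _) ?_) ?_
    · simp; omega
    · rw [List.reverse_append, List.append_assoc]
      rfl

/-- Recompute the tape whose index is on tape `4`. -/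
def replay : Machine := seq (moveTo 2 3) replayLoop

/-- The history is stored reversed on tape `2`, so that entries can be appended by pushing; moving
it to tape `3` puts it in chronological order, at 13 steps per symbol besides the 110 of the loop.
-/
theorem computes_replay {p f W : Tape (Option Bool)} (i : ℕ) (hs : List Micro) :
    replay.Computes O (tp [p, W, stk (encodeAll hs).reverse, stk [], stk (List.replicate i true),
        stk [], stk [], f])
      (123 * (encodeAll hs).length + 20) true
      (tp [p, replayOn i W hs, stk (encodeAll hs).reverse, stk [],
        stk (List.replicate i true), stk [], stk [], f]) := by
  have h1 := computes_replayLoop (O := O) (p := p) (f := f) i hs W []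
  rw [List.append_nil] at h1
  refine Computes.seq_le (computes_moveTo_tp (by omega) rfl rfl)
    (m := 110 * (encodeAll hs).length + 10) ?_ ?_
  · rw [List.reverse_reverse, List.append_nil]
    exact h1
  · simp; omega

/-! ### Executing an instruction -/

def testFlag : Machine := act 7 (fun s => (s, none)) (· == some true)

def setFlag (b : Bool) : Machine := act 7 (fun _ => (some b, none)) fun _ => true

theorem stk_write (b c : Bool) (l : List Bool) : (stk (b :: l)).write (some c) = stk (c :: l) := by
  unfold stk Tape.mk₁ Tape.mk₂
  rw [Tape.write_mk', ListBlank.tail_mk, ListBlank.cons_mk]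
  rfl

variable {p W h h' r r' e : Tape (Option Bool)} {f : Bool}

theorem computes_testFlag : testFlag.Computes O (tp [p, W, h, h', r, r', e, stk [f]]) 1 f
    (tp [p, W, h, h', r, r', e, stk [f]]) := by
  have := computes_act_tp (O := O) (ts := [p, W, h, h', r, r', e, stk [f]]) 7
    (fun s => (s, none)) (· == some true) rfl
  cases f <;> exact this

theorem computes_setFlag (b : Bool) :
    (setFlag b).Computes O (tp [p, W, h, h', r, r', e, stk [f]]) 1 true
      (tp [p, W, h, h', r, r', e, stk [b]]) := by
  have := computes_act_tp (O := O) (ts := [p, W, h, h', r, r', e, stk [f]]) 7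
    (fun _ => (some b, none)) (fun _ => true) rfl
  refine this.to ?_
  rw [show actOn (some b, none) (stk [f]) = stk [b] from stk_write f b []]
  rfl

/-- Append a write or a move to the history if the flag is set. -/
def record (o : Op) : Machine :=
  cond testFlag (seq (moveTo 4 2) (seq (push 2 false) (pushAll 2 o.code))) (ret true)

/-- Execute an operation when the work tape holds the current tape. -/
def exec : Op → Machine
  | .test s => cond (act 1 (fun s => (s, none)) (· == s)) (ret true) (setFlag false)
  | .answer a => cond (askBase 1) (if a then ret true else setFlag false)
      (if a then setFlag false else ret true)
  | .set => setFlag true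
  | o => record o

/-- Recording consumes the unary index on tape `4`, which becomes part of the new entry; otherwise
the index stays. It is erased later, so only the bound `j ≤ i` matters. -/
theorem computes_record (o : Op) (i : ℕ) (hs : List Micro) : ∃ j ≤ i,
    (record o).Computes O (tp [p, W, stk (encodeAll hs).reverse, h', stk (List.replicate i true),
        r', e, stk [f]]) (13 * i + 60) true
      (tp [p, W, stk (encodeAll (if f then hs ++ [(i, o)] else hs)).reverse, h',
        stk (List.replicate j true), r', e, stk [f]]) := by
  cases f
  · exact ⟨i, le_rfl, Computes.cond_false computes_testFlag computes_ret (by omega)⟩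
  · refine ⟨0, Nat.zero_le _, Computes.cond_true computes_testFlag (Computes.to
      (Computes.seq_le (computes_moveTo_tp (by omega) rfl rfl) (Computes.seq_le
        (computes_push_tp rfl) (computes_pushAll_tp rfl) le_rfl) le_rfl) ?_) ?_⟩
    · have : (encodeAll (hs ++ [(i, o)])).reverse = o.code.reverse ++ false ::
          ((List.replicate i true).reverse ++ (encodeAll hs).reverse) := by
        rw [encodeAll_append, List.reverse_append]
        simp [encodeAll, Micro.encode]
      rw [if_pos rfl, this]
      rfl
    · simp; omega

theorem computes_exec (o : Op) (i : ℕ) (hs : List Micro) : ∃ j ≤ i, ∃ b,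
    (exec o).Computes O (tp [p, replayOn i (stk []) hs, stk (encodeAll hs).reverse, h',
        stk (List.replicate i true), r', e, stk [f]]) (13 * i + 60) b
      (tp [p, replayOn i (stk []) hs, stk (encodeAll (microStep O.base (f, hs) (i, o)).2).reverse, h',
        stk (List.replicate j true), r', e, stk [(microStep O.base (f, hs) (i, o)).1]]) := by
  cases o with
  | write s =>
    obtain ⟨j, hj, H⟩ := computes_record (O := O) (p := p) (W := replayOn i (stk []) hs) (h' := h')
      (r' := r') (e := e) (f := f) (.write s) i hs
    exact ⟨j, hj, true, H⟩
  | move d =>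
    obtain ⟨j, hj, H⟩ := computes_record (O := O) (p := p) (W := replayOn i (stk []) hs) (h' := h')
      (r' := r') (e := e) (f := f) (.move d) i hs
    exact ⟨j, hj, true, H⟩
  | test s =>
    refine ⟨i, le_rfl, true, ?_⟩
    have h1 := computes_act_tp (O := O) (ts := [p, replayOn i (stk []) hs,
      stk (encodeAll hs).reverse, h', stk (List.replicate i true), r', e, stk [f]]) 1
      (fun s => (s, none)) (· == s) rfl
    rw [show actOn ((replayOn i (stk []) hs).head, none) (replayOn i (stk []) hs) =
      replayOn i (stk []) hs from Tape.write_self _] at h1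
    simp only [microStep, exec]
    cases hb : (replayOn i (stk []) hs).head == s
    · rw [hb] at h1
      rw [Bool.and_false]
      exact Computes.cond_false h1 (computes_setFlag false) (by omega)
    · rw [hb] at h1
      rw [Bool.and_true]
      exact Computes.cond_true h1 computes_ret (by omega)
  | answer a =>
    refine ⟨i, le_rfl, true, ?_⟩
    have h1 := computes_askBase (O := O) (T := tp [p, replayOn i (stk []) hs,
      stk (encodeAll hs).reverse, h', stk (List.replicate i true), r', e, stk [f]]) 1
    rw [tp_apply (v := replayOn i (stk []) hs) rfl] at h1
    simp only [microStep, exec]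
    cases hb : chi O.base (tapeString (replayOn i (stk []) hs))
    · rw [hb] at h1
      cases a
      · rw [beq_self_eq_true, Bool.and_true]
        exact Computes.cond_false h1 computes_ret (by omega)
      · rw [show (false == true) = false from rfl, Bool.and_false]
        exact Computes.cond_false h1 (computes_setFlag false) (by omega)
    · rw [hb] at h1
      cases a
      · rw [show (true == false) = false from rfl, Bool.and_false]
        exact Computes.cond_true h1 (computes_setFlag false) (by omega)
      · rw [beq_self_eq_true, Bool.and_true]
        exact Computes.cond_true h1 computes_ret (by omega)
  | set => exact ⟨i, le_rfl, true, (computes_setFlag true).mono (by omega)⟩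

end Machine

namespace Machine

variable {O : Oracles} {n m k i : ℕ} {a b : Bool} {p W : Tape (Option Bool)}
  {ts : List (Tape (Option Bool))}

/-! ### Erasing the work tape -/

def shiftWork (b : Bool) : Machine :=
  seq (push 3 b) (act 1 (fun s => (s, some .left)) fun _ => true)

def eraseWork : Machine := act 1 (fun _ => (none, some .right)) fun _ => true

def eraseTwice (b : Bool) : Machine := seq (push 2 b) (seq eraseWork eraseWork)

/-- Erase the work tape. The length of the history bounds the area to be erased. -/
def clearWork : Machine :=
  seq (forPop 2 (shiftWork false) (shiftWork true)) (forPop 3 (eraseTwice false) (eraseTwice true))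

/-- Moving left once per symbol of the history pushes the whole left half of the work tape to the
right of the head, lengthening the right half by at most `h.length`. -/
theorem computes_shiftWork_loop (h : List Bool) : ∀ (h' : List Bool) (L R : List (Option Bool)),
    ∃ R', R'.length ≤ R.length + h.length ∧
    (forPop 2 (shiftWork false) (shiftWork true)).Computes O
      (tp (p :: Tape.mk' (ListBlank.mk L) (ListBlank.mk R) :: stk h :: stk h' :: ts))
      (20 * h.length + 4) true
      (tp (p :: Tape.mk' (ListBlank.mk (L.drop h.length)) (ListBlank.mk R') :: stk [] ::
        stk (h.reverse ++ h') :: ts)) := by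
  induction h with
  | nil => exact fun h' L R => ⟨R, le_rfl, computes_forPop_nil_tp rfl⟩
  | cons c h ih =>
    intro h' L R
    obtain ⟨R', hR, ih⟩ := ih (c :: h') L.tail (L.headI :: R)
    refine ⟨R', by simp at hR ⊢; omega, ?_⟩
    have h1 : (shiftWork c).Computes O
        (tp (p :: Tape.mk' (ListBlank.mk L) (ListBlank.mk R) :: stk h :: stk h' :: ts)) 7 true
        (tp (p :: Tape.mk' (ListBlank.mk L.tail) (ListBlank.mk (L.headI :: R)) :: stk h ::
          stk (c :: h') :: ts)) := by
      refine Computes.to (Computes.seq_le (computes_push_tp rfl) (computes_act_tp 1 _ _ rfl)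
        (by omega)) ?_
      have : actOn ((Tape.mk' (ListBlank.mk L) (ListBlank.mk R)).head, some .left)
          (Tape.mk' (ListBlank.mk L) (ListBlank.mk R)) =
          Tape.mk' (ListBlank.mk L.tail) (ListBlank.mk (L.headI :: R)) := by
        simp only [actOn, Action.onTape, Tape.write_self]
        rw [Tape.move_left_mk', ListBlank.tail_mk, ListBlank.head_mk, ListBlank.cons_mk]
      rw [← this]
      rfl
    refine Computes.to (Computes.mono (computes_forPop_cons_tp (n := 7) (b := true) rfl ?_ ih) ?_) ?_
    · cases c <;> exact h1
    · simp; omega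
    · simp

theorem eraseWork_eq (R : List (Option Bool)) :
    actOn (none, some .right) (Tape.mk' (ListBlank.mk []) (ListBlank.mk R)) =
      Tape.mk' (ListBlank.mk []) (ListBlank.mk R.tail) := by
  simp only [actOn, Action.onTape]
  rw [Tape.write_mk', Tape.move_right_mk', ListBlank.head_cons, ListBlank.tail_cons,
    listBlank_cons_none, ListBlank.tail_mk]

/-- After the shift the right half may be twice as long as the history, so two cells are erased per
symbol; the erased cells on the left are invisible. -/
theorem computes_eraseTwice_loop (h' : List Bool) : ∀ (h : List Bool) (R : List (Option Bool)),
    (forPop 3 (eraseTwice false) (eraseTwice true)).Computes O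
      (tp (p :: Tape.mk' (ListBlank.mk []) (ListBlank.mk R) :: stk h :: stk h' :: ts))
      (20 * h'.length + 4) true
      (tp (p :: Tape.mk' (ListBlank.mk []) (ListBlank.mk (R.drop (2 * h'.length))) ::
        stk (h'.reverse ++ h) :: stk [] :: ts)) := by
  induction h' with
  | nil => exact fun h R => computes_forPop_nil_tp rfl
  | cons c h' ih =>
    intro h R
    have h1 : (eraseTwice c).Computes O
        (tp (p :: Tape.mk' (ListBlank.mk []) (ListBlank.mk R) :: stk h :: stk h' :: ts)) 10 true
        (tp (p :: Tape.mk' (ListBlank.mk []) (ListBlank.mk R.tail.tail) :: stk (c :: h) ::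
          stk h' :: ts)) := by
      refine Computes.to (Computes.seq_le (computes_push_tp rfl) (Computes.seq_le
        (computes_act_tp 1 _ _ rfl) (computes_act_tp 1 _ _ rfl) le_rfl)
        (by omega)) ?_
      rw [← eraseWork_eq, ← eraseWork_eq]
      rfl
    refine Computes.to (Computes.mono (computes_forPop_cons_tp (n := 10) (b := true)
      rfl ?_ (ih (c :: h) R.tail.tail)) ?_) ?_
    · cases c <;> exact h1
    · simp; omega
    · rw [show R.tail.tail = R.drop 2 by simp [← List.drop_one], List.drop_drop]
      simp [mul_add, add_comm]

theorem computes_clearWork {h : List Bool} (hW : Fits h.length W) :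
    clearWork.Computes O (tp (p :: W :: stk h :: stk [] :: ts)) (40 * h.length + 10) true
      (tp (p :: stk [] :: stk h :: stk [] :: ts)) := by
  obtain ⟨L, R, hL, hR, rfl⟩ := hW
  obtain ⟨R', hR', h1⟩ := computes_shiftWork_loop (O := O) (p := p) (ts := ts) h [] L R
  rw [List.drop_eq_nil_of_le hL, List.append_nil] at h1
  have h2 := computes_eraseTwice_loop (O := O) (p := p) (ts := ts) h.reverse [] R'
  rw [List.drop_eq_nil_of_le (by rw [List.length_reverse]; omega), List.append_nil,
    List.reverse_reverse] at h2
  exact h1.seq_le h2 (by rw [List.length_reverse]; omega)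

/-! ### The main loop -/

/-- Read and execute one instruction. -/
def runInstr : Machine :=
  seq readIndex (seq replay (seq (readOp 0 exec) (seq (clear 4) clearWork)))

/-- The instruction at the front of a program. -/
def headMicro (l : List Bool) : Micro := ((splitIndex l).1, headOp (splitIndex l).2)

theorem headMicro_encode (r : Micro) (l : List Bool) :
    headMicro (r.encode ++ l) = r ∧ (splitIndex (r.encode ++ l)).2.drop 4 = l := by
  obtain ⟨i, o⟩ := r
  have : splitIndex (Micro.encode (i, o) ++ l) = (i, o.code ++ l) := by
    simp only [Micro.encode, List.append_assoc, List.cons_append]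
    exact splitIndex_replicate i _
  simp only [headMicro, this, headOp_code, true_and]
  exact List.drop_left' o.length_code

/-- The second bound controls the growth of the history; the third shows that the code of the
history is long enough to measure the area that `clearWork` has to erase. -/
theorem length_encodeAll_microStep (A : Language Bool) (s : Bool × List Micro) (r : Micro) :
    (encodeAll s.2).length ≤ (encodeAll (microStep A s r).2).length ∧
    (encodeAll (microStep A s r).2).length ≤ (encodeAll s.2).length + (r.1 + 5) ∧
    s.2.length ≤ (encodeAll (microStep A s r).2).length := by
  obtain ⟨f, hs⟩ := s
  obtain ⟨i, o⟩ := r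
  have h1 := length_le_length_encodeAll hs
  have h2 : (encodeAll (hs ++ [(i, o)])).length = (encodeAll hs).length + (i + 5) := by
    rw [encodeAll_append, List.length_append]
    simp [encodeAll]
  cases o <;> simp only [microStep] <;> (try split_ifs) <;> (try rw [h2]) <;> omega

theorem computes_runInstr {f : Bool} (hs : List Micro) (l : List Bool) :
    runInstr.Computes O (tp [stk l, stk [], stk (encodeAll hs).reverse, stk [], stk [], stk [],
        stk [], stk [f]])
      (200 * (l.length + (encodeAll hs).length) + 500) true
      (tp [stk ((splitIndex l).2.drop 4), stk [],
        stk (encodeAll (microStep O.base (f, hs) (headMicro l)).2).reverse, stk [],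
        stk [], stk [], stk [], stk [(microStep O.base (f, hs) (headMicro l)).1]]) := by
  have hl := splitIndex_length l
  have hlen := length_encodeAll_microStep O.base (f, hs) (headMicro l)
  obtain ⟨j, hj, b, he⟩ := computes_exec (O := O) (p := stk ((splitIndex l).2.drop 4))
    (h' := stk []) (r' := stk []) (e := stk []) (f := f) (headMicro l).2 (headMicro l).1 hs
  have h1 : readIndex.Computes O (tp [stk l, stk [], stk (encodeAll hs).reverse, stk [], stk [],
      stk [], stk [], stk [f]]) (20 * l.length + 20) true (tp [stk (splitIndex l).2, stk [],
      stk (encodeAll hs).reverse, stk [], stk (List.replicate (splitIndex l).1 true), stk [],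
      stk [], stk [f]]) := by
    have := computes_readIndex (O := O) (w := stk []) (h := stk (encodeAll hs).reverse)
      (h' := stk []) (r' := stk []) (e := stk []) (f := stk [f]) l 0
    rwa [Nat.zero_add] at this
  have h3 := computes_readOp_tp (O := O) (i := 0) (body := exec) (l := (splitIndex l).2)
    (ts := [stk (splitIndex l).2, replayOn (splitIndex l).1 (stk []) hs, stk (encodeAll hs).reverse,
      stk [], stk (List.replicate (splitIndex l).1 true), stk [], stk [], stk [f]]) rfl he
  have hfit : Fits (encodeAll (microStep O.base (f, hs) (headMicro l)).2).reverse.length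
      (replayOn (splitIndex l).1 (stk []) hs) := by
    refine (fits_replayOn _ hs (fits_stk [])).mono ?_
    rw [List.length_reverse]
    simpa using hlen.2.2
  refine h1.seq_le ((computes_replay _ hs).seq_le (h3.seq_le ((computes_clear_tp (i := 4) rfl).seq_le
    (computes_clearWork hfit) le_rfl) le_rfl) le_rfl) ?_
  have h5 : (headMicro l).1 = (splitIndex l).1 := rfl
  have h4 := hlen.2.1
  rw [h5] at h4
  simp only [List.length_reverse, List.length_replicate, Prod.mk.eta] at h4 ⊢
  omega

def runLoop : Machine := loop (cond (isCons 0) (seq runInstr (ret true)) (ret false))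

/-- The potential `(encodeAll hs).length + 6 * l.length` never increases: an instruction with index
`i` lengthens the history by at most `i + 5`, and, even if truncated, consumes at least one symbol
and at least `i` of them. So `K` bounds the history throughout, on every string; the semantics is
asserted only for proper codes. -/
theorem exists_computes_runLoop {K : ℕ} : ∀ (N : ℕ) (l : List Bool), l.length ≤ N →
    ∀ (f : Bool) (hs : List Micro), (encodeAll hs).length + 6 * l.length ≤ K →
    ∃ (f' : Bool) (hs' : List Micro), (encodeAll hs').length ≤ K ∧
      runLoop.Computes O (tp [stk l, stk [], stk (encodeAll hs).reverse, stk [], stk [], stk [],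
        stk [], stk [f]]) (l.length * (200 * K + 600) + 10) true
        (tp [stk [], stk [], stk (encodeAll hs').reverse, stk [], stk [], stk [], stk [],
          stk [f']]) ∧
      ∀ rs, l = encodeAll rs → (f', hs') = rs.foldl (microStep O.base) (f, hs) := by
  intro N
  induction N with
  | zero =>
    intro l hl f hs hK
    obtain rfl : l = [] := List.length_eq_zero_iff.1 (by omega)
    refine ⟨f, hs, by omega, Computes.loop_exit_le (Computes.cond_false (computes_isCons_nil_tp rfl)
      computes_ret le_rfl) (by simp), fun rs h => ?_⟩
    have := length_le_length_encodeAll rs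
    rw [← h] at this
    obtain rfl : rs = [] := List.length_eq_zero_iff.1 (by simpa using this)
    rfl
  | succ N ih =>
    intro l hl f hs hK
    rcases l with _ | ⟨c, t⟩
    · exact (ih [] (Nat.zero_le _) f hs hK)
    have h1 := splitIndex_length_lt (l := c :: t) (by simp)
    have h2 := splitIndex_length (c :: t)
    have h3 := (length_encodeAll_microStep O.base (f, hs) (headMicro (c :: t))).2.1
    have h4 : (headMicro (c :: t)).1 = (splitIndex (c :: t)).1 := rfl
    have h5 : ((splitIndex (c :: t)).2.drop 4).length ≤ (splitIndex (c :: t)).2.length := by simp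
    rw [h4] at h3
    obtain ⟨f', hs', h6, h7, h8⟩ := ih ((splitIndex (c :: t)).2.drop 4) (by omega)
      (microStep O.base (f, hs) (headMicro (c :: t))).1
      (microStep O.base (f, hs) (headMicro (c :: t))).2 (by simp only at h3; omega)
    refine ⟨f', hs', h6, Computes.loop_step_le (Computes.cond_true (computes_isCons_cons_tp rfl)
      (Computes.seq_le (computes_runInstr hs (c :: t)) computes_ret le_rfl) le_rfl) h7 ?_, ?_⟩
    · have h9 : ((splitIndex (c :: t)).2.drop 4).length * (200 * K + 600) ≤
          t.length * (200 * K + 600) := Nat.mul_le_mul_right _ (by simp at h1 h5 ⊢; omega)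
      have h10 : (c :: t).length * (200 * K + 600) =
          t.length * (200 * K + 600) + (200 * K + 600) := by
        rw [List.length_cons, Nat.succ_mul]
      omega
    · intro rs hrs
      cases rs with
      | nil => exact absurd hrs (by simp [encodeAll])
      | cons r rs =>
        rw [encodeAll_cons] at hrs
        obtain ⟨h9, h10⟩ := headMicro_encode r (encodeAll rs)
        rw [← hrs] at h9 h10
        rw [h8 rs h10, h9]
        rfl

/-- The universal machine: run the program on tape `0` and recompute tape `2` of its result on
tape `1`. -/
def universal : Machine :=
  seq (push 7 false) (seq runLoop (seq (push 4 true) (seq (push 4 true) (seq replay (ret true)))))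

theorem avoids_universal {f : Feature} (hf : f ≠ .query) : universal.Avoids f := by
  have hbranch : ∀ {i : ℕ} {B : Bool → Machine}, (∀ b, (B b).Avoids f) → (branch i B).Avoids f :=
    fun h => avoids_pop.cond (h _) (h _)
  have hread : ∀ {i : ℕ} {B : Op → Machine}, (∀ o, (B o).Avoids f) → (readOp i B).Avoids f :=
    fun h => hbranch fun _ => hbranch fun _ => hbranch fun _ => hbranch fun _ => h _
  have hwork : ∀ o, (onWork o).Avoids f := by
    intro o; cases o <;> first | exact avoids_act | exact avoids_ret
  have hrestore : restoreIndex.Avoids f := avoids_moveTo.seq avoids_clear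
  have hmatch : matchIndex.Avoids f :=
    (avoids_pop.cond (avoids_push.seq ((avoids_isCons.cond (avoids_pop.seq avoids_push)
      avoids_push).seq avoids_ret)) (avoids_push.seq avoids_ret)).loop
  have hentry : replayEntry.Avoids f :=
    hmatch.seq ((avoids_isCons.cond avoids_ret (avoids_isCons.cond avoids_ret avoids_ret)).cond
      (hrestore.seq (hread fun o => avoids_pushAll.seq (hwork o)))
      (hrestore.seq (hread fun o => avoids_pushAll)))
  have hreplay : replay.Avoids f :=
    avoids_moveTo.seq (avoids_isCons.cond (hentry.seq avoids_ret) avoids_ret).loop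
  have hset : ∀ {b}, (setFlag b).Avoids f := avoids_act
  have hrecord : ∀ o, (record o).Avoids f := fun o =>
    Avoids.cond avoids_act (avoids_moveTo.seq (avoids_push.seq avoids_pushAll)) avoids_ret
  have hexec : ∀ o, (exec o).Avoids f := by
    intro o
    cases o with
    | test s => exact avoids_act.cond avoids_ret hset
    | answer a =>
      cases a
      · exact (avoids_askBase hf).cond hset avoids_ret
      · exact (avoids_askBase hf).cond avoids_ret hset
    | set => exact hset
    | write s => exact hrecord _
    | move d => exact hrecord _
  have hclear : clearWork.Avoids f :=
    ((avoids_push.seq avoids_act).forPop (avoids_push.seq avoids_act)).seq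
      ((avoids_push.seq (avoids_act.seq avoids_act)).forPop
        (avoids_push.seq (avoids_act.seq avoids_act)))
  have hindex : readIndex.Avoids f :=
    (avoids_pop.cond (avoids_push.seq avoids_ret) avoids_ret).loop
  have hinstr : runInstr.Avoids f :=
    hindex.seq (hreplay.seq ((hread hexec).seq (avoids_clear.seq hclear)))
  exact avoids_push.seq ((avoids_isCons.cond (hinstr.seq avoids_ret) avoids_ret).loop.seq
    (avoids_push.seq (avoids_push.seq (hreplay.seq avoids_ret))))

/-- The two marks pushed on tape `4` select simulated tape `2`, which represents the output tape `1`
of the simulated machine. The factor 6 is that of the potential in `exists_computes_runLoop`. -/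
theorem exists_computes_universal (l : List Bool) : ∃ T : Store,
    universal.Computes O (initial l).tapes (l.length * (200 * (6 * l.length) + 600) +
      123 * (6 * l.length) + 100) true T ∧
    ∀ rs, l = encodeAll rs →
      T 1 = replayOn 2 (stk []) (rs.foldl (microStep O.base) (false, [])).2 := by
  obtain ⟨f, hs, h1, h2, h3⟩ := exists_computes_runLoop (O := O) (K := 6 * l.length) l.length l
    le_rfl false [] (by simp [encodeAll])
  rw [initial_eq_tp l 7]
  refine ⟨_, Computes.seq_le (computes_push_tp rfl) (Computes.seq_le h2 (Computes.seq_le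
    (computes_push_tp rfl) (Computes.seq_le (computes_push_tp rfl) (Computes.seq_le
    (computes_replay 2 hs) computes_ret le_rfl) le_rfl) le_rfl) le_rfl) (by omega), fun rs hrs => ?_⟩
  rw [← h3 rs hrs]
  rfl

end Machine

/-! ## Micro-code of a machine -/

/-- The semantics of micro-instructions on tapes. -/
noncomputable def tapeStep (A : Language Bool) (s : Bool × Store) (r : Micro) : Bool × Store :=
  match r.2 with
  | .test a => (s.1 && ((s.2 r.1).head == a), s.2)
  | .answer a => (s.1 && (chi A (tapeString (s.2 r.1)) == a), s.2)
  | .set => (true, s.2)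
  | o => (s.1, if s.1 then Function.update s.2 r.1 (o.onTape (s.2 r.1)) else s.2)

/-- The tapes after a history. -/
def replayStore (hs : List Micro) : Store := fun i => replayOn i (stk []) hs

theorem replayStore_append (hs : List Micro) (r : Micro) :
    replayStore (hs ++ [r]) =
      Function.update (replayStore hs) r.1 (r.2.onTape (replayStore hs r.1)) := by
  funext i
  simp only [replayStore, replayOn, List.foldl_append, List.foldl_cons, List.foldl_nil]
  by_cases h : r.1 = i
  · subst h; simp
  · rw [if_neg h, Function.update_of_ne (Ne.symm h)]; rfl

theorem microStep_replayStore (A : Language Bool) (s : Bool × List Micro) (r : Micro) :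
    ((microStep A s r).1, replayStore (microStep A s r).2) =
      tapeStep A (s.1, replayStore s.2) r := by
  obtain ⟨f, hs⟩ := s
  obtain ⟨i, o⟩ := r
  cases o with
  | write a => cases f <;> simp [microStep, tapeStep, replayStore_append]
  | move a => cases f <;> simp [microStep, tapeStep, replayStore_append]
  | _ => rfl

/-- The log kept by the universal machine and the tapes it stands for evolve in the same way, so
simulation can be argued on tapes. -/
theorem foldl_microStep_replayStore (A : Language Bool) (rs : List Micro) :
    ∀ s : Bool × List Micro, ((rs.foldl (microStep A) s).1, replayStore (rs.foldl (microStep A) s).2) =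
      rs.foldl (tapeStep A) (s.1, replayStore s.2) := by
  induction rs with
  | nil => intro s; rfl
  | cons r rs ih =>
    intro s
    rw [List.foldl_cons, List.foldl_cons, ih, microStep_replayStore]

/-- A transition from state `q` to state `q'`. Tape `i` of the machine is represented by tape `2 * i`;
tape `2 * q + 1` marks whether `q` is the current state. -/
def edgeCode (q i : ℕ) (guard : Op) (acts : List Op) (q' : ℕ) : List Micro :=
  [(2 * q + 1, .set), (2 * q + 1, .test (some true)), (2 * i, guard)] ++
    acts.map (fun o => (2 * i, o)) ++
    [(2 * q + 1, .write none), (2 * q' + 1, .write (some true))]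

def Action.ops (a : Action) : List Op := .write a.write :: (a.move.map Op.move).toList

/-- Halting states get no code, so that a halted configuration stays fixed in later passes.
Branchings and parallel queries do not occur in the machines simulated. -/
def instrCode (q : ℕ) : Instr → List Micro
  | .scan i δ => edgeCode q i (.test none) (δ none).ops (δ none).next ++
      (edgeCode q i (.test (some false)) (δ (some false)).ops (δ (some false)).next ++
        edgeCode q i (.test (some true)) (δ (some true)).ops (δ (some true)).next)
  | .query i q' => edgeCode q i (.answer false) [] (q' false) ++
      edgeCode q i (.answer true) [] (q' true)
  | _ => []

/-- Micro-code that performs at least one step of a machine unless it has halted. -/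
def tableCode (M : Machine) : List Micro :=
  (List.range M.length).flatMap fun q => instrCode q (M.instr q)

/-- The tapes represent a configuration. -/
def Represents (T : Store) (c : Cfg) : Prop :=
  (∀ i, T (2 * i) = c.tapes i) ∧ ∀ q, T (2 * q + 1) = if q = c.state then stk [true] else stk []

theorem stk_write_nil (b : Bool) : (stk []).write (some b) = stk [b] := by
  unfold stk Tape.mk₁ Tape.mk₂
  rw [Tape.write_mk', ListBlank.tail_mk, ListBlank.cons_mk]
  rfl

theorem stk_singleton_write_none (b : Bool) : (stk [b]).write none = stk [] := by
  unfold stk Tape.mk₁ Tape.mk₂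
  rw [Tape.write_mk', ListBlank.tail_mk]
  simp only [List.map_cons, List.tail_cons, List.map_nil]
  rw [listBlank_cons_none]

/-- A failed guard disables the rest of its edge: nothing but `set` can raise the flag again. -/
theorem foldl_tapeStep_of_false (A : Language Bool) {rs : List Micro}
    (h : ∀ r ∈ rs, r.2 ≠ .set) (T : Store) : rs.foldl (tapeStep A) (false, T) = (false, T) := by
  induction rs with
  | nil => rfl
  | cons r rs ih =>
    rw [List.foldl_cons]
    have hr := h r (by simp)
    have : tapeStep A (false, T) r = (false, T) := by
      obtain ⟨i, o⟩ := r
      cases o with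
      | set => exact absurd rfl hr
      | _ => simp [tapeStep]
    rw [this]
    exact ih fun r hr => h r (by simp [hr])

theorem Action.foldl_ops (A : Language Bool) (a : Action) (i : ℕ) (T : Store) :
    (a.ops.map (fun o => (i, o))).foldl (tapeStep A) (true, T) =
      (true, Function.update T i (a.onTape (T i))) := by
  obtain ⟨w, _ | d, n⟩ := a <;> simp [ops, tapeStep, Op.onTape, onTape]

theorem Action.ne_set_of_mem_ops {a : Action} {o : Op} (h : o ∈ a.ops) : o ≠ .set := by
  obtain ⟨w, _ | d, n⟩ := a <;> simp [ops] at h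
  · rw [h]; simp
  · rcases h with h | h <;> rw [h] <;> simp

/-- The value of a guard in the current configuration. -/
noncomputable def guardHolds (A : Language Bool) (T : Tape (Option Bool)) : Op → Bool
  | .test s => T.head == s
  | .answer a => chi A (tapeString T) == a
  | _ => true

/-- The flag survives the first three instructions exactly if the marker of `q` is present and the
guard holds. Then the edge is executed, with `V` as the new tape `i`; otherwise it is inert. -/
theorem foldl_edgeCode (A : Language Bool) {T : Store} {c : Cfg} (hT : Represents T c) (f : Bool)
    (q i : ℕ) {guard : Op} {acts : List Op} (q' : ℕ) (V : Tape (Option Bool))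
    (hg : (∃ s, guard = .test s) ∨ ∃ a, guard = .answer a) (ho : ∀ o ∈ acts, o ≠ .set)
    (hacts : ∀ T : Store, T (2 * i) = c.tapes i →
      (acts.map (fun o => (2 * i, o))).foldl (tapeStep A) (true, T) =
        (true, Function.update T (2 * i) V)) :
    Represents ((edgeCode q i guard acts q').foldl (tapeStep A) (f, T)).2
      (if c.state = q ∧ guardHolds A (c.tapes i) guard = true then
        ⟨q', Function.update c.tapes i V⟩ else c) := by
  have h1 : ([(2 * q + 1, .set), (2 * q + 1, .test (some true)), (2 * i, guard)] : List Micro).foldl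
      (tapeStep A) (f, T) = (decide (c.state = q) && guardHolds A (c.tapes i) guard, T) := by
    have hq : ((T (2 * q + 1)).head == some true) = decide (c.state = q) := by
      rw [hT.2]
      by_cases h : q = c.state
      · subst h; simp [stk_head]
      · rw [if_neg h, stk_head]; simp [Ne.symm h]
    rcases hg with ⟨s, rfl⟩ | ⟨a, rfl⟩ <;>
      simp [tapeStep, hq, hT.1, guardHolds]
  unfold edgeCode
  rw [List.append_assoc, List.foldl_append, h1]
  by_cases hc : c.state = q ∧ guardHolds A (c.tapes i) guard = true
  · rw [if_pos hc, hc.2, hc.1]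
    simp only [decide_true, Bool.and_true]
    rw [List.foldl_append, hacts T (hT.1 i)]
    have e1 : (Function.update T (2 * i) V) (2 * q + 1) = stk [true] := by
      rw [Function.update_of_ne (by omega), hT.2, if_pos hc.1.symm]
    simp only [List.foldl_cons, List.foldl_nil, tapeStep, if_true, Op.onTape, e1,
      stk_singleton_write_none]
    constructor
    · intro j
      rw [Function.update_of_ne (by omega), Function.update_of_ne (by omega)]
      by_cases hj : j = i
      · subst hj; simp
      · rw [Function.update_of_ne (by omega), hT.1]; exact (Function.update_of_ne hj _ _).symm
    · intro p
      -- Once the marker of `q` is erased no marker is left, so writing that of `q'` is right even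
      -- if `q' = q`.
      have e2 : ∀ p, Function.update (Function.update T (2 * i) V) (2 * q + 1) (stk []) (2 * p + 1) =
          stk [] := by
        intro p
        by_cases hp : p = q
        · subst hp; rw [Function.update_self]
        · rw [Function.update_of_ne (by omega), Function.update_of_ne (by omega), hT.2,
            if_neg (by rw [hc.1]; exact hp)]
      by_cases hp : p = q'
      · subst hp; rw [e2]; simp [stk_write_nil]
      · rw [Function.update_of_ne (by omega), e2]; simp [hp]
  · rw [if_neg hc]
    have : (decide (c.state = q) && guardHolds A (c.tapes i) guard) = false := by
      by_contra h
      simp only [Bool.not_eq_false, Bool.and_eq_true, decide_eq_true_eq] at h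
      exact hc h
    rw [this, foldl_tapeStep_of_false]
    · exact hT
    · intro r hr
      simp only [List.mem_append, List.mem_map, List.mem_cons, List.not_mem_nil, or_false] at hr
      rcases hr with ⟨o, h, rfl⟩ | rfl | rfl
      · exact ho o h
      · simp
      · simp

/-! ### Micro-code simulates the steps of a deterministic machine. -/

namespace Machine

variable {M : Machine} {A : Language Bool} {P Q : Cfg → Prop}

/-- The micro-code `rs` performs some steps of `M`, and at least one if `P` holds. -/
def Simulates (M : Machine) (A : Language Bool) (rs : List Micro) (P : Cfg → Prop) : Prop :=
  ∀ (f : Bool) (T : Store) (c : Cfg), Represents T c → ∃ m c', M.Reaches (baseOnly A) m c c' ∧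
    Represents (rs.foldl (tapeStep A) (f, T)).2 c' ∧ (P c → 1 ≤ m)

theorem Simulates.mono {rs : List Micro} (h : M.Simulates A rs P) (hPQ : ∀ c, Q c → P c) :
    M.Simulates A rs Q := by
  intro f T c hT
  obtain ⟨m, c', h1, h2, h3⟩ := h f T c hT
  exact ⟨m, c', h1, h2, fun h => h3 (hPQ c h)⟩

/-- A later edge may fire from a configuration produced by an earlier one, so steps are only counted
from below. If the first part makes no step, the configuration is unchanged and `Q` still applies to
it. -/
theorem Simulates.append {rs rs' : List Micro} (h : M.Simulates A rs P) (h' : M.Simulates A rs' Q) :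
    M.Simulates A (rs ++ rs') fun c => P c ∨ Q c := by
  intro f T c hT
  obtain ⟨m, c', h1, h2, h3⟩ := h f T c hT
  obtain ⟨m', c'', h4, h5, h6⟩ := h' (rs.foldl (tapeStep A) (f, T)).1 _ c' h2
  refine ⟨m + m', c'', h1.trans h4, ?_, ?_⟩
  · rw [List.foldl_append]; exact h5
  · rintro (hc | hc)
    · have := h3 hc; omega
    · by_cases hm : m = 0
      · subst hm
        cases h1
        have := h6 hc; omega
      · omega

theorem simulates_edgeCode_scan {q i : ℕ} {δ : Option Bool → Action} (hq : M.instr q = .scan i δ)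
    (s : Option Bool) : M.Simulates A (edgeCode q i (.test s) (δ s).ops (δ s).next)
      fun c => c.state = q ∧ (c.tapes i).head = s := by
  intro f T c hT
  have := foldl_edgeCode A hT f q i (guard := .test s) (acts := (δ s).ops) (δ s).next
    ((δ s).onTape (c.tapes i)) (.inl ⟨s, rfl⟩) (fun o ho => Action.ne_set_of_mem_ops ho)
    (fun T hT => by rw [Action.foldl_ops, hT])
  by_cases hc : c.state = q ∧ (c.tapes i).head = s
  · rw [if_pos ⟨hc.1, by simp [guardHolds, hc.2]⟩] at this
    refine ⟨1, _, .cons false ?_ (.refl _), this, fun _ => le_rfl⟩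
    simp only [step, hc.1, hq, hc.2]
  · rw [if_neg (by simpa [guardHolds] using hc)] at this
    exact ⟨0, c, .refl _, this, fun h => absurd h hc⟩

theorem simulates_edgeCode_query {q i : ℕ} {q' : Bool → ℕ} (hq : M.instr q = .query i q') (a : Bool) :
    M.Simulates A (edgeCode q i (.answer a) [] (q' a))
      fun c => c.state = q ∧ chi A (tapeString (c.tapes i)) = a := by
  intro f T c hT
  have := foldl_edgeCode A hT f q i (guard := .answer a) (acts := []) (q' a) (c.tapes i)
    (.inr ⟨a, rfl⟩) (by simp) (fun T hT => by rw [← hT, Function.update_eq_self]; rfl)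
  by_cases hc : c.state = q ∧ chi A (tapeString (c.tapes i)) = a
  · rw [if_pos ⟨hc.1, by simp [guardHolds, hc.2]⟩, Function.update_eq_self] at this
    refine ⟨1, _, .cons false ?_ (.refl _), this, fun _ => le_rfl⟩
    simp only [step, hc.1, hq, baseOnly, hc.2]
  · rw [if_neg (by simpa [guardHolds] using hc)] at this
    exact ⟨0, c, .refl _, this, fun h => absurd h hc⟩

theorem simulates_nil (hP : ∀ c, ¬ P c) : M.Simulates A [] P :=
  fun _ _ c hT => ⟨0, c, .refl _, hT, fun h => absurd h (hP c)⟩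

theorem simulates_instrCode (hc : M.Avoids .choose) (ha : M.Avoids .ask) (q : ℕ) :
    M.Simulates A (instrCode q (M.instr q))
      fun c => c.state = q ∧ ∀ b, M.instr c.state ≠ .halt b := by
  have hc := hc.instr q
  have ha := ha.instr q
  cases h : M.instr q with
  | scan i δ =>
    refine ((simulates_edgeCode_scan h none).append ((simulates_edgeCode_scan h (some false)).append
      (simulates_edgeCode_scan h (some true)))).mono fun c hc => ?_
    rcases hh : (c.tapes i).head with _ | _ | _ <;> simp [hc.1]
  | query i q' =>
    refine ((simulates_edgeCode_query h false).append (simulates_edgeCode_query h true)).mono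
      fun c hc => ?_
    cases hh : chi A (tapeString (c.tapes i)) <;> simp [hc.1]
  | choose a b => simp [h, Instr.feature] at hc
  | ask i j q' => simp [h, Instr.feature] at ha
  | halt b =>
    refine simulates_nil fun c hc => ?_
    rw [hc.1] at hc
    exact hc.2 b h

theorem simulates_tableCode (hc : M.Avoids .choose) (ha : M.Avoids .ask) :
    M.Simulates A (tableCode M) fun c => ∀ b, M.instr c.state ≠ .halt b := by
  have key : ∀ n, M.Simulates A ((List.range n).flatMap fun q => instrCode q (M.instr q))
      fun c => c.state < n ∧ ∀ b, M.instr c.state ≠ .halt b := by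
    intro n
    induction n with
    | zero => exact simulates_nil fun c h => by omega
    | succ n ih =>
      rw [List.range_succ, List.flatMap_append]
      refine (ih.append (Q := fun c => c.state = n ∧ ∀ b, M.instr c.state ≠ .halt b) ?_).mono
        fun c hc => ?_
      · simpa using simulates_instrCode hc ha n
      · rcases Nat.lt_succ_iff_lt_or_eq.1 hc.1 with h | h
        · exact .inl ⟨h, hc.2⟩
        · exact .inr ⟨h, hc.2⟩
  refine (key M.length).mono fun c hc => ⟨?_, hc⟩
  -- A state outside the list halts.
  by_contra hlt
  refine hc false ?_
  unfold instr
  rw [List.getElem?_eq_none (not_lt.1 hlt)]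
  rfl

/-- Each pass through the table makes at least one step unless the configuration has halted, and a
halted configuration does not change any more. -/
theorem exists_represents_iterate (hc : M.Avoids .choose) (ha : M.Avoids .ask) (N : ℕ) :
    ∀ (f : Bool) (T : Store) (c : Cfg), Represents T c → ∃ m c', M.Reaches (baseOnly A) m c c' ∧
      Represents ((List.replicate N (tableCode M)).flatten.foldl (tapeStep A) (f, T)).2 c' ∧
      (N ≤ m ∨ ∃ b, M.instr c'.state = .halt b) := by
  induction N with
  | zero => exact fun f T c hT => ⟨0, c, .refl _, hT, .inl le_rfl⟩
  | succ N ih =>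
    intro f T c hT
    obtain ⟨m, c', h1, h2, h3⟩ := simulates_tableCode (A := A) hc ha f T c hT
    obtain ⟨m', c'', h4, h5, h6⟩ := ih ((tableCode M).foldl (tapeStep A) (f, T)).1 _ c' h2
    refine ⟨m + m', c'', h1.trans h4, ?_, ?_⟩
    · rw [List.replicate_succ, List.flatten_cons, List.foldl_append]; exact h5
    · rcases h6 with h6 | h6
      · by_cases hh : ∃ b, M.instr c.state = .halt b
        · obtain ⟨b, hb⟩ := hh
          have e1 : c' = c := by
            cases h1 with
            | refl => rfl
            | cons a ha _ => exact absurd hb (not_halt_of_step ha b)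
          have e2 : c'' = c := by
            subst e1
            cases h4 with
            | refl => rfl
            | cons a ha _ => exact absurd hb (not_halt_of_step ha b)
          exact .inr ⟨b, e2 ▸ hb⟩
        · have := h3 (by simpa using hh)
          exact .inl (by omega)
      · exact .inr h6

end Machine

/-- Micro-code that writes a symbol of the input and moves to the left. -/
def inputCode (b : Bool) : List Micro := [(0, .write (some b)), (0, .move .left)]

/-- Micro-code that sets up the initial configuration. -/
def initCode (x : List Bool) : List Micro :=
  (0, .set) :: (x.reverse.flatMap inputCode ++ [(0, .move .right), (1, .write (some true))])

theorem stk_nil_move_left : (stk []).move .left = stk [] := by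
  have := Tape.move_right_left (stk [])
  have h2 := stk_pop []
  rw [show (stk []).write none = stk [] from Tape.write_self (stk [])] at h2
  rw [h2] at this
  exact this

/-- The input is written from its last symbol to its first, leaving the head one cell to the left of
it; hence the final move to the right. Tape `1 = 2 * 0 + 1` is the marker of the initial state. -/
theorem represents_initCode (A : Language Bool) (x : List Bool) :
    Represents ((initCode x).foldl (tapeStep A) (false, replayStore [])).2 (initial x) := by
  have h1 : ∀ x : List Bool, (x.reverse.flatMap inputCode).foldl (tapeStep A) (true, replayStore []) =
      (true, Function.update (replayStore []) 0 ((stk x).move .left)) := by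
    intro x
    induction x with
    | nil =>
      rw [stk_nil_move_left, show stk [] = replayStore [] 0 from rfl, Function.update_eq_self]
      rfl
    | cons b x ih =>
      rw [List.reverse_cons, List.flatMap_append, List.foldl_append, ih]
      simp [inputCode, tapeStep, Op.onTape, stk_push]
  have h2 : (initCode x).foldl (tapeStep A) (false, replayStore []) =
      (true, Function.update (Function.update (replayStore []) 0 (stk x)) 1 (stk [true])) := by
    rw [initCode, List.foldl_cons, List.foldl_append,
      show tapeStep A (false, replayStore []) (0, .set) = (true, replayStore []) from rfl, h1]
    simp only [List.foldl_cons, List.foldl_nil, tapeStep, if_true, Op.onTape, Function.update_self,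
      Tape.move_left_right, Function.update_idem]
    rw [Function.update_of_ne (by omega), show replayStore [] 1 = stk [] from rfl, stk_write_nil]
  rw [h2]
  constructor <;> simp only
  · intro i
    rw [Function.update_of_ne (by omega), initial_eq]
    rcases eq_or_ne i 0 with rfl | hi
    · simp
    · rw [Function.update_of_ne (by omega)]
      simp only [hi, if_false]
      rfl
  · intro q
    rw [initial_eq]
    rcases eq_or_ne q 0 with rfl | hq
    · simp
    · rw [Function.update_of_ne (by omega), Function.update_of_ne (by omega)]
      simp only [hq, if_false]
      rfl

/-! ## Polynomial bounds -/

theorem eval_mono (p : Polynomial ℕ) {a b : ℕ} (h : a ≤ b) : p.eval a ≤ p.eval b := by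
  rw [Polynomial.eval_eq_sum_range, Polynomial.eval_eq_sum_range]
  exact Finset.sum_le_sum fun i _ => Nat.mul_le_mul_left _ (Nat.pow_le_pow_left h i)

/-- A polynomial is dominated by a power of a translation. -/
theorem exists_eval_le_pow (p : Polynomial ℕ) : ∃ c k : ℕ, ∀ n, p.eval n + 1 ≤ (n + c) ^ k := by
  induction p using Polynomial.induction_on' with
  | monomial d a =>
    refine ⟨a + 2, d + 1, fun n => ?_⟩
    rw [Polynomial.eval_monomial, pow_succ]
    have h1 : n ^ d ≤ (n + (a + 2)) ^ d := Nat.pow_le_pow_left (by omega) d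
    have h2 : 1 ≤ (n + (a + 2)) ^ d := Nat.one_le_pow _ _ (by omega)
    nlinarith
  | add p q hp hq =>
    obtain ⟨c, k, hp⟩ := hp
    obtain ⟨c', k', hq⟩ := hq
    refine ⟨c + c' + 2, k + k' + 1, fun n => ?_⟩
    have hp := hp n
    have hq := hq n
    have h1 : (n + c) ^ k ≤ (n + (c + c' + 2)) ^ (k + k') :=
      (Nat.pow_le_pow_left (by omega) k).trans (Nat.pow_le_pow_right (by omega) (by omega))
    have h2 : (n + c') ^ k' ≤ (n + (c + c' + 2)) ^ (k + k') :=
      (Nat.pow_le_pow_left (by omega) k').trans (Nat.pow_le_pow_right (by omega) (by omega))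
    rw [Polynomial.eval_add, pow_succ]
    nlinarith

namespace Machine

variable {M : Machine} {O : Oracles} {n m k i : ℕ} {a b : Bool}

theorem polyTime_of_ensures (p : Polynomial ℕ)
    (h : ∀ O x, ∃ Φ, M.Ensures O Φ (p.eval x.length) (initial x)) : M.PolyTime :=
  ⟨p, fun O x _ _ hr => (h O x).elim fun _ h => h.length_le hr⟩

theorem polyTime_of_computes (p : Polynomial ℕ)
    (h : ∀ O x, ∃ b T, M.Computes O (initial x).tapes (p.eval x.length) b T) : M.PolyTime :=
  polyTime_of_ensures p fun O x => by
    obtain ⟨b, T, h⟩ := h O x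
    exact ⟨_, h⟩

theorem PolyTime.ensures (h : M.PolyTime) : ∃ p : Polynomial ℕ, ∀ (O : Oracles) (x : List Bool),
    M.Ensures O (fun b T => ∃ m c', m ≤ p.eval x.length ∧ M.Reaches O m (initial x) c' ∧
      M.instr c'.state = .halt b ∧ c'.tapes = T) (p.eval x.length) (initial x) := by
  obtain ⟨p, hp⟩ := h
  refine ⟨p, fun O x => (ensures_of_bounded fun m c' hr => hp O x m c' hr).mono le_rfl ?_⟩
  rintro b T ⟨m, c', h1, h2, h3⟩
  exact ⟨m, c', hp O x m c' h1, h1, h2, h3⟩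

theorem Computes.acceptsWithOutput {x y : List Bool} {T : Store}
    (h : M.Computes O (initial x).tapes n true T) (hy : tapeString (T 1) = y) :
    M.AcceptsWithOutput O x y := by
  obtain ⟨n, c, b, h1, h2, rfl, rfl⟩ := Ensures.allows h
  exact ⟨n, c, h1, h2, hy⟩

theorem Computes.accepts_iff {x : List Bool} {T : Store}
    (h : M.Computes O (initial x).tapes n b T) : M.Accepts O x ↔ b = true := by
  constructor
  · rintro ⟨m, c, h1, h2⟩
    exact (Ensures.post h h1 h2).1.symm
  · rintro rfl
    obtain ⟨n, c, b, h1, h2, rfl, rfl⟩ := Ensures.allows h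
    exact ⟨n, c, h1, h2⟩

/-- A deterministic machine has at most one halting configuration. -/
theorem Avoids.halting_unique (hM : M.Avoids .choose) {c c₁ c₂ : Cfg} {b₁ b₂ : Bool}
    (h₁ : M.Reaches O n c c₁) (h₁' : M.instr c₁.state = .halt b₁)
    (h₂ : M.Reaches O m c c₂) (h₂' : M.instr c₂.state = .halt b₂) : c₁ = c₂ := by
  have hdet : ∀ (b b' : Bool) (c : Cfg), M.step O b c = M.step O b' c := by
    intro b b' c
    have := hM.instr c.state
    unfold step
    cases h : M.instr c.state <;> simp_all [Instr.feature]
  induction h₁ generalizing m with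
  | refl =>
    cases h₂ with
    | refl => rfl
    | cons b hb _ => exact absurd h₁' (not_halt_of_step hb _)
  | cons b hb _ ih =>
    cases h₂ with
    | refl => exact absurd h₂' (not_halt_of_step hb _)
    | cons b' hb' h₂ =>
      rw [hdet b' b, hb] at hb'
      cases hb'
      exact ih h₁' h₂

/-! ## The generator of micro-programs -/

/-- Copy the unary counter on tape `3` to tape `6`. -/
def addCounter : Machine :=
  seq (forPop 3 (seq (push 5 true) (push 6 true)) (seq (push 5 true) (push 6 true))) (moveTo 5 3)

/-- Multiply the unary number on tape `4` by the counter on tape `3`. -/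
def mulCounter : Machine := seq (forPop 4 addCounter addCounter) (moveTo 6 4)

def powCounter : ℕ → Machine
  | 0 => ret true
  | k + 1 => seq mulCounter (powCounter k)

variable {x o t : Tape (Option Bool)}

theorem replicate_append_cons {α : Type*} (n : ℕ) (a : α) (l : List α) :
    List.replicate n a ++ a :: l = a :: (List.replicate n a ++ l) := by
  induction n with
  | zero => rfl
  | succ n ih => rw [List.replicate_succ, List.cons_append, ih]; rfl

theorem computes_addCounter (N : ℕ) (r : List Bool) {s : Tape (Option Bool)} :
    addCounter.Computes O (tp [x, o, t, stk (List.replicate N true), s, stk [], stk r])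
      (40 * N + 20) true
      (tp [x, o, t, stk (List.replicate N true), s, stk [], stk (List.replicate N true ++ r)]) := by
  have h1 : ∀ (n : ℕ) (u v : List Bool),
      (forPop 3 (seq (push 5 true) (push 6 true)) (seq (push 5 true) (push 6 true))).Computes O
      (tp [x, o, t, stk (List.replicate n true), s, stk u, stk v]) (20 * n + 4) true
      (tp [x, o, t, stk [], s, stk (List.replicate n true ++ u),
        stk (List.replicate n true ++ v)]) := by
    intro n
    induction n with
    | zero => exact fun u v => computes_forPop_nil_tp rfl
    | succ n ih =>
      intro u v
      have := ih (true :: u) (true :: v)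
      rw [replicate_append_cons, replicate_append_cons] at this
      exact Computes.mono (computes_forPop_cons_tp (n := 10) (b := true) rfl
        (Computes.seq_le (computes_push_tp rfl) (computes_push_tp rfl) le_rfl) this) (by omega)
  have h2 := h1 N [] r
  rw [List.append_nil] at h2
  refine Computes.to (h2.seq_le (computes_moveTo_tp (by omega) rfl rfl) ?_) ?_
  · simp; omega
  · simp

theorem computes_mulCounter (N m : ℕ) :
    mulCounter.Computes O (tp [x, o, t, stk (List.replicate N true), stk (List.replicate m true),
        stk [], stk []]) (60 * (m * N) + 40 * m + 20) true
      (tp [x, o, t, stk (List.replicate N true), stk (List.replicate (m * N) true),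
        stk [], stk []]) := by
  have h1 : ∀ (m : ℕ) (r : List Bool),
      (forPop 4 addCounter addCounter).Computes O
      (tp [x, o, t, stk (List.replicate N true), stk (List.replicate m true), stk [], stk r])
      (40 * (m * N) + 29 * m + 4) true
      (tp [x, o, t, stk (List.replicate N true), stk [], stk [],
        stk (List.replicate (m * N) true ++ r)]) := by
    intro m
    induction m with
    | zero =>
      intro r
      simp only [Nat.zero_mul, List.replicate_zero, List.nil_append]
      exact computes_forPop_nil_tp rfl
    | succ m ih =>
      intro r
      have := ih (List.replicate N true ++ r)
      rw [← List.append_assoc, List.replicate_append_replicate, ← Nat.succ_mul] at this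
      refine Computes.mono (computes_forPop_cons_tp (n := 40 * N + 20) (b := true) rfl
        (computes_addCounter N r) this) ?_
      rw [Nat.succ_mul m]; omega
  have h2 := h1 m []
  rw [List.append_nil] at h2
  refine Computes.to (h2.seq_le (computes_moveTo_tp (by omega) rfl rfl) ?_) ?_
  · simp; omega
  · simp

/-- Generalized over the polynomial `p` whose value is on tape `4`, so that one multiplication turns
`p` into `p * X` and the time stays a polynomial in `N` for fixed `k`. -/
theorem computes_powCounter (k : ℕ) : ∀ p : Polynomial ℕ, ∃ q : Polynomial ℕ,
    ∀ (O : Oracles) (x o t : Tape (Option Bool)) (N : ℕ),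
    (powCounter k).Computes O (tp [x, o, t, stk (List.replicate N true),
        stk (List.replicate (p.eval N) true), stk [], stk []]) (q.eval N) true
      (tp [x, o, t, stk (List.replicate N true), stk (List.replicate (p.eval N * N ^ k) true),
        stk [], stk []]) := by
  induction k with
  | zero => exact fun p => ⟨0, fun O x o t N => by
    simpa [powCounter] using (computes_ret (b := true)).mono (Nat.zero_le _)⟩
  | succ k ih =>
    intro p
    obtain ⟨q, hq⟩ := ih (p * Polynomial.X)
    refine ⟨60 * (p * Polynomial.X) + 40 * p + 20 + q + 2, fun O x o t N => ?_⟩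
    have := hq O x o t N
    rw [Polynomial.eval_mul, Polynomial.eval_X] at this
    refine Computes.to ((computes_mulCounter N (p.eval N)).seq_le this ?_) ?_
    · simp
    · rw [pow_succ, mul_assoc, mul_comm N]

/-- Push the string `l` (reversed) onto tape `1` as many times as tape `4` says. -/
def emitLoop (l : List Bool) : Machine := forPop 4 (pushAll 1 l.reverse) (pushAll 1 l.reverse)

theorem computes_emitLoop (l : List Bool) (m : ℕ) {ts : List (Tape (Option Bool))}
    {z : Tape (Option Bool)} : ∀ (r : List Bool),
    (emitLoop l).Computes O (tp (x :: stk r :: t :: z :: stk (List.replicate m true) :: ts))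
      (m * (6 * l.length + 9) + 4) true
      (tp (x :: stk ((List.replicate m l).flatten ++ r) :: t :: z :: stk [] :: ts)) := by
  induction m with
  | zero =>
    intro r
    simp only [Nat.zero_mul, List.replicate_zero, List.flatten_nil, List.nil_append]
    exact computes_forPop_nil_tp rfl
  | succ m ih =>
    intro r
    have := ih (l ++ r)
    rw [← List.append_assoc] at this
    refine Computes.to (Computes.mono (computes_forPop_cons_tp (n := 6 * l.length) (b := true)
      (T₁ := tp (x :: stk (l ++ r) :: t :: z :: stk (List.replicate m true) :: ts)) rfl ?_ this) ?_) ?_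
    · refine Computes.to (Computes.mono (computes_pushAll_tp rfl) (by simp)) ?_
      rw [List.reverse_reverse]
      rfl
    · rw [Nat.succ_mul m]; omega
    · have : (List.replicate m l).flatten ++ l = (List.replicate (m + 1) l).flatten := by
        rw [List.replicate_succ', List.flatten_append]; simp
      rw [this]

/-- Push the code for writing the input on tape `0` onto tape `1`. -/
def emitInput : Machine :=
  forPop 0 (pushAll 1 (encodeAll (inputCode false)).reverse)
    (pushAll 1 (encodeAll (inputCode true)).reverse)

/-- Programs are pushed on a stack and thus produced back to front: popping the input from its first
symbol yields the code of the reversed input. A symbol costs 9 for the loop and 60 for pushing ten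
bits. -/
theorem computes_emitInput (x : List Bool) {ts : List (Tape (Option Bool))} : ∀ (r : List Bool),
    emitInput.Computes O (tp (stk x :: stk r :: ts)) (x.length * 69 + 4) true
      (tp (stk [] :: stk (encodeAll (x.reverse.flatMap inputCode) ++ r) :: ts)) := by
  induction x with
  | nil => exact fun r => computes_forPop_nil_tp rfl
  | cons b x ih =>
    intro r
    have := ih (encodeAll (inputCode b) ++ r)
    rw [← List.append_assoc, ← encodeAll_append] at this
    refine Computes.to (Computes.mono (computes_forPop_cons_tp (n := 60) (b := true)
      (T₁ := tp (stk x :: stk (encodeAll (inputCode b) ++ r) :: ts)) rfl ?_ this) ?_) ?_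
    · have h : (pushAll 1 (encodeAll (inputCode b)).reverse).Computes O
          (tp (stk x :: stk r :: ts)) 60 true
          (tp (stk x :: stk (encodeAll (inputCode b) ++ r) :: ts)) := by
        refine Computes.to (Computes.mono (computes_pushAll_tp rfl) ?_) ?_
        · simp [encodeAll, inputCode]
        · rw [List.reverse_reverse]
          rfl
      cases b <;> exact h
    · simp; omega
    · simp [List.flatMap_append]

/-- Replace the input on tape `0` by the same string and a unary counter for its length. -/
def countInput : Machine :=
  seq (forPop 0 (seq (push 2 false) (push 3 true)) (seq (push 2 true) (push 3 true))) (moveTo 2 0)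

theorem computes_countInput (x : List Bool) {ts : List (Tape (Option Bool))} :
    countInput.Computes O (tp (stk x :: o :: stk [] :: stk [] :: ts)) (40 * x.length + 20) true
      (tp (stk x :: o :: stk [] :: stk (List.replicate x.length true) :: ts)) := by
  have h1 : ∀ (x u : List Bool) (v : List Bool),
      (forPop 0 (seq (push 2 false) (push 3 true)) (seq (push 2 true) (push 3 true))).Computes O
      (tp (stk x :: o :: stk u :: stk v :: ts)) (20 * x.length + 4) true
      (tp (stk [] :: o :: stk (x.reverse ++ u) :: stk (List.replicate x.length true ++ v) :: ts)) := by
    intro x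
    induction x with
    | nil => exact fun u v => computes_forPop_nil_tp rfl
    | cons b x ih =>
      intro u v
      have := ih (b :: u) (true :: v)
      rw [replicate_append_cons] at this
      refine Computes.to (Computes.mono (computes_forPop_cons_tp (n := 10) (b := true)
        (T₁ := tp (stk x :: o :: stk (b :: u) :: stk (true :: v) :: ts)) rfl ?_ this) ?_) ?_
      · cases b <;> exact Computes.seq_le (computes_push_tp rfl) (computes_push_tp rfl) le_rfl
      · simp; omega
      · simp [List.replicate_succ]
  have h2 := h1 x [] []
  rw [List.append_nil, List.append_nil] at h2
  refine Computes.to (h2.seq_le (computes_moveTo_tp (by omega) rfl rfl) ?_) ?_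
  · simp; omega
  · simp

/-- The machine that writes the micro-program of a machine on a given input: the tape `0` is set up,
then the table `l` is run `(n + c) ^ k` times, where `n` is the length of the input. -/
def generator (c k : ℕ) (l : List Bool) : Machine :=
  seq countInput (seq (pushAll 3 (List.replicate c true)) (seq (push 4 true) (seq (powCounter k)
    (seq (emitLoop l) (seq (pushAll 1 (encodeAll [(0, .move .right), (1, .write (some true))]).reverse)
      (seq emitInput (seq (pushAll 1 (encodeAll [(0, .set)]).reverse) (ret true))))))))

theorem avoids_generator {f : Feature} (c k : ℕ) (l : List Bool) : (generator c k l).Avoids f := by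
  have hadd : addCounter.Avoids f :=
    ((avoids_push.seq avoids_push).forPop (avoids_push.seq avoids_push)).seq avoids_moveTo
  have hpow : ∀ k, (powCounter k).Avoids f := by
    intro k
    induction k with
    | zero => exact avoids_ret
    | succ k ih => exact ((hadd.forPop hadd).seq avoids_moveTo).seq ih
  exact Avoids.seq (((avoids_push.seq avoids_push).forPop (avoids_push.seq avoids_push)).seq
    avoids_moveTo) (avoids_pushAll.seq (avoids_push.seq ((hpow k).seq
    ((avoids_pushAll.forPop avoids_pushAll).seq (avoids_pushAll.seq
    ((avoids_pushAll.forPop avoids_pushAll).seq (avoids_pushAll.seq avoids_ret)))))))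

/-- `c`, `k` and the table are fixed, so unrolling the table `(x.length + c) ^ k` times takes
polynomial time, without any oracle. -/
theorem exists_computes_generator (c k : ℕ) (rs : List Micro) : ∃ q : Polynomial ℕ,
    ∀ (O : Oracles) (x : List Bool), ∃ T : Store,
      (generator c k (encodeAll rs)).Computes O (initial x).tapes (q.eval x.length) true T ∧
      T 1 = stk (encodeAll (initCode x ++ (List.replicate ((x.length + c) ^ k) rs).flatten)) := by
  obtain ⟨q, hq⟩ := computes_powCounter k 1
  have hrep : ∀ N, (List.replicate N (encodeAll rs)).flatten =
      encodeAll (List.replicate N rs).flatten := by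
    intro N
    induction N with
    | zero => rfl
    | succ N ih =>
      rw [List.replicate_succ, List.replicate_succ, List.flatten_cons, List.flatten_cons,
        encodeAll_append, ih]
  refine ⟨40 * Polynomial.X + q.comp (Polynomial.X + Polynomial.C c) +
    (Polynomial.X + Polynomial.C c) ^ k * Polynomial.C (6 * (encodeAll rs).length + 9) +
    69 * Polynomial.X + Polynomial.C (6 * c) + 500, fun O x => ?_⟩
  have h3 := hq O (stk x) (stk []) (stk []) (x.length + c)
  simp only [Polynomial.eval_one, one_mul] at h3
  rw [initial_eq_tp x 6]
  have h2 : (pushAll 3 (List.replicate c true)).Computes O (tp [stk x, stk [], stk [],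
      stk (List.replicate x.length true), stk [], stk [], stk []]) (6 * c) true
      (tp [stk x, stk [], stk [], stk (List.replicate (x.length + c) true), stk [], stk [],
        stk []]) := by
    refine Computes.to (Computes.mono (computes_pushAll_tp rfl) (by simp)) ?_
    rw [List.reverse_replicate, List.replicate_append_replicate, add_comm c]
    rfl
  refine ⟨_, Computes.seq_le (computes_countInput x) (Computes.seq_le h2 (Computes.seq_le
    (computes_push_tp rfl) (Computes.seq_le h3 (Computes.seq_le (computes_emitLoop _ _ [])
    (Computes.seq_le (computes_pushAll_tp rfl) (Computes.seq_le (computes_emitInput x _)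
    (Computes.seq_le (computes_pushAll_tp rfl) computes_ret le_rfl) le_rfl) le_rfl) le_rfl) le_rfl)
    le_rfl) le_rfl) ?_, ?_⟩
  · have e1 : (encodeAll [(0, .move .right), (1, .write (some true))]).length = 11 := rfl
    have e2 : (encodeAll [(0, .set)]).length = 5 := rfl
    simp only [List.length_reverse, e1, e2, Polynomial.eval_add, Polynomial.eval_mul,
      Polynomial.eval_pow, Polynomial.eval_comp, Polynomial.eval_X, Polynomial.eval_C,
      Polynomial.eval_ofNat]
    omega
  · rw [List.reverse_reverse, List.reverse_reverse, hrep, List.append_nil]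
    refine congrArg stk ?_
    simp only [initCode, List.cons_append, List.append_assoc, encodeAll_append, encodeAll_cons]
    rfl

end Machine

/-! ## A universal function -/

/-- The time bound must hold for every choice of oracles, whereas the output matters only for `A`.
-/
theorem fpRel_of_computes {A : Language Bool} {M : Machine} {f : List Bool → List Bool}
    (hc : M.Avoids .choose) (ha : M.Avoids .ask) (p : Polynomial ℕ)
    (h : ∀ O x, ∃ T, M.Computes O (initial x).tapes (p.eval x.length) true T ∧
      (O = baseOnly A → tapeString (T 1) = f x)) : f ∈ FPRel A := by
  refine ⟨M, Machine.deterministic_iff.2 hc, Machine.noParallelQueries_iff.2 ha,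
    Machine.polyTime_of_computes p fun O x => ?_, fun x => ?_⟩
  · obtain ⟨T, h, -⟩ := h O x
    exact ⟨_, _, h⟩
  · obtain ⟨T, h, h'⟩ := h (baseOnly A) x
    exact h.acceptsWithOutput (h' rfl)

theorem fp_of_computes {M : Machine} {f : List Bool → List Bool}
    (hc : M.Avoids .choose) (hq : M.Avoids .query) (ha : M.Avoids .ask) (p : Polynomial ℕ)
    (h : ∀ O x, ∃ T, M.Computes O (initial x).tapes (p.eval x.length) true T ∧
      tapeString (T 1) = f x) : f ∈ FP := by
  refine ⟨M, Machine.deterministic_iff.2 hc, Machine.noBaseQueries_iff.2 hq,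
    Machine.noParallelQueries_iff.2 ha,
    Machine.polyTime_of_computes p fun O x => ?_, fun x => ?_⟩
  · obtain ⟨T, h, -⟩ := h O x
    exact ⟨_, _, h⟩
  · obtain ⟨T, h, h'⟩ := h (baseOnly ⊥) x
    exact h.acceptsWithOutput h'

/-- There is a function in `FPRel A` to which all others reduce by functions in `FP`. -/
theorem exists_universal (A : Language Bool) :
    ∃ u ∈ FPRel A, ∀ f ∈ FPRel A, ∃ g ∈ FP, ∀ x, u (g x) = f x := by
  choose T hT hT' using fun (O : Oracles) (l : List Bool) =>
    Machine.exists_computes_universal (O := O) l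
  refine ⟨fun l => tapeString (T (baseOnly A) l 1), ?_, fun f hf => ?_⟩
  · refine fpRel_of_computes (M := Machine.universal) (Machine.avoids_universal (by simp))
      (Machine.avoids_universal (by simp))
      (Polynomial.X * (200 * (6 * Polynomial.X) + 600) + 123 * (6 * Polynomial.X) + 100)
      fun O x => ⟨T O x, (hT O x).mono (by simp), ?_⟩
    rintro rfl
    rfl
  · obtain ⟨M, hc, ha, hp, hM⟩ := hf
    rw [Machine.deterministic_iff] at hc
    rw [Machine.noParallelQueries_iff] at ha
    obtain ⟨p, hp⟩ := hp
    obtain ⟨c, k, hck⟩ := exists_eval_le_pow p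
    obtain ⟨q, hq⟩ := Machine.exists_computes_generator c k (tableCode M)
    set g : List Bool → List Micro := fun x =>
      initCode x ++ (List.replicate ((x.length + c) ^ k) (tableCode M)).flatten with hg
    refine ⟨fun x => encodeAll (g x), fp_of_computes
      (Machine.avoids_generator c k (encodeAll (tableCode M))) (Machine.avoids_generator c k _)
      (Machine.avoids_generator c k _) q fun O x => ?_, fun x => ?_⟩
    · obtain ⟨T, h1, h2⟩ := hq O x
      exact ⟨T, h1, by rw [h2, tapeString_stk]⟩
    · obtain ⟨m, c', h1, h2, h3⟩ := Machine.exists_represents_iterate (A := A) hc ha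
        ((x.length + c) ^ k) ((initCode x).foldl (tapeStep A) (false, replayStore [])).1 _ _
        (represents_initCode A x)
      -- The number of passes exceeds the clock of `M`, since `exists_eval_le_pow` leaves room for
      -- one more step; so `M` has halted.
      have h4 : ∃ b, M.instr c'.state = .halt b := by
        rcases h3 with h3 | h3
        · have := hp _ _ _ _ h1
          have := hck x.length
          omega
        · exact h3
      obtain ⟨b, h4⟩ := h4
      obtain ⟨n, c'', h5, h6, h7⟩ := hM x
      have h8 := hc.halting_unique h1 h4 h5 h6
      have h9 := hT' (baseOnly A) (encodeAll (g x)) (g x) rfl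
      have h10 := foldl_microStep_replayStore A (g x) (false, [])
      -- Simulated tape `2 = 2 * 1` stands for the output tape.
      have h11 : replayStore ((g x).foldl (microStep A) (false, [])).2 2 = c'.tapes 1 := by
        have := congrArg (fun s => s.2 2) h10
        simp only at this
        rw [this, hg, List.foldl_append]
        exact h2.1 1
      rw [← h7, ← h8, ← h11]
      exact congrArg tapeString h9

open Machine

/-! ## Closure properties of `NP` -/

/-- A property of strings that is decided by a nondeterministic polynomial-time machine. -/
def InNP (A : Language Bool) (p : List Bool → Prop) : Prop :=
  ∃ M : Machine, M.Avoids .ask ∧ M.PolyTime ∧ ∀ x, p x ↔ M.Accepts (baseOnly A) x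

/-- A property of strings that is in `NP` together with its negation. -/
def InNPCoNP (A : Language Bool) (p : List Bool → Prop) : Prop := InNP A p ∧ InNP A fun x => ¬ p x

variable {A : Language Bool} {p q : List Bool → Prop}

theorem mem_NP_iff {L : Language Bool} : L ∈ NP A ↔ InNP A (· ∈ L) := by
  simp only [NP, InNP, Set.mem_ofPred_eq, noParallelQueries_iff]

theorem mem_NP_inter_coNP_iff {L : Language Bool} :
    L ∈ NP A ∩ coNP A ↔ InNPCoNP A (· ∈ L) :=
  and_congr mem_NP_iff mem_NP_iff

theorem InNP.congr (h : InNP A p) (hpq : ∀ x, q x ↔ p x) : InNP A q := by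
  obtain ⟨M, h1, h2, h3⟩ := h
  exact ⟨M, h1, h2, fun x => (hpq x).trans (h3 x)⟩

theorem InNPCoNP.congr (h : InNPCoNP A p) (hpq : ∀ x, q x ↔ p x) : InNPCoNP A q :=
  ⟨h.1.congr hpq, h.2.congr fun x => not_congr (hpq x)⟩

/-- `wp` serves both as the clock, for all oracles, and as soundness, for `A` only; `can` is
completeness. -/
theorem inNP_of_wp {M : Machine} (ha : M.Avoids .ask) (P : Polynomial ℕ)
    (h : ∀ O x, M.wp O (P.eval x.length) (initial x).tapes fun b _ => O = baseOnly A → b = true → p x)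
    (h' : ∀ x, p x → M.can (baseOnly A) (initial x).tapes fun b _ => b = true) : InNP A p := by
  refine ⟨M, ha, polyTime_of_ensures P fun O x => ⟨_, h O x⟩, fun x => ⟨fun hx => ?_, ?_⟩⟩
  · obtain ⟨n, c, b, h1, h2, rfl⟩ := h' x hx
    exact ⟨n, c, h1, h2⟩
  · rintro ⟨n, c, h1, h2⟩
    exact Ensures.post (h (baseOnly A) x) h1 h2 rfl rfl

theorem Machine.Accepts.can {M : Machine} {O : Oracles} {x : List Bool} (h : M.Accepts O x) :
    M.can O (initial x).tapes fun b _ => b = true := by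
  obtain ⟨n, c, h1, h2⟩ := h
  exact ⟨n, c, true, h1, h2, rfl⟩

theorem initial_comp (x : List Bool) {σ : ℕ → ℕ} {T : Store} (h0 : T (σ 0) = stk x)
    (h : ∀ i, T (σ (i + 1)) = stk []) : T ∘ σ = (initial x).tapes := by
  funext i
  cases i with
  | zero => exact h0
  | succ i => exact h i

theorem Machine.Ensures.rename_initial {M : Machine} {O : Oracles} {Φ : Bool → Store → Prop} {n : ℕ}
    {σ : ℕ → ℕ} {x : List Bool} {T : Store} (hσ : Function.Injective σ)
    (hT : T ∘ σ = (initial x).tapes) (h : M.Ensures O Φ n (initial x)) :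
    (Machine.rename σ M).wp O n T fun b T' => Φ b (T' ∘ σ) ∧ ∀ j ∉ Set.range σ, T' j = T j := by
  refine Ensures.rename hσ ?_
  rw [hT]
  exact h

/-- If some accepting path of `F` leaves on tape `t` a string with a property in `NP`: this is a
property in `NP`. -/
theorem InNP.exists_output (h : InNP A p) {F : Machine} (hFa : F.Avoids .ask) (hF : F.PolyTime)
    (t : ℕ) : InNP A fun x => ∃ n c, F.Reaches (baseOnly A) n (initial x) c ∧
      F.instr c.state = .halt true ∧ p (tapeString (c.tapes t)) := by
  obtain ⟨M, hMa, hM, hp⟩ := h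
  obtain ⟨pF, hF⟩ := hF.ensures
  obtain ⟨pM, hM⟩ := hM.ensures
  -- `F` runs on the even tapes and `M` on the odd ones, which `F` leaves blank.
  have h0 : Function.Injective fun i : ℕ => 2 * i := fun a b h => by simpa using h
  have h1 : Function.Injective fun i : ℕ => 2 * i + 1 := fun a b h => by simpa using h
  have hodd : ∀ (x : List Bool) (T : Store), (∀ j ∉ Set.range fun i : ℕ => 2 * i,
      T j = (initial x).tapes j) → ∀ i, T (2 * i + 1) = stk [] := fun x T hT i => by
    rw [hT _ (by rintro ⟨j, hj⟩; simp only at hj; omega), initial_eq]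
    simp
  have hin : ∀ x, (initial x).tapes ∘ (fun i => 2 * i) = (initial x).tapes := fun x =>
    initial_comp x rfl fun i => by rw [initial_eq]; simp
  have hcopy : ∀ {T : Store} {v : Tape (Option Bool)} {y : List Bool}, (∀ i, T (2 * i + 1) = stk []) →
      (Function.update (Function.update T (2 * t) v) 1 (stk y)) ∘ (fun i => 2 * i + 1) =
        (initial y).tapes := by
    intro T v y hT
    refine initial_comp y (by simp) fun i => ?_
    rw [Function.update_of_ne (by omega), Function.update_of_ne (by omega), hT]
  -- `L` bounds the length of the string handed to `M`: the input length plus 2 for every step of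
  -- `F`.
  set L : Polynomial ℕ := Polynomial.X + 2 * pF
  refine inNP_of_wp (M := cond (rename (fun i => 2 * i) F) (seq (copyString (2 * t) 3 1)
    (rename (fun i => 2 * i + 1) M)) (ret false))
    (hFa.rename.cond (avoids_copyString.seq hMa.rename) avoids_ret)
    (pF + (26 * L + 10 + pM.comp L + 2) + 2) (fun O x => ?_) fun x hx => ?_
  · have hF := hF O x
    have key := Ensures.rename_initial h0 (hin x) hF
    refine (wp_cond (m := (26 * L + 10 + pM.comp L + 2).eval x.length) (key.mono le_rfl ?_)).mono'
      (by simp)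
    rintro b T ⟨⟨m, c, hm, hr, hc, hT⟩, hT'⟩
    cases b
    · exact .halt false rfl fun _ h => by cases h
    simp only [if_true]
    have hTodd := hodd x T hT'
    -- Tape `1` is the input tape of the renamed `M`; tape `3` is blank scratch space and is blank
    -- again afterwards.
    obtain ⟨v, hv⟩ := computes_copyString (O := O) (i := 2 * t) (j := 3) (k := 1) (by omega)
      (by omega) (by omega) (T := T) (hTodd 1) (hTodd 0)
    have hTt : T (2 * t) = c.tapes t := by rw [hT]; rfl
    set y := tapeString (T (2 * t)) with hy
    have hylen : y.length ≤ L.eval x.length := by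
      have hfit : Fits (x.length + 2 * m) (c.tapes t) := by
        refine hr.fits t ?_
        rw [initial_eq]
        by_cases ht : t = 0
        · simpa [ht] using fits_stk x
        · simpa [ht] using (fits_stk []).mono (Nat.zero_le _)
      rw [hy, hTt]
      refine hfit.length_tapeString_le.trans ?_
      simp only [L, Polynomial.eval_add, Polynomial.eval_X, Polynomial.eval_mul,
        Polynomial.eval_ofNat]
      omega
    have hM' := hM O y
    have key' := Ensures.rename_initial h1 (hcopy (v := v) hTodd) hM'
    have hpm : pM.eval y.length ≤ pM.eval (L.eval x.length) := eval_mono _ hylen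
    refine (wp_seq (m := (pM.comp L).eval x.length) (hv.wp
      (key'.mono (by simpa using hpm) ?_))).mono' ?_
    · rintro b T ⟨⟨m', c', -, hr', hc', -⟩, -⟩ rfl rfl
      refine ⟨m, c, hr, hc, ?_⟩
      rw [← hTt]
      exact (hp y).2 ⟨m', c', hr', hc'⟩
    · simp only [Polynomial.eval_add, Polynomial.eval_mul,
        Polynomial.eval_ofNat]
      omega
  · obtain ⟨n, c, hr, hc, hx⟩ := hx
    have hFc : F.can (baseOnly A) ((initial x).tapes ∘ fun i => 2 * i)
        fun b T => b = true ∧ T = c.tapes := by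
      rw [hin]
      exact ⟨n, c, true, hr, hc, rfl, rfl⟩
    refine can_cond ((Allows.rename h0 hFc).mono ?_)
    rintro b T ⟨⟨rfl, hT⟩, hT'⟩
    simp only [if_true]
    have hTodd := hodd x T hT'
    obtain ⟨v, hv⟩ := computes_copyString (O := baseOnly A) (i := 2 * t) (j := 3) (k := 1) (by omega)
      (by omega) (by omega) (T := T) (hTodd 1) (hTodd 0)
    have hTt : T (2 * t) = c.tapes t := by rw [← hT]; rfl
    refine can_seq (hv.can ?_)
    rw [← hTt, hp] at hx
    have := hx.can
    rw [← hcopy (v := v) hTodd] at this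
    exact (Allows.rename h1 this).mono fun b T h => h.1

/-- Guess an accepting path of the machine for `f`, then one for `p` on its output.
Single-valuedness makes every accepting path yield the right string, and totality provides one. -/
theorem InNP.comp (h : InNP A p) {f : List Bool → List Bool} (hf : f ∈ NPSVRel A) :
    InNP A fun x => p (f x) := by
  obtain ⟨F, ha, hF, hf⟩ := hf
  refine (h.exists_output (noParallelQueries_iff.1 ha) hF 1).congr fun x => ⟨fun hx => ?_, ?_⟩
  · obtain ⟨n, c, h1, h2, h3⟩ := (hf x).1
    exact ⟨n, c, h1, h2, by rwa [h3]⟩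
  · rintro ⟨n, c, h1, h2, h3⟩
    rwa [← (hf x).2 _ ⟨n, c, h1, h2, rfl⟩]

theorem InNPCoNP.comp (h : InNPCoNP A p) {f : List Bool → List Bool} (hf : f ∈ NPSVRel A) :
    InNPCoNP A fun x => p (f x) := ⟨h.1.comp hf, h.2.comp hf⟩

theorem InNP.or (hp : InNP A p) (hq : InNP A q) : InNP A fun x => p x ∨ q x := by
  obtain ⟨M, hMa, hM, hp⟩ := hp
  obtain ⟨N, hNa, hN, hq⟩ := hq
  obtain ⟨P, hM⟩ := hM.ensures
  obtain ⟨Q, hN⟩ := hN.ensures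
  refine inNP_of_wp (M := cond coin M N) ((avoids_coin (by simp)).cond hMa hNa) (1 + (P + Q) + 2)
    (fun O x => ?_) fun x hx => ?_
  · refine (wp_cond (m := (P + Q).eval x.length) (wp_coin fun b => ?_)).mono' (by simp)
    cases b
    · refine (hN O x).mono (by simp) ?_
      rintro b T ⟨m, c, -, h1, h2, h3⟩ rfl rfl
      exact .inr ((hq x).2 ⟨m, c, h1, h2⟩)
    · refine (hM O x).mono (by simp) ?_
      rintro b T ⟨m, c, -, h1, h2, h3⟩ rfl rfl
      exact .inl ((hp x).2 ⟨m, c, h1, h2⟩)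
  · rcases hx with hx | hx
    · exact can_cond (can_coin true ((hp x).1 hx).can)
    · exact can_cond (can_coin false ((hq x).1 hx).can)

/-- Move the string on tape `0` to the tapes `1` and `2`. -/
def dupInput : Machine :=
  seq (moveTo 0 3) (forPop 3 (seq (push 1 false) (push 2 false)) (seq (push 1 true) (push 2 true)))

theorem avoids_dupInput {f : Feature} : dupInput.Avoids f :=
  avoids_moveTo.seq ((avoids_push.seq avoids_push).forPop (avoids_push.seq avoids_push))

theorem computes_dupInput (O : Oracles) (x : List Bool) :
    dupInput.Computes O (initial x).tapes (40 * x.length + 20) true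
      (tp [stk [], stk x, stk x, stk []]) := by
  have h1 : ∀ (l u v : List Bool),
      (forPop 3 (seq (push 1 false) (push 2 false)) (seq (push 1 true) (push 2 true))).Computes O
      (tp [stk [], stk u, stk v, stk l]) (20 * l.length + 4) true
      (tp [stk [], stk (l.reverse ++ u), stk (l.reverse ++ v), stk []]) := by
    intro l
    induction l with
    | nil => exact fun u v => computes_forPop_nil_tp rfl
    | cons b l ih =>
      intro u v
      refine Computes.to (Computes.mono (computes_forPop_cons_tp (n := 10) (b := true)
        (T₁ := tp [stk [], stk (b :: u), stk (b :: v), stk l]) rfl ?_ (ih (b :: u) (b :: v))) ?_) ?_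
      · cases b <;> exact Computes.seq_le (computes_push_tp rfl) (computes_push_tp rfl) le_rfl
      · simp; omega
      · simp
  have h2 := h1 x.reverse [] []
  rw [List.reverse_reverse, List.append_nil] at h2
  rw [initial_eq_tp x 3]
  refine Computes.seq_le (m := 20 * x.reverse.length + 4) (computes_moveTo_tp (i := 0) (j := 3)
    (r := []) (by omega) rfl rfl) ?_ (by simp; omega)
  rw [List.append_nil]
  exact h2

theorem tp_dup_comp_odd (x : List Bool) :
    tp [stk [], stk x, stk x, stk []] ∘ (fun i => 2 * i + 1) = (initial x).tapes := by
  refine initial_comp x rfl fun i => ?_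
  rcases i with _ | i <;> rfl

theorem tp_dup_comp_even (x : List Bool) :
    tp [stk [], stk x, stk x, stk []] ∘ (fun i => 2 * i + 2) = (initial x).tapes := by
  refine initial_comp x rfl fun i => ?_
  rcases i with _ | i <;> rfl

theorem injective_two_mul_add (k : ℕ) : Function.Injective fun i : ℕ => 2 * i + k :=
  fun a b h => by simpa using h

theorem InNP.and (hp : InNP A p) (hq : InNP A q) : InNP A fun x => p x ∧ q x := by
  obtain ⟨M, hMa, hM, hp⟩ := hp
  obtain ⟨N, hNa, hN, hq⟩ := hq
  obtain ⟨P, hM⟩ := hM.ensures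
  obtain ⟨Q, hN⟩ := hN.ensures
  -- The second copy of the input lies on tapes that the first machine does not touch.
  have hcomp : ∀ (x : List Bool) (T : Store), (∀ j ∉ Set.range fun i : ℕ => 2 * i + 1,
      T j = tp [stk [], stk x, stk x, stk []] j) → T ∘ (fun i => 2 * i + 2) = (initial x).tapes := by
    intro x T hT
    rw [← tp_dup_comp_even]
    funext i
    exact hT _ (by rintro ⟨j, hj⟩; simp only at hj; omega)
  refine inNP_of_wp (M := seq dupInput (cond (rename (fun i => 2 * i + 1) M)
    (rename (fun i => 2 * i + 2) N) (ret false)))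
    (avoids_dupInput.seq (hMa.rename.cond hNa.rename avoids_ret))
    (40 * Polynomial.X + 20 + (P + Q + 2) + 2) (fun O x => ?_) fun x hx => ?_
  · refine (wp_seq (m := (P + Q + 2).eval x.length) ((computes_dupInput O x).wp ?_)).mono' (by simp)
    refine (wp_cond (m := Q.eval x.length) ((Ensures.rename_initial
      (injective_two_mul_add 1) (tp_dup_comp_odd x) (hM O x)).mono le_rfl ?_)).mono' (by simp)
    rintro b T ⟨⟨m, c, -, h1, h2, -⟩, hT⟩
    cases b
    · exact .halt false rfl fun _ h => by cases h
    simp only [if_true]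
    refine (Ensures.rename_initial (injective_two_mul_add 2) (hcomp x T hT) (hN O x)).mono le_rfl ?_
    rintro b T ⟨⟨m', c', -, h1', h2', -⟩, -⟩ rfl rfl
    exact ⟨(hp x).2 ⟨m, c, h1, h2⟩, (hq x).2 ⟨m', c', h1', h2'⟩⟩
  · have h1 := ((hp x).1 hx.1).can
    have h2 := ((hq x).1 hx.2).can
    rw [← tp_dup_comp_odd] at h1
    refine can_seq ((computes_dupInput _ x).can (can_cond
      ((Allows.rename (injective_two_mul_add 1) h1).mono ?_)))
    rintro b T ⟨rfl, hT⟩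
    rw [← hcomp x T hT] at h2
    exact (Allows.rename (injective_two_mul_add 2) h2).mono fun _ _ h => h.1

theorem InNPCoNP.not (hp : InNPCoNP A p) : InNPCoNP A fun x => ¬ p x :=
  ⟨hp.2, hp.1.congr fun _ => not_not⟩

theorem InNPCoNP.and (hp : InNPCoNP A p) (hq : InNPCoNP A q) : InNPCoNP A fun x => p x ∧ q x :=
  ⟨hp.1.and hq.1, (hp.2.or hq.2).congr fun _ => not_and_or⟩

theorem InNPCoNP.or (hp : InNPCoNP A p) (hq : InNPCoNP A q) : InNPCoNP A fun x => p x ∨ q x :=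
  ⟨hp.1.or hq.1, (hp.2.and hq.2).congr fun _ => not_or⟩

theorem InNPCoNP.iff (hp : InNPCoNP A p) (hq : InNPCoNP A q) : InNPCoNP A fun x => (p x ↔ q x) :=
  ((hp.and hq).or (hp.not.and hq.not)).congr fun _ => by tauto

/-- Deterministic polynomial-time machines decide properties in `NP ∩ coNP`. -/
theorem inNPCoNP_accepts {M : Machine} (hc : M.Avoids .choose) (ha : M.Avoids .ask)
    (hM : M.PolyTime) : InNPCoNP A fun x => M.Accepts (baseOnly A) x := by
  refine ⟨⟨M, ha, hM, fun x => Iff.rfl⟩, ?_⟩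
  obtain ⟨P, hP⟩ := hM.ensures
  -- Exchange the two answers. This decides the complement because a deterministic machine has only
  -- one halting configuration.
  refine inNP_of_wp (M := cond M (ret false) (ret true)) (ha.cond avoids_ret avoids_ret) (P + 2)
    (fun O x => ?_) fun x hx => ?_
  · refine (wp_cond (m := 0) ((hP O x).mono le_rfl ?_)).mono' (by simp)
    rintro b T ⟨m, c, -, h1, h2, -⟩
    cases b
    · refine .halt true rfl ?_
      rintro rfl - ⟨m', c', h1', h2'⟩
      have := hc.halting_unique h1 h2 h1' h2'
      subst this
      rw [h2] at h2'
      cases h2'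
    · exact .halt false rfl fun _ h => by cases h
  · refine can_cond ((hP (baseOnly A) x).allows.mono ?_)
    rintro b T ⟨m, c, -, h1, h2, -⟩
    cases b
    · exact ⟨0, _, true, .refl _, rfl, rfl⟩
    · exact absurd ⟨m, c, h1, h2⟩ hx

theorem inNPCoNP_of_computes {M : Machine} (hc : M.Avoids .choose) (ha : M.Avoids .ask)
    (P : Polynomial ℕ) (h : ∀ O x, ∃ b T, M.Computes O (initial x).tapes (P.eval x.length) b T ∧
      (O = baseOnly A → (p x ↔ b = true))) : InNPCoNP A p := by
  have hM : M.PolyTime := polyTime_of_computes P fun O x => by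
    obtain ⟨b, T, h, -⟩ := h O x
    exact ⟨b, T, h⟩
  refine (inNPCoNP_accepts hc ha hM).congr fun x => ?_
  obtain ⟨b, T, h, h'⟩ := h (baseOnly A) x
  rw [h.accepts_iff, h' rfl]

/-- The result of one pop from the input. -/
theorem computes_pop_initial (O : Oracles) (z : List Bool) :
    (pop 0).Computes O (initial z).tapes 1 (z.headD false) (initial z.tail).tapes := by
  have h := computes_pop (O := O) (T := (initial z).tapes) 0 (l := z) rfl
  refine h.to ?_
  funext i
  rcases eq_or_ne i 0 with rfl | hi
  · simp [initial_eq]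
  · simp [initial_eq, hi]

theorem inNPCoNP_head : InNPCoNP A fun z => z.headD false = true :=
  inNPCoNP_of_computes (M := pop 0) avoids_pop avoids_pop 1 fun O x =>
    ⟨_, _, (computes_pop_initial O x).mono (by simp), fun _ => Iff.rfl⟩

theorem InNP.tail (h : InNP A p) : InNP A fun z => p z.tail := by
  obtain ⟨M, ha, hM, hp⟩ := h
  obtain ⟨P, hM⟩ := hM.ensures
  refine inNP_of_wp (M := seq (pop 0) M) (avoids_pop.seq ha) (P + 3) (fun O x => ?_) fun x hx => ?_
  · refine (wp_seq (m := P.eval x.length) ((computes_pop_initial O x).wp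
      ((hM O x.tail).mono (eval_mono _ (by simp)) ?_))).mono' (by simp; omega)
    rintro b T ⟨m, c, -, h1, h2, -⟩ rfl rfl
    exact (hp _).2 ⟨m, c, h1, h2⟩
  · exact can_seq ((computes_pop_initial _ x).can ((hp _).1 hx).can)

theorem InNPCoNP.tail (h : InNPCoNP A p) : InNPCoNP A fun z => p z.tail := ⟨h.1.tail, h.2.tail⟩

/-- The truth table of a property in `NP ∩ coNP`, in front of the input. -/
theorem InNPCoNP.truthTable (h : InNPCoNP A p) :
    ∃ f ∈ NPSVRel A, ∀ x, (p x → f x = true :: false :: x) ∧ (¬ p x → f x = false :: true :: x) := by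
  classical
  obtain ⟨⟨M, hMa, hM, hp⟩, ⟨N, hNa, hN, hq⟩⟩ := h
  obtain ⟨P, hM⟩ := hM.ensures
  obtain ⟨Q, hN⟩ := hN.ensures
  refine ⟨fun x => if p x then true :: false :: x else false :: true :: x, ?_,
    fun x => ⟨fun h => if_pos h, fun h => if_neg h⟩⟩
  -- The bits are pushed in reverse, so `a` ends up in front: the table is negation for `a = true`
  -- and identity for `a = false`.
  set B : Bool → Machine → Machine := fun a K =>
    seq (push 1 !a) (seq (push 1 a) (rename (fun i => 2 * i + 2) K)) with hB
  have hpush : ∀ (O : Oracles) (x : List Bool) (a : Bool) (K : Machine) (n : ℕ)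
      (Φ : Bool → Store → Prop), (rename (fun i => 2 * i + 2) K).wp O n
        (tp [stk [], stk (a :: (!a) :: x), stk x, stk []]) Φ →
      (B a K).wp O (n + 12) (tp [stk [], stk x, stk x, stk []]) Φ := by
    intro O x a K n Φ h
    exact (wp_seq ((computes_push_tp rfl).wp (wp_seq ((computes_push_tp rfl).wp h)))).mono'
      (by omega)
  have hpush' : ∀ (O : Oracles) (x : List Bool) (a : Bool) (K : Machine)
      (Φ : Bool → Store → Prop), (rename (fun i => 2 * i + 2) K).can O
        (tp [stk [], stk (a :: (!a) :: x), stk x, stk []]) Φ →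
      (B a K).can O (tp [stk [], stk x, stk x, stk []]) Φ := by
    intro O x a K Φ h
    exact can_seq ((computes_push_tp rfl).can (can_seq ((computes_push_tp rfl).can h)))
  have hcomp : ∀ (x y : List Bool), tp [stk [], stk y, stk x, stk []] ∘ (fun i => 2 * i + 2) =
      (initial x).tapes := by
    intro x y
    refine initial_comp x rfl fun i => ?_
    rcases i with _ | i <;> rfl
  have hout : ∀ (x y : List Bool) (T : Store), (∀ j ∉ Set.range fun i : ℕ => 2 * i + 2,
      T j = tp [stk [], stk y, stk x, stk []] j) → tapeString (T 1) = y := by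
    intro x y T hT
    rw [hT 1 (by rintro ⟨j, hj⟩; simp only at hj; omega)]
    exact tapeString_stk y
  -- Guess whether `p x` holds and verify the guess by `M` or `N`; only the correct guess can lead
  -- to acceptance.
  set K : Machine := seq dupInput (cond coin (B true M) (B false N)) with hK
  have hwp : ∀ O x, K.wp O ((40 * Polynomial.X + P + Q + 40 : Polynomial ℕ).eval x.length)
      (initial x).tapes fun b T => O = baseOnly A → b = true →
        tapeString (T 1) = if p x then true :: false :: x else false :: true :: x := by
    intro O x
    refine (wp_seq (m := (P + Q + 15).eval x.length) ((computes_dupInput O x).wp ?_)).mono'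
      (by simp; omega)
    refine (wp_cond (m := (P + Q + 12).eval x.length) (wp_coin fun b => ?_)).mono' (by simp; omega)
    cases b
    · refine (hpush O x false N (Q.eval x.length) _ ?_).mono' (by simp)
      refine (Ensures.rename_initial (injective_two_mul_add 2) (hcomp x _) (hN O x)).mono le_rfl ?_
      rintro b T ⟨⟨m, c, -, h1, h2, -⟩, hT⟩ rfl rfl
      rw [hout _ _ _ hT, if_neg ((hq x).2 ⟨m, c, h1, h2⟩)]
      rfl
    · refine (hpush O x true M (P.eval x.length) _ ?_).mono' (by simp)
      refine (Ensures.rename_initial (injective_two_mul_add 2) (hcomp x _) (hM O x)).mono le_rfl ?_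
      rintro b T ⟨⟨m, c, -, h1, h2, -⟩, hT⟩ rfl rfl
      rw [hout _ _ _ hT, if_pos ((hp x).2 ⟨m, c, h1, h2⟩)]
      rfl
  refine ⟨K, noParallelQueries_iff.2 (avoids_dupInput.seq ((avoids_coin (by simp)).cond
    (avoids_push.seq (avoids_push.seq hMa.rename)) (avoids_push.seq (avoids_push.seq hNa.rename)))),
    polyTime_of_ensures _ fun O x => ⟨_, hwp O x⟩, fun x => ⟨?_, ?_⟩⟩
  · have : K.can (baseOnly A) (initial x).tapes fun b T => b = true ∧
        tapeString (T 1) = if p x then true :: false :: x else false :: true :: x := by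
      refine can_seq ((computes_dupInput _ x).can (can_cond (can_coin (decide (p x)) ?_)))
      by_cases hx : p x
      · have h := ((hp x).1 hx).can
        rw [← hcomp x (true :: (!true) :: x)] at h
        simp only [hx, decide_true, if_true]
        refine hpush' _ x true M _ ((Allows.rename (injective_two_mul_add 2) h).mono ?_)
        rintro b T ⟨rfl, hT⟩
        exact ⟨rfl, hout _ _ _ hT⟩
      · have h := ((hq x).1 hx).can
        rw [← hcomp x (false :: (!false) :: x)] at h
        simp only [hx, decide_false, if_false, Bool.false_eq_true]
        refine hpush' _ x false N _ ((Allows.rename (injective_two_mul_add 2) h).mono ?_)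
        rintro b T ⟨rfl, hT⟩
        exact ⟨rfl, hout _ _ _ hT⟩
    obtain ⟨n, c, b, h1, h2, rfl, h3⟩ := this
    exact ⟨n, c, h1, h2, h3⟩
  · rintro y ⟨n, c, h1, h2, rfl⟩
    exact Ensures.post (hwp (baseOnly A) x) h1 h2 rfl rfl

/-! ## Computations with the same steps -/

namespace Machine

variable {M N : Machine} {O O' : Oracles} {n m : ℕ} {c c' c₀ : Cfg}

theorem Reaches.transfer (h : M.Reaches O n c c')
    (hs : ∀ k c₁ b c₂, M.Reaches O k c c₁ → M.step O b c₁ = some c₂ → N.step O' b c₁ = some c₂) :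
    N.Reaches O' n c c' :=
  Reaches.rec_snoc (P := fun n c' => N.Reaches O' n c c') (.refl _)
    (fun _ _ _ _ hr hb ih => ih.snoc (hs _ _ _ _ hr hb)) h

theorem Avoids.step_congr_base (h : M.Avoids .query) (b : Bool) (c : Cfg) {C D B B' : Language Bool} :
    M.step ⟨B, C, D⟩ b c = M.step ⟨B', C, D⟩ b c := by
  have := h.instr c.state
  unfold step
  cases h : M.instr c.state <;> simp_all [Instr.feature]

theorem Avoids.reaches_congr_base (h : M.Avoids .query) {C D B B' : Language Bool}
    (hr : M.Reaches ⟨B, C, D⟩ n c c') : M.Reaches ⟨B', C, D⟩ n c c' :=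
  hr.transfer fun _ _ b _ _ hb => (h.step_congr_base b _).symm.trans hb

/-! ## Eliminating the parallel queries -/

/-- The language that contains all strings or none. -/
def constLanguage (a : Bool) : Language Bool := {_x | a = true}

/-- Replace the answers to the parallel queries by constants. -/
def fixAnswers (a d : Bool) (M : Machine) : Machine :=
  M.map fun
    | .ask i j q => jump (q (i.isSome && a) (j.isSome && d))
    | I => I

theorem instr_map (f : Instr → Instr) (hf : f (.halt false) = .halt false) (q : ℕ) :
    Machine.instr (M.map f) q = f (M.instr q) := by
  unfold instr
  rw [List.getElem?_map]
  cases M[q]? with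
  | none => exact hf.symm
  | some I => rfl

theorem instr_fixAnswers {a d : Bool} (q : ℕ) : (fixAnswers a d M).instr q =
    match M.instr q with
    | .ask i j q => jump (q (i.isSome && a) (j.isSome && d))
    | I => I := instr_map _ rfl q

/-- A query that is not posed is answered `false` whatever the oracle, hence the conjunction with
`i.isSome`. -/
theorem optAnswer_constLanguage (a : Bool) (i : Option ℕ) :
    optAnswer (constLanguage a) c i = (i.isSome && a) := by
  classical
  cases i with
  | none => rfl
  | some t =>
    have : ∀ x, x ∈ constLanguage a ↔ a = true := fun _ => Iff.rfl
    simp [optAnswer, chi, this]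

theorem step_fixAnswers {a d : Bool} (O : Oracles) (b : Bool) (c : Cfg) :
    (fixAnswers a d M).step O b c = M.step ⟨O.base, constLanguage a, constLanguage d⟩ b c := by
  unfold step
  rw [instr_fixAnswers]
  cases h : M.instr c.state <;> simp [jump, optAnswer_constLanguage, Action.onTape]

theorem halt_fixAnswers {a d b : Bool} {q : ℕ} (h : M.instr q = .halt b) :
    (fixAnswers a d M).instr q = .halt b := by rw [instr_fixAnswers, h]

/-- The steps are those of `M` with constant parallel oracles, and the clock of `M` covers all
oracles. -/
theorem PolyTime.fixAnswers {a d : Bool} (h : M.PolyTime) : (fixAnswers a d M).PolyTime := by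
  obtain ⟨P, h⟩ := h
  exact ⟨P, fun O x n c hr => h ⟨O.base, constLanguage a, constLanguage d⟩ x n c
    (hr.transfer fun _ _ _ _ _ hb => (step_fixAnswers O _ _).symm.trans hb)⟩

theorem avoids_map {f : Feature} {g : Instr → Instr}
    (h : ∀ I, I.feature ≠ some f → (g I).feature ≠ some f) (hM : M.Avoids f) :
    Avoids f (M.map g) := by
  intro I hI
  obtain ⟨J, hJ, rfl⟩ := List.mem_map.1 hI
  exact h J (hM J hJ)

theorem Avoids.fixAnswers {f : Feature} {a d : Bool} (h : M.Avoids f) :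
    (fixAnswers a d M).Avoids f :=
  avoids_map (fun I hI => by cases I <;> simp_all [Instr.feature, jump]) h

theorem avoids_ask_fixAnswers {a d : Bool} : (fixAnswers a d M).Avoids .ask := by
  intro I hI
  obtain ⟨J, hJ, rfl⟩ := List.mem_map.1 hI
  cases J <;> simp [Instr.feature, jump]

/-- Halt at the first round of parallel queries, and accept if `s` holds for the queried tapes. -/
def stopAtAsk (s : Option ℕ → Option ℕ → Bool) (M : Machine) : Machine :=
  M.map fun
    | .ask i j _ => .halt (s i j)
    | .halt _ => .halt false
    | I => I

variable {s : Option ℕ → Option ℕ → Bool}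

theorem instr_stopAtAsk (q : ℕ) : (stopAtAsk s M).instr q =
    match M.instr q with
    | .ask i j _ => .halt (s i j)
    | .halt _ => .halt false
    | I => I := instr_map _ rfl q

theorem step_of_step_stopAtAsk {b : Bool} (hO : O.base = O'.base)
    (h : (stopAtAsk s M).step O b c = some c') : M.step O' b c = some c' := by
  unfold step at *
  rw [instr_stopAtAsk] at h
  cases h' : M.instr c.state <;> simp_all

/-- Before the parallel round only the base oracle matters, so the parallel oracles may be
exchanged. -/
theorem step_stopAtAsk {b : Bool} (hO : O.base = O'.base) (hc : ¬ M.AsksAt c)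
    (h : M.step O b c = some c') : (stopAtAsk s M).step O' b c = some c' := by
  have hc : ∀ i j q, M.instr c.state ≠ .ask i j q := fun i j q h => hc ⟨i, j, q, h⟩
  unfold step at *
  rw [instr_stopAtAsk]
  cases h' : M.instr c.state <;> simp_all

theorem halt_stopAtAsk_iff {q : ℕ} : (stopAtAsk s M).instr q = .halt true ↔
    ∃ i j r, M.instr q = .ask i j r ∧ s i j = true := by
  rw [instr_stopAtAsk]
  cases h : M.instr q <;> simp

theorem AsksAt.halt_stopAtAsk (h : M.AsksAt c) : ∃ b, (stopAtAsk s M).instr c.state = .halt b := by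
  obtain ⟨i, j, q, h⟩ := h
  exact ⟨s i j, by rw [instr_stopAtAsk, h]⟩

theorem PolyTime.stopAtAsk (h : M.PolyTime) : (stopAtAsk s M).PolyTime := by
  obtain ⟨P, h⟩ := h
  exact ⟨P, fun O x n c hr => h O x n c
    (hr.transfer fun _ _ _ _ _ hb => step_of_step_stopAtAsk rfl hb)⟩

theorem Avoids.stopAtAsk {f : Feature} (h : M.Avoids f) : (stopAtAsk s M).Avoids f :=
  avoids_map (fun I hI => by cases I <;> simp_all [Instr.feature]) h

theorem avoids_ask_stopAtAsk : (stopAtAsk s M).Avoids .ask := by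
  intro I hI
  obtain ⟨J, hJ, rfl⟩ := List.mem_map.1 hI
  cases J <;> simp [Instr.feature]

/-- With at most one round of parallel queries, nothing is lost by halting at the first one. -/
theorem Reaches.stopAtAsk (hO : O.base = O'.base) (hM : M.AtMostOneRound O) {x : List Bool}
    (hr : M.Reaches O n (initial x) c) (hc : M.AsksAt c) :
    (stopAtAsk s M).Reaches O' n (initial x) c := by
  have key : (Machine.stopAtAsk s M).Reaches O' n (initial x) c ∨
      ∃ k m c₁, M.Reaches O k (initial x) c₁ ∧ M.AsksAt c₁ ∧ M.Reaches O (m + 1) c₁ c := by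
    refine Reaches.rec_snoc (P := fun n c => (Machine.stopAtAsk s M).Reaches O' n (initial x) c ∨
      ∃ k m c₁, M.Reaches O k (initial x) c₁ ∧ M.AsksAt c₁ ∧ M.Reaches O (m + 1) c₁ c)
      (.inl (.refl _)) ?_ hr
    rintro n c' c'' b hr hb (ih | ⟨k, m, c₁, h1, h2, h3⟩)
    · by_cases hc : M.AsksAt c'
      · exact .inr ⟨n, 0, c', hr, hc, .cons b hb (.refl _)⟩
      · exact .inl (ih.snoc (step_stopAtAsk hO hc hb))
    · exact .inr ⟨k, m + 1, c₁, h1, h2, h3.snoc hb⟩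
  refine key.resolve_right ?_
  rintro ⟨k, m, c₁, h1, h2, h3⟩
  exact hM x k m c₁ c h1 h2 h3 hc

/-- A deterministic machine poses its only round of parallel queries in a unique configuration. -/
theorem AtMostOneRound.unique (hM : M.AtMostOneRound O) (hc : M.Avoids .choose) {x : List Bool}
    {c₁ c₂ : Cfg} (h₁ : M.Reaches O n (initial x) c₁) (h₁' : M.AsksAt c₁)
    (h₂ : M.Reaches O m (initial x) c₂) (h₂' : M.AsksAt c₂) : c₁ = c₂ := by
  obtain ⟨b₁, hb₁⟩ := h₁'.halt_stopAtAsk (s := fun _ _ => true)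
  obtain ⟨b₂, hb₂⟩ := h₂'.halt_stopAtAsk (s := fun _ _ => true)
  exact hc.stopAtAsk.halting_unique (h₁.stopAtAsk rfl hM h₁') hb₁ (h₂.stopAtAsk rfl hM h₂') hb₂

end Machine

/-- The tape of a parallel query, where `sel` selects one of the two queries. -/
def Instr.askTape (sel : Option ℕ → Option ℕ → Option ℕ) : Instr → Option ℕ
  | .ask i j _ => sel i j
  | _ => none

/-- A parallel query about a string with the property `p` is posed on the given input. -/
def Machine.Asked (M : Machine) (O : Oracles) (sel : Option ℕ → Option ℕ → Option ℕ)
    (p : List Bool → Prop) (x : List Bool) : Prop :=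
  ∃ n c t, M.Reaches O n (initial x) c ∧ (M.instr c.state).askTape sel = some t ∧
    p (tapeString (c.tapes t))

theorem asksAt_of_askTape {M : Machine} {c : Cfg} {sel : Option ℕ → Option ℕ → Option ℕ} {t : ℕ}
    (h : (M.instr c.state).askTape sel = some t) :
    ∃ i j q, M.instr c.state = .ask i j q ∧ sel i j = some t := by
  cases h' : M.instr c.state <;> simp_all [Instr.askTape]

theorem inNPCoNP_const (a : Bool) : InNPCoNP A fun _ => a = true :=
  inNPCoNP_of_computes (M := ret a) avoids_ret avoids_ret 0 fun _ _ =>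
    ⟨a, _, computes_ret.mono (Nat.zero_le _), fun _ => Iff.rfl⟩

theorem InNP.exists_mem {ι : Type*} {r : ι → List Bool → Prop} (h : ∀ i, InNP A (r i)) (l : List ι) :
    InNP A fun x => ∃ i ∈ l, r i x := by
  induction l with
  | nil => exact (inNPCoNP_const false).1.congr fun x => by simp
  | cons i l ih => exact ((h i).or ih).congr fun x => by simp

/-! ### The posed parallel queries as properties in `NP` and `NP ∩ coNP`. -/

section

variable {M : Machine} {O : Oracles} {sel : Option ℕ → Option ℕ → Option ℕ}

/-- Run `M` up to its round, which needs only the base oracle, and then verify `p` for the queried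
string. The tape of the query depends on the path, but only the finitely many tapes named in `M` can
occur. -/
theorem InNP.asked (hp : InNP O.base p) (hM : M.PolyTime) (hO : M.AtMostOneRound O) :
    InNP O.base (M.Asked O sel p) := by
  refine (InNP.exists_mem (fun t => hp.exists_output (F := stopAtAsk
    (fun i j => decide (sel i j = some t)) M) avoids_ask_stopAtAsk hM.stopAtAsk t)
    (M.filterMap (Instr.askTape sel))).congr fun x => ⟨?_, ?_⟩
  · rintro ⟨n, c, t, h1, h2, h3⟩
    obtain ⟨i, j, q, h4, h5⟩ := asksAt_of_askTape h2
    refine ⟨t, List.mem_filterMap.2 ⟨M.instr c.state, ?_, h2⟩, n, c,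
      h1.stopAtAsk (O := O) (O' := baseOnly O.base) rfl hO ⟨i, j, q, h4⟩,
      halt_stopAtAsk_iff.2 ⟨i, j, q, h4, by simpa using h5⟩, h3⟩
    refine (M.instr_eq_or_mem c.state).resolve_left fun h => ?_
    rw [h] at h4
    cases h4
  · rintro ⟨t, -, n, c, h1, h2, h3⟩
    obtain ⟨i, j, q, h4, h5⟩ := halt_stopAtAsk_iff.1 h2
    refine ⟨n, c, t, h1.transfer fun _ _ _ _ _ hb =>
      step_of_step_stopAtAsk (O := baseOnly O.base) rfl hb, ?_, h3⟩
    rw [h4]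
    exact of_decide_eq_true h5

/-- By determinism the round is posed in only one configuration, so the existential in `Asked`
concerns a single string. -/
theorem asked_iff (hc : M.Avoids .choose) (hO : M.AtMostOneRound O) {x : List Bool} {n t : ℕ}
    {c : Cfg} (h : M.Reaches O n (initial x) c) (ht : (M.instr c.state).askTape sel = some t) :
    M.Asked O sel p x ↔ p (tapeString (c.tapes t)) := by
  refine ⟨?_, fun hp => ⟨n, c, t, h, ht, hp⟩⟩
  rintro ⟨n', c', t', h', ht', hp⟩
  obtain ⟨i, j, q, h1, -⟩ := asksAt_of_askTape ht
  obtain ⟨i', j', q', h1', -⟩ := asksAt_of_askTape ht'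
  have := hO.unique hc h ⟨i, j, q, h1⟩ h' ⟨i', j', q', h1'⟩
  subst this
  rw [ht] at ht'
  cases ht'
  exact hp

/-- `Asked` fails either because no such query is posed, which is decidable in deterministic
polynomial time, or because the queried string fails `p`, which is in `NP`. -/
theorem InNPCoNP.asked (hp : InNPCoNP O.base p) (hM : M.PolyTime) (hc : M.Avoids .choose)
    (hO : M.AtMostOneRound O) : InNPCoNP O.base (M.Asked O sel p) := by
  refine ⟨hp.1.asked hM hO, ?_⟩
  have h := inNPCoNP_accepts (M := stopAtAsk (fun i j => (sel i j).isSome) M) (A := O.base)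
    hc.stopAtAsk avoids_ask_stopAtAsk hM.stopAtAsk
  refine (h.2.or (hp.2.asked (sel := sel) hM hO)).congr fun x => ?_
  by_cases hx : ∃ n c t, M.Reaches O n (initial x) c ∧ (M.instr c.state).askTape sel = some t
  · obtain ⟨n, c, t, h1, h2⟩ := hx
    obtain ⟨i, j, q, h3, h4⟩ := asksAt_of_askTape h2
    rw [asked_iff hc hO h1 h2, asked_iff hc hO h1 h2]
    refine ⟨.inr, fun h => h.resolve_left fun h => h ⟨n, c,
      h1.stopAtAsk (O := O) (O' := baseOnly O.base) rfl hO ⟨i, j, q, h3⟩,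
      halt_stopAtAsk_iff.2 ⟨i, j, q, h3, by simp [h4]⟩⟩⟩
  · refine iff_of_true (fun ⟨n, c, t, h1, h2, _⟩ => hx ⟨n, c, t, h1, h2⟩) (.inl ?_)
    rintro ⟨n, c, h1, h2⟩
    obtain ⟨i, j, q, h4, h5⟩ := halt_stopAtAsk_iff.1 h2
    obtain ⟨t, h5⟩ := Option.isSome_iff_exists.1 h5
    exact hx ⟨n, c, t, h1.transfer fun _ _ _ _ _ hb =>
      step_of_step_stopAtAsk (O := baseOnly O.base) rfl hb,
      by rw [h4]; exact h5⟩

-- The true answers are functions of the input alone, because the round is unique; substituting them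
-- as constants changes no step of `M`.
open Classical in
theorem accepts_iff_fixAnswers (hM : M.PolyTime) (hc : M.Avoids .choose) (hO : M.AtMostOneRound O)
    (x : List Bool) : M.Accepts O x ↔ (fixAnswers (decide (M.Asked O (fun i _ => i) (· ∈ O.fst) x))
      (decide (M.Asked O (fun _ j => j) (· ∈ O.snd) x)) M).Accepts (baseOnly O.base) x := by
  have key : ∀ {n c}, M.Reaches O n (initial x) c →
      (fixAnswers (decide (M.Asked O (fun i _ => i) (· ∈ O.fst) x))
      (decide (M.Asked O (fun _ j => j) (· ∈ O.snd) x)) M).Reaches (baseOnly O.base) n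
        (initial x) c := by
    intro n c h
    refine h.transfer fun k c₁ b c₂ hr hb => ?_
    rw [step_fixAnswers, ← hb]
    unfold step
    cases h' : M.instr c₁.state with
    | ask i j q =>
      have h1 : optAnswer O.fst c₁ i =
          (i.isSome && decide (M.Asked O (fun i _ => i) (· ∈ O.fst) x)) := by
        cases i with
        | none => rfl
        | some t =>
          rw [Bool.decide_congr (asked_iff hc hO hr (t := t) (by rw [h']; rfl))]
          simp [optAnswer, chi]
      have h2 : optAnswer O.snd c₁ j =
          (j.isSome && decide (M.Asked O (fun _ j => j) (· ∈ O.snd) x)) := by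
        cases j with
        | none => rfl
        | some t =>
          rw [Bool.decide_congr (asked_iff hc hO hr (t := t) (by rw [h']; rfl))]
          simp [optAnswer, chi]
      simp only [optAnswer_constLanguage, h1, h2]
    | _ => rfl
  constructor
  · rintro ⟨n, c, h1, h2⟩
    exact ⟨n, c, key h1, halt_fixAnswers h2⟩
  · rintro ⟨n, c, h1, h2⟩
    -- `M` itself halts; its halting configuration is also reached with fixed answers, and there it
    -- is unique.
    obtain ⟨P, hP⟩ := hM.ensures
    obtain ⟨-, -, b, -, -, m, c', -, h3, h4, -⟩ := (hP O x).allows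
    have := hc.fixAnswers.halting_unique h1 h2 (key h3) (halt_fixAnswers h4)
    subst this
    rw [halt_fixAnswers h4] at h2
    cases h2
    exact ⟨m, c, h3, h4⟩

end

/-! ## The normal form of the three classes -/

/-- The language of the strings with a given property. -/
def languageOf (p : List Bool → Prop) : Language Bool := {x | p x}

@[simp] theorem mem_languageOf {x : List Bool} : x ∈ languageOf p ↔ p x := Iff.rfl

/-- The property is the symmetric difference of one in `NP ∩ coNP` and one in `NP`. -/
def IsXor (A : Language Bool) (p : List Bool → Prop) : Prop :=
  ∃ C D, InNPCoNP A C ∧ InNP A D ∧ ∀ x, p x ↔ ¬ (C x ↔ D x)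

theorem InNP.isXor (h : InNP A p) : IsXor A p :=
  ⟨_, p, inNPCoNP_const false, h, fun x => by simp⟩

/-- Evaluate the truth table in front of a string at the truth value of a property of the string. -/
def EvalTable (p : List Bool → Prop) (z : List Bool) : Prop :=
  (p z.tail.tail ∧ z.tail.headD false = true) ∨ (¬ p z.tail.tail ∧ z.headD false = true)

/-- With the table `(a₀, a₁)` and `p = C ⊕ D`, the value is `[a₀ ⊕ ((a₀ ⊕ a₁) ∧ C)] ⊕ [(a₀ ⊕ a₁) ∧
D]`. The first bracket is in `NP ∩ coNP`, the second in `NP`. -/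
theorem IsXor.evalTable (h : IsXor A p) {f : List Bool → List Bool} (hf : f ∈ NPSVRel A) :
    IsXor A fun x => EvalTable p (f x) := by
  obtain ⟨C, D, hC, hD, h⟩ := h
  have h0 := inNPCoNP_head (A := A)
  have h1 := h0.tail
  refine ⟨_, _, (h0.iff ((h0.iff h1).not.and hC.tail.tail)).not.comp hf,
    ((h0.iff h1).not.1.and hD.tail.tail).comp hf, fun x => ?_⟩
  simp only [EvalTable, h]
  tauto

theorem fpRel_subset_npsvRel : FPRel A ⊆ NPSVRel A := by
  rintro f ⟨M, hc, ha, hM, hf⟩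
  refine ⟨M, ha, hM, fun x => ⟨hf x, ?_⟩⟩
  rintro y ⟨n, c, h1, h2, rfl⟩
  obtain ⟨n', c', h1', h2', h3'⟩ := hf x
  rw [← h3', (deterministic_iff.1 hc).halting_unique h1 h2 h1' h2']

theorem fp_subset_fpRel : FP ⊆ FPRel A := by
  rintro f ⟨M, hc, hq, ha, hM, hf⟩
  refine ⟨M, hc, ha, hM, fun x => ?_⟩
  obtain ⟨n, c, h1, h2, h3⟩ := hf x
  exact ⟨n, c, (noBaseQueries_iff.1 hq).reaches_congr_base h1, h2, h3⟩

theorem OneTTVia.evalTable {F : Set (List Bool → List Bool)} {L B : Language Bool}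
    (h : OneTTVia F L B) : ∃ f ∈ F, ∀ x, x ∈ L ↔ EvalTable (· ∈ B) (f x) := by
  classical
  obtain ⟨α, y, hf, h⟩ := h
  refine ⟨_, hf, fun x => (h x).trans ?_⟩
  by_cases hx : y x ∈ B <;> simp [EvalTable, chi, hx]

/-- An `NP` set is a symmetric difference with the empty set, and differences are closed under truth
tables. Conversely `C x ⊕ D x` is the truth table `b ↦ C x ⊕ b` with query `x` to `D`, and
`InNPCoNP.truthTable` computes that table. -/
theorem mem_RSNNP_iff {L : Language Bool} : L ∈ RSNNP A ↔ IsXor A (· ∈ L) := by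
  classical
  constructor
  · rintro ⟨B, hB, h⟩
    obtain ⟨f, hf, h⟩ := OneTTVia.evalTable h
    obtain ⟨C, D, hC, hD, h'⟩ := (mem_NP_iff.1 hB).isXor.evalTable hf
    exact ⟨C, D, hC, hD, fun x => (h x).trans (h' x)⟩
  · rintro ⟨C, D, hC, hD, h⟩
    obtain ⟨f, hf, hf'⟩ := hC.truthTable
    refine ⟨languageOf D, mem_NP_iff.2 hD, fun x b => if b then decide (¬ C x) else decide (C x),
      id, ?_, fun x => (h x).trans ?_⟩
    · convert hf using 2 with x
      by_cases hx : C x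
      · simp [(hf' x).1 hx, hx]
      · simp [(hf' x).2 hx, hx]
    · by_cases hx : D x <;> simp [chi, hx]

theorem pParallel_subset : PParallel (NP A ∩ coNP A) (NP A) ⊆ PParallelNPRel A := by
  rintro L ⟨C, hC, D, hD, M, hc, hq, hM, h1, h⟩
  have hq := noBaseQueries_iff.1 hq
  refine ⟨C, hC, D, hD, M, hc, hM, fun x n m c c' hr ha hr' => h1 x n m c c'
    (hq.reaches_congr_base hr) ha (hq.reaches_congr_base hr'), fun x => (h x).trans ⟨?_, ?_⟩⟩
  · rintro ⟨n, c, hr, hc⟩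
    exact ⟨n, c, hq.reaches_congr_base hr, hc⟩
  · rintro ⟨n, c, hr, hc⟩
    exact ⟨n, c, hq.reaches_congr_base hr, hc⟩

/-- With the correct first answer inserted, the verdict `W_d` for second answer `d` is in `NP ∩
coNP`. The language is `W_0 ⊕ (d ∧ (W_0 ⊕ W_1))` for the true `d`, which is an `NP` property; the
conjunction is then in `NP`. -/
theorem isXor_of_mem_pParallelNPRel {L : Language Bool} (hL : L ∈ PParallelNPRel A) :
    IsXor A (· ∈ L) := by
  classical
  obtain ⟨C, hC, D, hD, M, hc, hM, hO, h⟩ := hL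
  have hc := deterministic_iff.1 hc
  have hCA : InNPCoNP A (M.Asked ⟨A, C, D⟩ (fun i _ => i) (· ∈ C)) :=
    InNPCoNP.asked (O := ⟨A, C, D⟩) (mem_NP_inter_coNP_iff.1 hC) hM hc hO
  have hDA : InNP A (M.Asked ⟨A, C, D⟩ (fun _ j => j) (· ∈ D)) :=
    InNP.asked (O := ⟨A, C, D⟩) (mem_NP_iff.1 hD) hM hO
  have hV : ∀ a d, InNPCoNP A fun x => (fixAnswers a d M).Accepts (baseOnly A) x := fun a d =>
    inNPCoNP_accepts hc.fixAnswers avoids_ask_fixAnswers hM.fixAnswers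
  have hV' : ∀ d, InNPCoNP A _ := fun d =>
    (hCA.and (hV true d)).or (hCA.not.and (hV false d))
  refine ⟨_, _, hV' false, hDA.and ((hV' false).iff (hV' true)).not.1, fun x => ?_⟩
  refine (h x).trans ?_
  rw [accepts_iff_fixAnswers hM hc hO]
  by_cases h1 : M.Asked ⟨A, C, D⟩ (fun i _ => i) (· ∈ C) x <;>
    by_cases h2 : M.Asked ⟨A, C, D⟩ (fun _ j => j) (· ∈ D) x <;> simp only [h1, h2] <;> simp <;>
    tauto

/-- Ask both oracles about the input, and accept if the answers differ. -/
def askXor : Machine :=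
  [.ask (some 0) (some 0) fun a b => if a = b then 1 else 2, .halt false, .halt true]

theorem askXor_reaches {O : Oracles} {n : ℕ} {x : List Bool} {c : Cfg}
    (h : askXor.Reaches O n (initial x) c) : (n = 0 ∧ c = initial x) ∨
      (n = 1 ∧ c.state = if chi O.fst x = chi O.snd x then 1 else 2) := by
  cases h with
  | refl => exact .inl ⟨rfl, rfl⟩
  | @cons n _ c₁ _ b hb h =>
    have h0 : tapeString ((initial x).tapes 0) = x := tapeString_stk x
    have hs : (initial x).state = 0 := rfl
    simp only [step, instr, askXor, hs, List.getElem?_cons_zero, Option.getD_some, optAnswer, h0,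
      Option.some.injEq] at hb
    cases h with
    | refl => exact .inr ⟨rfl, by rw [← hb]⟩
    | cons b' hb' h =>
      rw [← hb] at hb'
      by_cases hO : chi O.fst x = chi O.snd x <;> simp [step, instr, askXor, hO] at hb'

theorem mem_pParallel_of_isXor {L : Language Bool} (h : IsXor A (· ∈ L)) :
    L ∈ PParallel (NP A ∩ coNP A) (NP A) := by
  classical
  obtain ⟨C, D, hC, hD, h⟩ := h
  refine ⟨languageOf C, mem_NP_inter_coNP_iff.2 hC, languageOf D, mem_NP_iff.2 hD, askXor,
    fun _ _ h => by simp [askXor] at h, fun _ _ h => by simp [askXor] at h,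
    ⟨1, fun O x n c hr => ?_⟩, fun x n m c c' hr ha hr' ha' => ?_, fun x => (h x).trans ⟨?_, ?_⟩⟩
  · rcases askXor_reaches hr with ⟨rfl, -⟩ | ⟨rfl, -⟩ <;> simp
  · rcases askXor_reaches (hr.trans hr') with ⟨hn, -⟩ | ⟨hn, hs⟩
    · omega
    · obtain ⟨i, j, q, ha'⟩ := ha'
      rw [hs] at ha'
      split_ifs at ha' <;> cases ha'
  · intro hx
    have h0 : tapeString ((initial x).tapes 0) = x := tapeString_stk x
    refine ⟨1, ⟨2, (initial x).tapes⟩, .cons false ?_ (.refl _), rfl⟩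
    have hs : (initial x).state = 0 := rfl
    simp only [step, instr, askXor, hs, List.getElem?_cons_zero, Option.getD_some, optAnswer, h0,
      chi, mem_languageOf, decide_eq_decide, hx, if_false]
  · rintro ⟨n, c, hr, hc⟩ hx
    rcases askXor_reaches hr with ⟨-, rfl⟩ | ⟨-, hs⟩
    · cases hc
    · have : chi (languageOf C) x = chi (languageOf D) x :=
        decide_eq_decide.2 hx
      rw [hs, if_pos this] at hc
      cases hc

theorem pParallelNPRel_eq : PParallelNPRel A = RSNNP A :=
  Set.ext fun _ => ⟨fun h => mem_RSNNP_iff.2 (isXor_of_mem_pParallelNPRel h),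
    fun h => pParallel_subset (mem_pParallel_of_isXor (mem_RSNNP_iff.1 h))⟩

theorem pParallel_eq : PParallel (NP A ∩ coNP A) (NP A) = RSNNP A :=
  Set.ext fun _ => ⟨fun h => mem_RSNNP_iff.2 (isXor_of_mem_pParallelNPRel (pParallel_subset h)),
    fun h => mem_pParallel_of_isXor (mem_RSNNP_iff.1 h)⟩

/-! ## Comparison of the reducibilities -/

variable {L B : Language Bool} {𝒞 : Set (Language Bool)}

theorem HasComplete.mono {le le' : Language Bool → Language Bool → Prop} (h : ∀ B L, le B L → le' B L)
    (hc : HasComplete 𝒞 le) : HasComplete 𝒞 le' := by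
  obtain ⟨L, hL, hc⟩ := hc
  exact ⟨L, hL, fun B hB => h _ _ (hc B hB)⟩

theorem LeM.leMRel (h : LeM B L) : LeMRel A B L := by
  obtain ⟨f, hf, h⟩ := h
  exact ⟨f, fp_subset_fpRel hf, h⟩

theorem LeOneTT.leOneTTRel (h : LeOneTT B L) : LeOneTTRel A B L := by
  obtain ⟨α, y, hf, h⟩ := h
  exact ⟨α, y, fp_subset_fpRel hf, h⟩

/-- Stated for arbitrary tapes, as the output tape of a general machine is not a stack; a symbol is
prepended by overwriting the cell to the left of the head. -/
theorem tapeString_push (T : Tape (Option Bool)) (b : Bool) :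
    tapeString ((T.move .left).write (some b)) = b :: tapeString T := by
  obtain ⟨R, hR⟩ : ∃ R, T.right₀ = ListBlank.mk R := T.right₀.induction_on fun R => ⟨R, rfl⟩
  rw [← T.mk'_left_right₀, hR, Tape.move_left_mk', Tape.write_mk', ListBlank.cons_mk,
    ListBlank.tail_mk, List.tail_cons, ListBlank.cons_mk,
    tapeString_mk', tapeString_mk']
  rfl

/-- Put the truth table of the identity in front of the output of a machine. -/
theorem exists_machine_cons_cons (M : Machine) (hM : M.PolyTime) : ∃ N : Machine, N.PolyTime ∧
    (∀ f, M.Avoids f → N.Avoids f) ∧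
    ∀ O x y, M.AcceptsWithOutput O x y → N.AcceptsWithOutput O x (false :: true :: y) := by
  obtain ⟨P, hP⟩ := hM.ensures
  have hw : ∀ O (T : Store), ∃ T', (seq (push 1 true) (push 1 false)).Computes O T 10 true T' ∧
      tapeString (T' 1) = false :: true :: tapeString (T 1) := fun O T =>
    ⟨_, Computes.seq_le (computes_push_raw 1 true) (computes_push_raw 1 false) le_rfl, by
      simp [tapeString_push]⟩
  refine ⟨seq M (seq (push 1 true) (push 1 false)), polyTime_of_ensures (P + 12) fun O x =>
    ⟨fun _ _ => True, ?_⟩, fun f hf => hf.seq (avoids_push.seq avoids_push), ?_⟩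
  · refine (wp_seq (m := 10) ((hP O x).mono le_rfl fun b T _ => ?_)).mono' (by simp)
    obtain ⟨T', h, -⟩ := hw O T
    exact h.wp trivial
  · rintro O x y ⟨n, c, h1, h2, rfl⟩
    obtain ⟨T', h, hT'⟩ := hw O c.tapes
    have : (seq M (seq (push 1 true) (push 1 false))).can O (initial x).tapes fun b T =>
        b = true ∧ tapeString (T 1) = false :: true :: tapeString (c.tapes 1) :=
      can_seq ⟨n, c, true, h1, h2, h.can ⟨rfl, hT'⟩⟩
    obtain ⟨n, c, b, h1, h2, rfl, h3⟩ := this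
    exact ⟨n, c, h1, h2, h3⟩

theorem ManyOneVia.oneTTVia {F : Set (List Bool → List Bool)}
    (hF : ∀ f ∈ F, (fun x => false :: true :: f x) ∈ F) (h : ManyOneVia F B L) : OneTTVia F B L := by
  obtain ⟨f, hf, h⟩ := h
  exact ⟨fun _ b => b, f, hF f hf, fun x => (h x).trans (by simp [chi])⟩

theorem LeM.leOneTT (h : LeM B L) : LeOneTT B L := by
  refine ManyOneVia.oneTTVia ?_ h
  rintro f ⟨M, hc, hq, ha, hM, hf⟩
  obtain ⟨N, hN, h1, h2⟩ := exists_machine_cons_cons M hM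
  rw [deterministic_iff] at hc
  rw [noBaseQueries_iff] at hq
  rw [noParallelQueries_iff] at ha
  exact ⟨N, deterministic_iff.2 (h1 _ hc), noBaseQueries_iff.2 (h1 _ hq),
    noParallelQueries_iff.2 (h1 _ ha), hN, fun x => h2 _ _ _ (hf x)⟩

theorem LeMRel.leOneTTRel (h : LeMRel A B L) : LeOneTTRel A B L := by
  refine ManyOneVia.oneTTVia ?_ h
  rintro f ⟨M, hc, ha, hM, hf⟩
  obtain ⟨N, hN, h1, h2⟩ := exists_machine_cons_cons M hM
  rw [deterministic_iff] at hc
  rw [noParallelQueries_iff] at ha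
  exact ⟨N, deterministic_iff.2 (h1 _ hc), noParallelQueries_iff.2 (h1 _ ha), hN,
    fun x => h2 _ _ _ (hf x)⟩

/-- A set that is complete in the weakest sense yields one that is complete in the strongest
sense: evaluate the truth tables produced by a universal function. -/
theorem HasComplete.leM (h : HasComplete (RSNNP A) (LeOneTTRel A)) : HasComplete (RSNNP A) LeM := by
  obtain ⟨L, hL, h⟩ := h
  obtain ⟨u, hu, hu'⟩ := exists_universal A
  refine ⟨languageOf fun w => EvalTable (· ∈ L) (u w),
    mem_RSNNP_iff.2 ((mem_RSNNP_iff.1 hL).evalTable (fpRel_subset_npsvRel hu)), fun B hB => ?_⟩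
  obtain ⟨f, hf, hB⟩ := (h B hB).evalTable
  obtain ⟨g, hg, hgf⟩ := hu' f hf
  exact ⟨g, hg, fun x => by rw [hB, mem_languageOf, hgf]⟩

theorem hasComplete_tfae (A : Language Bool) :
    List.TFAE
      [ HasComplete (RSNNP A) (LeOneTTRel A), HasComplete (RSNNP A) LeOneTT,
        HasComplete (RSNNP A) (LeMRel A), HasComplete (RSNNP A) LeM ] := by
  tfae_have 4 → 3 := HasComplete.mono fun _ _ => LeM.leMRel
  tfae_have 4 → 2 := HasComplete.mono fun _ _ => LeM.leOneTT
  tfae_have 3 → 1 := HasComplete.mono fun _ _ => LeMRel.leOneTTRel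
  tfae_have 2 → 1 := HasComplete.mono fun _ _ => LeOneTT.leOneTTRel
  -- The only implication with content; the others compare strengths of reductions.
  tfae_have 1 → 4 := HasComplete.leM
  tfae_finish

end RelComplexity

theorem theoremt (A : Language Bool) :
    List.TFAE
      [ HasComplete (RSNNP A) (LeOneTTRel A),
        HasComplete (RSNNP A) LeOneTT,
        HasComplete (RSNNP A) (LeMRel A),
        HasComplete (RSNNP A) LeM,
        HasComplete (PParallelNPRel A) (LeOneTTRel A),
        HasComplete (PParallelNPRel A) LeOneTT,
        HasComplete (PParallelNPRel A) (LeMRel A),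
        HasComplete (PParallelNPRel A) LeM,
        HasComplete (PParallel (NP A ∩ coNP A) (NP A)) (LeOneTTRel A),
        HasComplete (PParallel (NP A ∩ coNP A) (NP A)) LeOneTT,
        HasComplete (PParallel (NP A ∩ coNP A) (NP A)) (LeMRel A),
        HasComplete (PParallel (NP A ∩ coNP A) (NP A)) LeM ] := by
  -- The classes coincide, so only the four reducibilities remain, and each statement can be
  -- rewritten into the first.
  rw [pParallelNPRel_eq, pParallel_eq]
  have h := hasComplete_tfae A
  have h2 := (h.out 0 1 :)
  have h3 := (h.out 0 2 :)
  have h4 := (h.out 0 3 :)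
  rw [← h2, ← h3, ← h4]
  exact List.tfae_of_forall _ _ fun _ h => by simpa using h
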